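/- **Definitions.** A *fat graph* is a finite connected graph (loops and multiple edges allowed), all of whose vertices are at least trivalent, with a cyclic ordering of the half-edges at each vertex. Its *boundary cycles* are the cycles of oriented edges obtained by traversing an oriented edge to its terminal vertex and continuing along the next edge in the cyclic ordering there, oriented away from that vertex. The graph represents a surface of genus $g$ with $n$ boundary components if it has $n$ boundary cycles and $V-E+n=2-2g$, where $V$ and $E$ are the numbers of vertices and edges. A *Sullivan chord diagram of type $(g;p,q)$* is a fat graph $c$ representing a surface of genus $g$ with $p+q$ boundary components, with its boundary cycles ordered and the first $p$ called incoming and the last $q$ outgoing, such that the $p$ incoming boundary cycles are pairwise disjoint embedded closed circles and the remaining edges (the *ghost edges*) form a disjoint union of trees. Let $S(c)$ be the fat graph obtained from $c$ by collapsing every ghost edge. A *marked metric chord diagram* is a chord diagram $c$ with a positive length on each edge and a *marking*: a choice of a point on each of the $p+q$ boundary cycles of $S(c)$, regarded as metric circles. Let $\mathcal{CF}^\mu_{p,q}(g)$ be the set of isomorphism classes of marked metric chord diagrams of type $(g;p,q)$, where isomorphisms preserve the cyclic orderings, the ordering of the boundary cycles, the lengths and the markings. It is topologized as follows. For a chord diagram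 $c$ of type $(g;p,q)$, let $X_c$ be the space of pairs consisting of a function $\ell\ge 0$ on the edges of $c$, such that the edges of length $0$ form a forest whose collapse gives again a chord diagram of type $(g;p,q)$, and a choice of a point on each boundary cycle of $S(c)$ (with the metric $\ell$). Collapsing the edges of length $0$ defines a map $X_c\to\mathcal{CF}^\mu_{p,q}(g)$, and $\mathcal{CF}^\mu_{p,q}(g)$ carries the quotient topology from the disjoint union of all the $X_c$. **Theorem.** Let $g\ge 0$ and $p,q\ge 1$ be integers with $(g,p,q)\ne(0,1,1)$. Then the space $\mathcal{CF}^\mu_{p,q}(g)$ of marked metric Sullivan chord diagrams of type $(g;p,q)$ is non-empty and path connected. -/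

import Mathlib

namespace StringTopology

/-! ### First return maps -/

section FirstReturn

variable {α : Type} [Finite α]

theorem exists_return (f : Equiv.Perm α) {K : Set α} {a : α} (ha : a ∈ K) :
    ∃ n : ℕ, 0 < n ∧ (f ^ n) a ∈ K :=
  ⟨orderOf f, orderOf_pos f, by rw [pow_orderOf_eq_one]; exact ha⟩

open Classical in
/-- The least `n ≥ 1` such that `f ^ n` maps the point `a` of `K` back into `K`. -/
noncomputable def returnTime (f : Equiv.Perm α) (K : Set α) (a : K) : ℕ :=
  Nat.find (exists_return f a.2)

open Classical in
theorem returnTime_spec (f : Equiv.Perm α) (K : Set α) (a : K) :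
    0 < returnTime f K a ∧ (f ^ returnTime f K a) a ∈ K :=
  Nat.find_spec (exists_return f a.2)

open Classical in
theorem returnTime_le (f : Equiv.Perm α) (K : Set α) (a : K) {n : ℕ} (hn : 0 < n)
    (h : (f ^ n) (a : α) ∈ K) : returnTime f K a ≤ n :=
  Nat.find_min' (exists_return f a.2) ⟨hn, h⟩

theorem firstReturn_injective (f : Equiv.Perm α) (K : Set α) :
    Function.Injective
      (fun a : K => (⟨(f ^ returnTime f K a) a, (returnTime_spec f K a).2⟩ : K)) := by
  have key : ∀ a b : K, returnTime f K a ≤ returnTime f K b →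
      (f ^ returnTime f K a) (a : α) = (f ^ returnTime f K b) (b : α) → a = b := by
    intro a b hle h
    obtain ⟨d, hd⟩ := Nat.exists_eq_add_of_le hle
    rw [hd, pow_add, Equiv.Perm.mul_apply] at h
    have hab : (a : α) = (f ^ d) (b : α) := (f ^ returnTime f K a).injective h
    rcases Nat.eq_zero_or_pos d with h0 | h0
    · subst h0
      exact Subtype.ext (by simpa using hab)
    · have h1 := returnTime_le f K b h0 (hab ▸ a.2)
      have h2 := (returnTime_spec f K a).1
      omega
  intro a b h
  have h' : (f ^ returnTime f K a) (a : α) = (f ^ returnTime f K b) (b : α) :=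
    congrArg Subtype.val h
  rcases le_total (returnTime f K a) (returnTime f K b) with hle | hle
  · exact key a b hle h'
  · exact (key b a hle h'.symm).symm

/-- The permutation of `K` obtained from the permutation `f` of `α` by deleting from the cycles of
`f` all elements that are not in `K`: it maps `a ∈ K` to the first of `f a`, `f (f a)`, … that lies
in `K`. -/
noncomputable def firstReturn (f : Equiv.Perm α) (K : Set α) : Equiv.Perm K :=
  Equiv.ofBijective _ (Finite.injective_iff_bijective.1 (firstReturn_injective f K))

end FirstReturn

/-! ### Graphs with cyclic orderings -/

/-- A finite graph with a cyclic ordering of the edges coming into each vertex, together with a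
labelling of its oriented edges by elements of `ι`. The graph is given by its set `Dart` of oriented
edges; an oriented edge `h` is also regarded as the half-edge at its initial vertex. `rev` reverses
the orientation, and `rot` maps a half-edge to the next one in the cyclic ordering at its vertex.
So the vertices are the cycles of `rot`, and the edges are the cycles `{h, rev h}` of `rev`. -/
structure RibbonGraph (ι : Type) where
  Dart : Type
  [finite : Finite Dart]
  rev : Equiv.Perm Dart
  rot : Equiv.Perm Dart
  rev_rev : ∀ h, rev (rev h) = h
  rev_ne : ∀ h, rev h ≠ h
  label : Dart → ι

attribute [instance] RibbonGraph.finite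

namespace RibbonGraph

variable {ι : Type} (Γ : RibbonGraph ι)

/-- The vertices: the cycles of `rot`. -/
abbrev Vertex : Type := Quotient (Equiv.Perm.SameCycle.setoid Γ.rot)

/-- The (unoriented) edges: the cycles of `rev`. -/
abbrev Edge : Type := Quotient (Equiv.Perm.SameCycle.setoid Γ.rev)

/-- Traverse the oriented edge `h`, arriving at its terminal vertex along `rev h`, and go on with the
next edge in the cyclic ordering there, oriented away from the vertex. The cycles of this
permutation are the boundary cycles of the graph. -/
def bdry : Equiv.Perm Γ.Dart := Γ.rot * Γ.rev

/-- `Γ.Joined S h k`: the initial vertices of `h` and `k` are joined by a path all of whose edges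
are in `S`. -/
def Joined (S : Set Γ.Dart) : Γ.Dart → Γ.Dart → Prop :=
  Relation.EqvGen fun h k => k = Γ.rot h ∨ (h ∈ S ∧ k = Γ.rev h)

/-- The edges in `S` form a forest (a disjoint union of trees): no edge in `S` has its two ends
joined by a path of other edges in `S`, that is, there is no cycle of edges in `S`. -/
def IsForest (S : Set Γ.Dart) : Prop :=
  ∀ h ∈ S, ¬ Γ.Joined (S \ {h, Γ.rev h}) h (Γ.rev h)

/-- The oriented edges that remain when the edges in `S` are removed. -/
def kept (S : Set Γ.Dart) : Set Γ.Dart := {h | h ∉ S ∧ Γ.rev h ∉ S}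

theorem rev_mem_kept {S : Set Γ.Dart} {h : Γ.Dart} (hh : h ∈ Γ.kept S) : Γ.rev h ∈ Γ.kept S :=
  ⟨hh.2, by rw [Γ.rev_rev]; exact hh.1⟩

/-- Orientation reversal on the edges that are not in `S`. -/
def revKept (S : Set Γ.Dart) : Equiv.Perm (Γ.kept S) where
  toFun h := ⟨Γ.rev h, Γ.rev_mem_kept h.2⟩
  invFun h := ⟨Γ.rev h, Γ.rev_mem_kept h.2⟩
  left_inv h := Subtype.ext (Γ.rev_rev h)
  right_inv h := Subtype.ext (Γ.rev_rev h)

/-- The graph obtained by collapsing every edge in a forest `S`, with the induced cyclic orderings: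
those for which the boundary cycles of the collapsed graph are the boundary cycles of `Γ` with the
oriented edges of `S` deleted. -/
noncomputable def collapse (S : Set Γ.Dart) : RibbonGraph ι where
  Dart := Γ.kept S
  rev := Γ.revKept S
  rot := firstReturn Γ.bdry (Γ.kept S) * Γ.revKept S
  rev_rev h := Subtype.ext (Γ.rev_rev h)
  rev_ne h e := Γ.rev_ne h (congrArg Subtype.val e)
  label h := Γ.label h

/-- An isomorphism of graphs with cyclic orderings and labels. -/
structure Iso (Γ Γ' : RibbonGraph ι) where
  toEquiv : Γ.Dart ≃ Γ'.Dart
  map_rev : ∀ h, toEquiv (Γ.rev h) = Γ'.rev (toEquiv h)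
  map_rot : ∀ h, toEquiv (Γ.rot h) = Γ'.rot (toEquiv h)
  map_label : ∀ h, Γ'.label (toEquiv h) = Γ.label h

/-- A connected fat graph whose boundary cycles are indexed by `ι`: all vertices are at least
trivalent, and `label` gives a bijection from the boundary cycles to `ι`. -/
structure IsFatGraph : Prop where
  nonempty : Nonempty Γ.Dart
  connected : ∀ h k, Γ.Joined Set.univ h k
  trivalent : ∀ h, Γ.rot h ≠ h ∧ Γ.rot (Γ.rot h) ≠ h
  label_eq_iff : ∀ h k, Γ.label h = Γ.label k ↔ Γ.bdry.SameCycle h k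
  label_surjective : Function.Surjective Γ.label

/-! ### Sullivan chord diagrams

The labels are now `Fin p ⊕ Fin q`: the boundary cycles labelled by `Fin p` are incoming, those
labelled by `Fin q` are outgoing. -/

variable {p q : ℕ} (G : RibbonGraph (Fin p ⊕ Fin q))

/-- The oriented edge belongs to an incoming boundary cycle. -/
def IsIncoming (h : G.Dart) : Prop := ∃ i : Fin p, G.label h = Sum.inl i

/-- The ghost edges: those which, in neither orientation, lie on an incoming boundary cycle. All
other edges are circular. -/
def ghost : Set G.Dart := {h | ¬ G.IsIncoming h ∧ ¬ G.IsIncoming (G.rev h)}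

/-- A Sullivan chord diagram of type `(g; p, q)` with ordered boundary cycles: a fat graph
representing a surface of genus `g` with `p + q` boundary components, whose incoming boundary cycles
are disjoint closed circles, and whose other edges form a disjoint union of trees. (As all vertices
are at least trivalent, the endpoints of these trees lie on the circles.) -/
structure IsChordDiagram (g : ℕ) : Prop extends G.IsFatGraph where
  euler : (Nat.card G.Vertex : ℤ) - Nat.card G.Edge + (p + q) = 2 - 2 * g
  /-- Any vertex is passed at most once by the incoming boundary cycles taken together. -/
  circles : ∀ h k, G.IsIncoming h → G.IsIncoming k → G.rot.SameCycle h k → h = k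
  forest : G.IsForest G.ghost

/-- The graph `S(c)` obtained from a chord diagram `c` by collapsing all ghost edges. -/
noncomputable def core : RibbonGraph (Fin p ⊕ Fin q) := G.collapse G.ghost

/-- The choice of an oriented edge of `S(c)` on every boundary cycle of `S(c)`. -/
abbrev MarkedEdges : Type := {m : Fin p ⊕ Fin q → G.core.Dart // ∀ i, G.core.label (m i) = i}

end RibbonGraph

/-! ### The space of marked metric chord diagrams -/

section Space

variable {g p q : ℕ}

/-- The combinatorial part of a chart: a Sullivan chord diagram `c` of type `(g; p, q)`, and for
every boundary cycle of `S(c)` an edge on it, which is to carry the marked point. -/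
structure MarkedDiagram (g p q : ℕ) where
  graph : RibbonGraph (Fin p ⊕ Fin q)
  isChordDiagram : graph.IsChordDiagram g
  edge : graph.MarkedEdges

/-- The oriented edge of the diagram that carries the marked point of the `i`-th boundary cycle. -/
def MarkedDiagram.dart (D : MarkedDiagram g p q) (i : Fin p ⊕ Fin q) : D.graph.Dart :=
  Subtype.val (p := (· ∈ D.graph.kept D.graph.ghost)) (D.edge.1 i)

/-- The chart of a marked diagram, a subspace of a Euclidean space. A point of it consists of the
lengths of the edges and, for every `i`, the distance of the `i`-th marked point from the initial
vertex of the oriented edge carrying it. The edges of length zero, which have to be collapsed, must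
form a forest, and collapsing them must give a chord diagram of type `(g; p, q)` again. -/
def Chart (D : MarkedDiagram g p q) : Type :=
  {x : (D.graph.Dart → ℝ) × (Fin p ⊕ Fin q → ℝ) //
    (∀ h, 0 ≤ x.1 h) ∧ (∀ h, x.1 (D.graph.rev h) = x.1 h) ∧
    D.graph.IsForest {h | x.1 h = 0} ∧ (D.graph.collapse {h | x.1 h = 0}).IsChordDiagram g ∧
    ∀ i, 0 ≤ x.2 i ∧ x.2 i ≤ x.1 (D.dart i)}

instance (D : MarkedDiagram g p q) : TopologicalSpace (Chart D) :=
  inferInstanceAs (TopologicalSpace (Subtype _))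

/-- The lengths of the edges. -/
def Chart.len {D : MarkedDiagram g p q} (x : Chart D) : D.graph.Dart → ℝ := x.1.1

/-- The positions of the marked points on the edges that carry them. -/
def Chart.pos {D : MarkedDiagram g p q} (x : Chart D) : Fin p ⊕ Fin q → ℝ := x.1.2

/-- The edges of length zero. -/
def Chart.zero {D : MarkedDiagram g p q} (x : Chart D) : Set D.graph.Dart := {h | x.len h = 0}

/-- The identifications between points of the charts. -/
inductive Glue : (Σ D : MarkedDiagram g p q, Chart D) → (Σ D : MarkedDiagram g p q, Chart D) → Prop
  /-- On a boundary cycle of `S(c)`, the terminal point of an oriented edge is the initial point of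
  the next one. -/
  | slide (Γ : RibbonGraph (Fin p ⊕ Fin q)) (hΓ : Γ.IsChordDiagram g) (m n : Γ.MarkedEdges)
      (x : Chart ⟨Γ, hΓ, m⟩) (y : Chart ⟨Γ, hΓ, n⟩) (hlen : x.len = y.len)
      (hmark : ∀ i, (n.1 i = m.1 i ∧ y.pos i = x.pos i) ∨
        (n.1 i = Γ.core.bdry (m.1 i) ∧ x.pos i = x.len (MarkedDiagram.dart ⟨Γ, hΓ, m⟩ i) ∧
          y.pos i = 0)) :
      Glue ⟨⟨Γ, hΓ, m⟩, x⟩ ⟨⟨Γ, hΓ, n⟩, y⟩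
  /-- A metric chord diagram some of whose edges have length zero (and do not carry a marked point)
  is identified with any diagram isomorphic to the one in which these edges have been collapsed. In
  particular, isomorphic marked metric chord diagrams are identified. -/
  | collapse (D E : MarkedDiagram g p q) (x : Chart D) (y : Chart E)
      (e : (D.graph.collapse x.zero).Iso E.graph)
      (hlen : ∀ h : D.graph.kept x.zero, y.len (e.toEquiv h) = x.len h)
      (hdart : ∀ i, ∃ h : D.graph.kept x.zero, h = D.dart i ∧ e.toEquiv h = E.dart i)
      (hpos : y.pos = x.pos) :
      Glue ⟨D, x⟩ ⟨E, y⟩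

/-- The space of marked metric Sullivan chord diagrams of type `(g; p, q)`. Its points are the
isomorphism classes of chord diagrams with positive edge lengths and with a marked point on every
boundary cycle of `S(c)`; its topology is the quotient topology from the disjoint union of the
charts. -/
def MarkedChordDiagramSpace (g p q : ℕ) : Type 1 :=
  Quot (Glue (g := g) (p := p) (q := q))

instance (g p q : ℕ) : TopologicalSpace (MarkedChordDiagramSpace g p q) :=
  inferInstanceAs (TopologicalSpace (Quot _))

end Space

end StringTopology

/-!
A point of the space can be moved, within a chart, to any point at which the edge lengths are
arbitrary positive numbers, since a chart contains the segment from such a point to each of its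
points; the marked points can be slid along the boundary cycles of `S(c)`; and letting the lengths
of the edges of a forest tend to zero leads from a diagram to the collapsed one. Hence the space is
path connected as soon as chord diagrams exist and any two of them are linked by collapses of
forests and their inverses (`pathConnectedSpace_of_linked`).

The graph `S(c)` consists of the incoming circles, with some of their vertices identified, and of a
cyclic ordering at every vertex. It is encoded as a pair of permutations `inn`, `out` of its set of
edges, whose cycles are the incoming and the outgoing boundary cycles (`Core`); the cycles of
`tau = inn * out` are its vertices. The diagrams with a given `S(c)` differ by their ghost edges
only. They are all linked: splitting trivalent vertices off the circles and then contracting the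
ghost edges between the remaining vertices replaces the ghost trees by stars, and such a diagram is
determined by its core (`RibbonGraph.HasCore.linked`). Conversely, a core in which every vertex
lies on at least two circles, or twice on the same circle, comes from a star-shaped diagram
(`RibbonGraph.isWeakDiagram_starGraph`).

In a diagram of this reduced form, an edge of a circle that is not a loop of the core can be
contracted. So every diagram is linked to one whose core has a single vertex
(`RibbonGraph.HasCore.exists_isOneVertex`), and by the Euler characteristic such a core has
`2g + p + q - 1` edges. It remains to connect one-vertex cores of equal size by moves that insert an
edge, producing a second vertex, and then contract another edge (`Core.related_of_card_eq`). If
`p > 1`, such moves shrink an incoming cycle until it has length one (`IsOneVertex.exists_fixed`),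
and a cycle of length one can be left out of consideration because moves of the remaining core
extend to it and because it can be moved to every other place (`Related.addLoop`). By the symmetry
between `inn` and `out`, the same applies to the outgoing cycles. For `p = q = 1`, the moves
make `inn` and `out` agree on longer and longer intervals, until they are equal
(`IsOneVertex.exists_inn_eq_out`), and then the core is determined by its size.
-/

namespace StringTopology

/-! ### Permutations and first returns -/

section Next

variable {α : Type}

/-- `Next f L a b`: the point `b` is the first of `f a`, `f (f a)`, … that lies in `L`. -/
inductive Next (f : Equiv.Perm α) (L : Set α) : α → α → Prop
  | here {a b : α} : f a = b → b ∈ L → Next f L a b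
  | skip {a b : α} : f a ∉ L → Next f L (f a) b → Next f L a b

theorem Next.mem {f : Equiv.Perm α} {L : Set α} {a b : α} (h : Next f L a b) : b ∈ L := by
  induction h with
  | here _ h => exact h
  | skip _ _ ih => exact ih

theorem Next.unique {f : Equiv.Perm α} {L : Set α} {a b c : α} (h : Next f L a b)
    (h' : Next f L a c) : b = c := by
  induction h with
  | here e hb =>
    cases h' with
    | here e' _ => exact e.symm.trans e'
    | skip hn _ => exact absurd (e ▸ hb) hn
  | skip hn _ ih =>
    cases h' with
    | here e' hc => exact absurd (e' ▸ hc) hn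
    | skip _ h' => exact ih h'

theorem Next.sameCycle {f : Equiv.Perm α} {L : Set α} {a b : α} (h : Next f L a b) :
    f.SameCycle a b := by
  induction h with
  | here e _ => exact ⟨1, by simpa using e⟩
  | skip _ _ ih => exact (Equiv.Perm.sameCycle_apply_left).1 ih

theorem Next.trans {f : Equiv.Perm α} {L L' : Set α} (hL : L' ⊆ L) {a b c : α} (h : Next f L a b)
    (hb : b ∉ L') (h' : Next f L' b c) : Next f L' a c := by
  induction h with
  | here e _ => subst e; exact .skip hb h'
  | skip hn _ ih => exact .skip (fun h => hn (hL h)) (ih hb h')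

theorem Next.mono {f : Equiv.Perm α} {L L' : Set α} (hL : L' ⊆ L) {a b : α} (h : Next f L a b)
    (hb : b ∈ L') : Next f L' a b := by
  induction h with
  | here e _ => exact .here e hb
  | skip hn _ ih => exact .skip (fun h => hn (hL h)) (ih hb)

theorem next_pow (f : Equiv.Perm α) (L : Set α) (n : ℕ) : ∀ a : α, 0 < n → (f ^ n) a ∈ L →
    (∀ i, 0 < i → i < n → (f ^ i) a ∉ L) → Next f L a ((f ^ n) a) := by
  induction n with
  | zero => intro a h; omega
  | succ n ih =>
    intro a _ hm hi
    rcases Nat.eq_zero_or_pos n with h0 | h0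
    · subst h0; exact .here (by simp) hm
    · have h1 : ∀ i, (f ^ (i + 1)) a = (f ^ i) (f a) := fun i => by
        rw [pow_succ, Equiv.Perm.mul_apply]
      refine .skip ?_ ?_
      · simpa using hi 1 one_pos (by omega)
      · rw [h1] at hm ⊢
        exact ih (f a) h0 hm fun i hi0 hin => by rw [← h1]; exact hi _ (by omega) (by omega)

variable [Finite α]

theorem next_firstReturn (f : Equiv.Perm α) (K : Set α) (a : K) :
    Next f K a (firstReturn f K a) :=
  next_pow f K _ _ (returnTime_spec f K a).1 (returnTime_spec f K a).2 fun i h0 hi hm =>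
    absurd (returnTime_le f K a h0 hm) (by omega)

theorem firstReturn_eq_iff {f : Equiv.Perm α} {K : Set α} {a b : K} :
    firstReturn f K a = b ↔ Next f K a b :=
  ⟨fun h => h ▸ next_firstReturn f K a,
    fun h => Subtype.ext ((next_firstReturn f K a).unique h)⟩

theorem exists_pow_eq_of_sameCycle {f : Equiv.Perm α} {a b : α} (h : f.SameCycle a b) :
    ∃ n : ℕ, (f ^ n) a = b := by
  obtain ⟨n, -, hn⟩ := h.exists_pow_eq'
  exact ⟨n, hn⟩

/-- A set that a permutation of a finite type maps into itself is a union of cycles. -/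
theorem mem_of_sameCycle {f : Equiv.Perm α} {W : Set α} (hW : ∀ a ∈ W, f a ∈ W) {a b : α}
    (h : f.SameCycle a b) (ha : a ∈ W) : b ∈ W := by
  obtain ⟨n, rfl⟩ := exists_pow_eq_of_sameCycle h
  clear h
  induction n with
  | zero => simpa using ha
  | succ n ih => rw [pow_succ', Equiv.Perm.mul_apply]; exact hW _ ih

theorem exists_next {f : Equiv.Perm α} {L : Set α} {a b : α} (h : f.SameCycle a b) (hb : b ∈ L) :
    ∃ c, Next f L a c := by
  classical
  have : ∃ n : ℕ, 0 < n ∧ (f ^ n) a ∈ L := by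
    obtain ⟨n, hn⟩ := exists_pow_eq_of_sameCycle h
    exact ⟨n + orderOf f, by have := orderOf_pos f; omega, by
      rw [pow_add, pow_orderOf_eq_one, mul_one, hn]; exact hb⟩
  exact ⟨_, next_pow f L (Nat.find this) a (Nat.find_spec this).1 (Nat.find_spec this).2
    fun i h0 hi hm => Nat.find_min this hi ⟨h0, hm⟩⟩

/-- Deleting points from the cycles of a permutation does not change which of the other points lie
on the same cycle. -/
theorem sameCycle_firstReturn {f : Equiv.Perm α} {K : Set α} {a b : K} :
    (firstReturn f K).SameCycle a b ↔ f.SameCycle (a : α) b := by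
  constructor
  · intro h
    obtain ⟨n, rfl⟩ := exists_pow_eq_of_sameCycle h
    clear h
    induction n with
    | zero => exact Equiv.Perm.SameCycle.refl _ _
    | succ n ih =>
      rw [pow_succ', Equiv.Perm.mul_apply]
      exact ih.trans (next_firstReturn f K _).sameCycle
  · intro h
    have key : ∀ c d : α, f.SameCycle c d → ∀ (hd : d ∈ K) (c' : K),
        (c = c' ∨ Next f K c c') → (firstReturn f K).SameCycle c' ⟨d, hd⟩ := by
      intro c d hcd hd
      obtain ⟨n, hn⟩ := exists_pow_eq_of_sameCycle hcd
      clear hcd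
      induction n generalizing c with
      | zero =>
        have hn : c = d := by simpa using hn
        subst hn
        rintro c' (h | h)
        · have : c' = ⟨c, hd⟩ := Subtype.ext h.symm
          rw [this]
        · have : firstReturn f K ⟨c, hd⟩ = c' := firstReturn_eq_iff.2 h
          rw [← this]
          exact Equiv.Perm.sameCycle_apply_left.2 (Equiv.Perm.SameCycle.refl _ _)
      | succ n ih =>
        intro c' hc
        rw [pow_succ, Equiv.Perm.mul_apply] at hn
        rcases hc with hc | hc
        · have h2 := next_firstReturn f K c'
          have : (firstReturn f K).SameCycle (firstReturn f K c') ⟨d, hd⟩ := by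
            refine ih (f c) hn _ ?_
            rw [← hc] at h2
            cases h2 with
            | here e _ => exact Or.inl e
            | skip _ h2 => exact Or.inr h2
          exact Equiv.Perm.sameCycle_apply_left.1 this
        · refine ih (f c) hn _ ?_
          cases hc with
          | here e _ => exact Or.inl e
          | skip _ h2 => exact Or.inr h2
    exact key a b h b.2 a (Or.inl rfl)

theorem next_firstReturn_iff {f : Equiv.Perm α} {K L : Set α} (hL : L ⊆ K) {a b : K} :
    Next (firstReturn f K) {c | (c : α) ∈ L} a b ↔ Next f L a b := by
  have h1 : ∀ a b : K, Next (firstReturn f K) {c | (c : α) ∈ L} a b → Next f L a b := by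
    intro a b h
    induction h with
    | @here a b e hb =>
      subst e; exact (next_firstReturn f K _).mono hL hb
    | skip hn _ ih => exact (next_firstReturn f K _).trans hL hn ih
  refine ⟨h1 a b, fun h => ?_⟩
  obtain ⟨c, hc⟩ := exists_next (sameCycle_firstReturn.2 h.sameCycle)
    (show b ∈ {c : K | (c : α) ∈ L} from h.mem)
  have : b = c := Subtype.ext (h.unique (h1 _ _ hc))
  rwa [this]

end Next

/-- Joining two distinct classes `u`, `v` of an equivalence relation lowers the number of classes
by one. The joined relation may be given on another type `β` that meets all its classes. -/
theorem card_quotient_join {α β : Type} [Finite α] (r : Setoid α) (s : Setoid β) (i : β → α)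
    (u v : α) (huv : ¬ r u v)
    (hs : ∀ b c, s b c ↔ r (i b) (i c) ∨ (r (i b) u ∧ r (i c) v) ∨ (r (i b) v ∧ r (i c) u))
    (hi : ∀ a, ¬ r a v → ¬ r a u → ∃ b, r a (i b)) (hu : ∃ b, r u (i b) ∨ r v (i b)) :
    Nat.card (Quotient s) + 1 = Nat.card (Quotient r) := by
  classical
  have hT : Nat.card {c : Quotient r // c ≠ ⟦v⟧} + 1 = Nat.card (Quotient r) := by
    rw [← Finite.card_option]
    exact Nat.card_congr (Equiv.optionSubtypeNe _)
  rw [← hT]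
  congr 1
  let F : β → {c : Quotient r // c ≠ ⟦v⟧} := fun b =>
    if h : r (i b) v then ⟨⟦u⟧, fun e => huv (Quotient.exact e)⟩
    else ⟨⟦i b⟧, fun e => h (Quotient.exact e)⟩
  have hF : ∀ b c, s b c ↔ F b = F c := by
    intro b c
    rw [hs]
    by_cases hb : r (i b) v <;> by_cases hc : r (i c) v
    · simp only [F, dif_pos hb, dif_pos hc, iff_true]
      exact Or.inl (r.trans hb (r.symm hc))
    · simp only [F, dif_pos hb, dif_neg hc, Subtype.mk.injEq]
      rw [Quotient.eq]
      constructor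
      · rintro (h | ⟨h, h'⟩ | ⟨h, h'⟩)
        · exact absurd (r.trans (r.symm h) hb) hc
        · exact absurd h' hc
        · exact r.symm h'
      · intro h; exact Or.inr (Or.inr ⟨hb, r.symm h⟩)
    · simp only [F, dif_neg hb, dif_pos hc, Subtype.mk.injEq]
      rw [Quotient.eq]
      constructor
      · rintro (h | ⟨h, h'⟩ | ⟨h, h'⟩)
        · exact absurd (r.trans h hc) hb
        · exact h
        · exact absurd h hb
      · intro h; exact Or.inr (Or.inl ⟨h, hc⟩)
    · simp only [F, dif_neg hb, dif_neg hc, Subtype.mk.injEq]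
      rw [Quotient.eq]
      constructor
      · rintro (h | ⟨h, h'⟩ | ⟨h, h'⟩)
        · exact h
        · exact absurd h' hc
        · exact absurd h hb
      · exact Or.inl
  refine Nat.card_congr (Equiv.ofBijective
    (Quotient.lift F fun b c h => (hF b c).1 h) ⟨?_, ?_⟩)
  · intro x y
    induction x using Quotient.ind
    induction y using Quotient.ind
    intro h
    exact Quotient.sound ((hF _ _).2 h)
  · rintro ⟨c, hc⟩
    induction c using Quotient.ind with | _ a => ?_
    have hav : ¬ r a v := fun h => hc (Quotient.sound h)
    by_cases hau : r a u
    · obtain ⟨b, hb⟩ := hu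
      refine ⟨⟦b⟧, ?_⟩
      change F b = _
      rcases hb with hb | hb
      · have : ¬ r (i b) v := fun h => huv (r.trans hb h)
        simp only [F, dif_neg this, Subtype.mk.injEq]
        exact Quotient.sound (r.trans (r.symm hb) (r.symm hau))
      · simp only [F, dif_pos (r.symm hb), Subtype.mk.injEq]
        exact Quotient.sound (r.symm hau)
    · obtain ⟨b, hb⟩ := hi a hav hau
      refine ⟨⟦b⟧, ?_⟩
      change F b = _
      have : ¬ r (i b) v := fun h => hav (r.trans hb h)
      simp only [F, dif_neg this, Subtype.mk.injEq]
      exact Quotient.sound (r.symm hb)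

/-! ### Paths of edges in a ribbon graph -/

namespace RibbonGraph

section Joined

variable {ι : Type} {Γ : RibbonGraph ι} {S T : Set Γ.Dart} {h k l y : Γ.Dart}

theorem Joined.refl (h : Γ.Dart) : Γ.Joined S h h := Relation.EqvGen.refl _

theorem Joined.symm (H : Γ.Joined S h k) : Γ.Joined S k h := Relation.EqvGen.symm _ _ H

theorem Joined.trans (H : Γ.Joined S h k) (H' : Γ.Joined S k l) : Γ.Joined S h l :=
  Relation.EqvGen.trans _ _ _ H H'

theorem joined_rot (h : Γ.Dart) : Γ.Joined S h (Γ.rot h) := Relation.EqvGen.rel _ _ (Or.inl rfl)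

theorem joined_rev (hh : h ∈ S) : Γ.Joined S h (Γ.rev h) :=
  Relation.EqvGen.rel _ _ (Or.inr ⟨hh, rfl⟩)

/-- A function that is constant along the steps of a path is constant along the path. -/
theorem Joined.apply_eq {β : Sort*} (f : Γ.Dart → β) (hrot : ∀ h, f (Γ.rot h) = f h)
    (hrev : ∀ h ∈ S, f (Γ.rev h) = f h) (H : Γ.Joined S h k) : f h = f k := by
  induction H with
  | rel h k H =>
    rcases H with rfl | ⟨hh, rfl⟩
    · exact (hrot h).symm
    · exact (hrev h hh).symm
  | refl h => rfl
  | symm h k _ ih => exact ih.symm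
  | trans h k l _ _ ih ih' => exact ih.trans ih'

theorem Joined.mono (hST : S ⊆ T) (H : Γ.Joined S h k) : Γ.Joined T h k :=
  Relation.EqvGen.mono (fun _ _ H => H.imp_right fun H => ⟨hST H.1, H.2⟩) _ _ H

theorem joined_of_sameCycle (H : Γ.rot.SameCycle h k) : Γ.Joined S h k := by
  obtain ⟨n, rfl⟩ := exists_pow_eq_of_sameCycle H
  clear H
  induction n with
  | zero => exact .refl _
  | succ n ih => rw [pow_succ', Equiv.Perm.mul_apply]; exact ih.trans (joined_rot _)

theorem joined_empty_iff : Γ.Joined ∅ h k ↔ Γ.rot.SameCycle h k := by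
  refine ⟨fun H => ?_, joined_of_sameCycle⟩
  have := H.apply_eq (fun h => (Quotient.mk'' h : Γ.Vertex))
    (fun h => Quotient.sound (Equiv.Perm.sameCycle_apply_left.2 (Equiv.Perm.SameCycle.refl _ _)))
    (by simp)
  exact Quotient.exact this

theorem joined_bdry (hh : h ∈ S) : Γ.Joined S h (Γ.bdry h) :=
  (joined_rev hh).trans (joined_rot _)

/-- Adding one edge to `T` joins the two classes of its end points. -/
theorem joined_union_iff : Γ.Joined (T ∪ {y, Γ.rev y}) h k ↔ Γ.Joined T h k ∨
    (Γ.Joined T h y ∧ Γ.Joined T k (Γ.rev y)) ∨ (Γ.Joined T h (Γ.rev y) ∧ Γ.Joined T k y) := by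
  constructor
  · intro H
    induction H with
    | rel h k H =>
      rcases H with rfl | ⟨hh | rfl | rfl, rfl⟩
      · exact Or.inl (joined_rot _)
      · exact Or.inl (joined_rev hh)
      · exact Or.inr (Or.inl ⟨.refl _, .refl _⟩)
      · rw [Γ.rev_rev]
        exact Or.inr (Or.inr ⟨.refl _, .refl _⟩)
    | refl h => exact Or.inl (.refl _)
    | symm h k _ ih =>
      rcases ih with ih | ⟨a, b⟩ | ⟨a, b⟩
      · exact Or.inl ih.symm
      · exact Or.inr (Or.inr ⟨b, a⟩)
      · exact Or.inr (Or.inl ⟨b, a⟩)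
    | trans h k l _ _ ih ih' =>
      rcases ih with ih | ⟨a, b⟩ | ⟨a, b⟩ <;> rcases ih' with ih' | ⟨a', b'⟩ | ⟨a', b'⟩
      · exact Or.inl (ih.trans ih')
      · exact Or.inr (Or.inl ⟨ih.trans a', b'⟩)
      · exact Or.inr (Or.inr ⟨ih.trans a', b'⟩)
      · exact Or.inr (Or.inl ⟨a, ih'.symm.trans b⟩)
      · exact Or.inr (Or.inl ⟨a, b'⟩)
      · exact Or.inl (a.trans b'.symm)
      · exact Or.inr (Or.inr ⟨a, ih'.symm.trans b⟩)
      · exact Or.inl (a.trans b'.symm)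
      · exact Or.inr (Or.inr ⟨a, b'⟩)
  · have hT : T ⊆ T ∪ {y, Γ.rev y} := Set.subset_union_left
    have hy : Γ.Joined (T ∪ {y, Γ.rev y}) y (Γ.rev y) := joined_rev (by simp)
    rintro (H | ⟨a, b⟩ | ⟨a, b⟩)
    · exact H.mono hT
    · exact (a.mono hT).trans (hy.trans (b.mono hT).symm)
    · exact (a.mono hT).trans (hy.symm.trans (b.mono hT).symm)

theorem bdry_apply (h : Γ.Dart) : Γ.bdry h = Γ.rot (Γ.rev h) := rfl

theorem rot_eq (h : Γ.Dart) : Γ.rot h = Γ.bdry (Γ.rev h) := by rw [bdry_apply, Γ.rev_rev]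

theorem rev_injective : Function.Injective Γ.rev := Γ.rev.injective

theorem rev_eq_iff : Γ.rev h = k ↔ h = Γ.rev k :=
  ⟨fun e => by rw [← e, Γ.rev_rev], fun e => by rw [e, Γ.rev_rev]⟩

theorem collapse_bdry (S : Set Γ.Dart) : (Γ.collapse S).bdry = firstReturn Γ.bdry (Γ.kept S) := by
  refine Equiv.ext fun h => ?_
  exact congrArg (firstReturn Γ.bdry (Γ.kept S)) ((Γ.collapse S).rev_rev h)

end Joined

/-! ### Isomorphisms -/

theorem sameCycle_map_iff {α β : Type} {f : Equiv.Perm α} {f' : Equiv.Perm β} (e : α ≃ β)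
    (he : ∀ a, e (f a) = f' (e a)) {a b : α} : f'.SameCycle (e a) (e b) ↔ f.SameCycle a b := by
  have : f' = e.permCongr f := by
    ext b; obtain ⟨a, rfl⟩ := e.surjective b; simp [he]
  subst this
  have hz : ∀ n : ℤ, ((e.permCongr f) ^ n) (e a) = e ((f ^ n) a) := by
    intro n
    have : (e.permCongr f) ^ n = e.permCongr (f ^ n) := (map_zpow e.permCongrHom f n).symm
    rw [this]; simp
  unfold Equiv.Perm.SameCycle
  simp only [hz, e.injective.eq_iff]

section Iso

variable {ι : Type} {Γ Γ' : RibbonGraph ι} (e : Γ.Iso Γ')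

/-- The inverse isomorphism. -/
def Iso.symm : Γ'.Iso Γ where
  toEquiv := e.toEquiv.symm
  map_rev h := by rw [Equiv.symm_apply_eq, e.map_rev, Equiv.apply_symm_apply]
  map_rot h := by rw [Equiv.symm_apply_eq, e.map_rot, Equiv.apply_symm_apply]
  map_label h := by rw [← e.map_label, Equiv.apply_symm_apply]

theorem Iso.map_bdry (h : Γ.Dart) : e.toEquiv (Γ.bdry h) = Γ'.bdry (e.toEquiv h) := by
  rw [bdry_apply, e.map_rot, e.map_rev]; rfl

theorem Iso.joined {S : Set Γ.Dart} {S' : Set Γ'.Dart} (hS : ∀ h ∈ S, e.toEquiv h ∈ S')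
    {h k : Γ.Dart} (H : Γ.Joined S h k) : Γ'.Joined S' (e.toEquiv h) (e.toEquiv k) := by
  induction H with
  | rel h k H =>
    rcases H with rfl | ⟨hh, rfl⟩
    · rw [e.map_rot]; exact joined_rot _
    · rw [e.map_rev]; exact joined_rev (hS _ hh)
  | refl h => exact .refl _
  | symm h k _ ih => exact ih.symm
  | trans h k l _ _ ih ih' => exact ih.trans ih'

end Iso

/-- Collapsing nothing gives the same graph. -/
def collapseEmptyIso {ι : Type} (Γ : RibbonGraph ι) : (Γ.collapse ∅).Iso Γ where
  toEquiv := Equiv.subtypeUnivEquiv (p := (· ∈ Γ.kept ∅)) fun h => ⟨fun h => h, fun h => h⟩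
  map_rev h := rfl
  map_rot h := by
    have h1 : Γ.bdry (Γ.rev h.1) ∈ Γ.kept ∅ := ⟨fun h => h, fun h => h⟩
    have h2 : firstReturn Γ.bdry (Γ.kept ∅) ((Γ.revKept ∅) h) = ⟨_, h1⟩ :=
      firstReturn_eq_iff.2 (.here rfl h1)
    exact (congrArg Subtype.val h2).trans (rot_eq _).symm
  map_label h := rfl

/-! ### Diagrams with bivalent vertices -/

section Weak

variable {p q : ℕ} (G : RibbonGraph (Fin p ⊕ Fin q))

/-- A chord diagram in which bivalent vertices are allowed as well. -/
structure IsWeakDiagram (g : ℕ) : Prop where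
  nonempty : Nonempty G.Dart
  connected : ∀ h k, G.Joined Set.univ h k
  rot_ne : ∀ h, G.rot h ≠ h
  label_eq_iff : ∀ h k, G.label h = G.label k ↔ G.bdry.SameCycle h k
  label_surjective : Function.Surjective G.label
  euler : (Nat.card G.Vertex : ℤ) - Nat.card G.Edge + (p + q) = 2 - 2 * g
  circles : ∀ h k, G.IsIncoming h → G.IsIncoming k → G.rot.SameCycle h k → h = k
  forest : G.IsForest G.ghost

variable {G} {g : ℕ}

theorem isChordDiagram_iff :
    G.IsChordDiagram g ↔ G.IsWeakDiagram g ∧ ∀ h, G.rot (G.rot h) ≠ h :=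
  ⟨fun H => ⟨⟨H.nonempty, H.connected, fun h => (H.trivalent h).1, H.label_eq_iff,
    H.label_surjective, H.euler, H.circles, H.forest⟩, fun h => (H.trivalent h).2⟩,
   fun H => ⟨⟨H.1.nonempty, H.1.connected, fun h => ⟨H.1.rot_ne h, H.2 h⟩, H.1.label_eq_iff,
    H.1.label_surjective⟩, H.1.euler, H.1.circles, H.1.forest⟩⟩

theorem IsChordDiagram.weak (H : G.IsChordDiagram g) : G.IsWeakDiagram g :=
  (isChordDiagram_iff.1 H).1

theorem Iso.isIncoming_iff {G' : RibbonGraph (Fin p ⊕ Fin q)} (e : G.Iso G') (h : G.Dart) :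
    G'.IsIncoming (e.toEquiv h) ↔ G.IsIncoming h := by
  unfold IsIncoming; rw [e.map_label]

theorem Iso.mem_ghost_iff {G' : RibbonGraph (Fin p ⊕ Fin q)} (e : G.Iso G') (h : G.Dart) :
    e.toEquiv h ∈ G'.ghost ↔ h ∈ G.ghost := by
  change (¬ _ ∧ ¬ _) ↔ (¬ _ ∧ ¬ _)
  rw [← e.map_rev, e.isIncoming_iff, e.isIncoming_iff]

theorem IsWeakDiagram.of_iso {G' : RibbonGraph (Fin p ⊕ Fin q)} (e : G.Iso G')
    (H : G.IsWeakDiagram g) : G'.IsWeakDiagram g where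
  nonempty := H.nonempty.map e.toEquiv
  connected h k := by
    simpa using e.joined (S' := Set.univ) (fun _ _ => trivial)
      (H.connected (e.toEquiv.symm h) (e.toEquiv.symm k))
  rot_ne h := by
    obtain ⟨h, rfl⟩ := e.toEquiv.surjective h
    rw [← e.map_rot]; exact fun E => H.rot_ne h (e.toEquiv.injective E)
  label_eq_iff h k := by
    obtain ⟨h, rfl⟩ := e.toEquiv.surjective h
    obtain ⟨k, rfl⟩ := e.toEquiv.surjective k
    rw [e.map_label, e.map_label, H.label_eq_iff, sameCycle_map_iff e.toEquiv e.map_bdry]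
  label_surjective i := by
    obtain ⟨h, rfl⟩ := H.label_surjective i
    exact ⟨_, e.map_label h⟩
  euler := by
    have h1 : Nat.card G.Vertex = Nat.card G'.Vertex := Nat.card_congr
      (Quotient.congr e.toEquiv fun a b => (sameCycle_map_iff e.toEquiv e.map_rot).symm)
    have h2 : Nat.card G.Edge = Nat.card G'.Edge := Nat.card_congr
      (Quotient.congr e.toEquiv fun a b => (sameCycle_map_iff e.toEquiv e.map_rev).symm)
    rw [← h1, ← h2]; exact H.euler
  circles h k hh hk E := by
    obtain ⟨h, rfl⟩ := e.toEquiv.surjective h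
    obtain ⟨k, rfl⟩ := e.toEquiv.surjective k
    rw [e.isIncoming_iff] at hh hk
    rw [sameCycle_map_iff e.toEquiv e.map_rot] at E
    rw [H.circles h k hh hk E]
  forest h hh E := by
    obtain ⟨h, rfl⟩ := e.toEquiv.surjective h
    rw [e.mem_ghost_iff] at hh
    refine H.forest h hh ?_
    have := e.symm.joined (S' := G.ghost \ {h, G.rev h}) ?_ E
    · simpa [Iso.symm, ← e.map_rev] using this
    · intro k hk
      obtain ⟨k, rfl⟩ := e.toEquiv.surjective k
      rw [← e.map_rev] at hk
      simpa [Iso.symm, e.mem_ghost_iff] using hk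

theorem IsChordDiagram.of_iso {G' : RibbonGraph (Fin p ⊕ Fin q)} (e : G.Iso G')
    (H : G.IsChordDiagram g) : G'.IsChordDiagram g := by
  rw [isChordDiagram_iff] at H ⊢
  refine ⟨H.1.of_iso e, fun h => ?_⟩
  obtain ⟨h, rfl⟩ := e.toEquiv.surjective h
  rw [← e.map_rot, ← e.map_rot]
  exact fun E => H.2 h (e.toEquiv.injective E)

end Weak

/-! ### Contracting one edge -/

section Contract

variable {ι : Type} (Γ : RibbonGraph ι)

/-- The graph obtained by collapsing the edge `{y, rev y}`. -/
noncomputable def contract (y : Γ.Dart) : RibbonGraph ι := Γ.collapse {y, Γ.rev y}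

theorem mem_kept_pair {y h : Γ.Dart} : h ∈ Γ.kept {y, Γ.rev y} ↔ h ≠ y ∧ h ≠ Γ.rev y := by
  change (¬ (h = y ∨ h = Γ.rev y) ∧ ¬ (Γ.rev h = y ∨ Γ.rev h = Γ.rev y)) ↔ _
  rw [Γ.rev_injective.eq_iff, not_or, not_or]
  constructor
  · rintro ⟨h, -⟩; exact h
  · rintro ⟨a, b⟩; exact ⟨⟨a, b⟩, fun e => b (rev_eq_iff.1 e), a⟩

variable {Γ} in
/-- The dart of the graph that a dart of the contracted graph comes from. -/
def under {y : Γ.Dart} (h : (Γ.contract y).Dart) : Γ.Dart :=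
  Subtype.val (p := (· ∈ Γ.kept {y, Γ.rev y})) h

variable {Γ} in
/-- A dart that is not on the contracted edge, as a dart of the contracted graph. -/
def keep {y : Γ.Dart} (h : Γ.Dart) (hh : h ≠ y ∧ h ≠ Γ.rev y) : (Γ.contract y).Dart :=
  (⟨h, (mem_kept_pair Γ).2 hh⟩ : Γ.kept {y, Γ.rev y})

/-- The edge `y` can be contracted: it is not a loop, and its end points are not univalent. -/
structure Contractible (y : Γ.Dart) : Prop where
  not_loop : ¬ Γ.rot.SameCycle y (Γ.rev y)
  rot_ne : Γ.rot y ≠ y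
  rot_rev_ne : Γ.rot (Γ.rev y) ≠ Γ.rev y

open Classical in
/-- A dart that is kept when the edge `y` is contracted, at the end point of `h` in the contracted
graph: `h` itself if it is kept, and otherwise the dart that follows on the boundary cycle of
`h`. -/
noncomputable def slip (y h : Γ.Dart) : Γ.Dart :=
  if h = y then Γ.rot (Γ.rev y) else if h = Γ.rev y then Γ.rot y else h

variable {Γ} {y h k : Γ.Dart}

theorem slip_left : Γ.slip y y = Γ.rot (Γ.rev y) := if_pos rfl

theorem slip_right : Γ.slip y (Γ.rev y) = Γ.rot y := by
  unfold slip; rw [if_neg (Γ.rev_ne y), if_pos rfl]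

theorem slip_of_kept (hh : h ≠ y ∧ h ≠ Γ.rev y) : Γ.slip y h = h := by
  unfold slip; rw [if_neg hh.1, if_neg hh.2]

@[simp] theorem under_keep (hh : h ≠ y ∧ h ≠ Γ.rev y) : under (keep h hh) = h := rfl

theorem under_ne (h : (Γ.contract y).Dart) : under h ≠ y ∧ under h ≠ Γ.rev y :=
  (mem_kept_pair Γ).1 (Subtype.property (p := (· ∈ Γ.kept {y, Γ.rev y})) h)

theorem under_injective : Function.Injective (under : (Γ.contract y).Dart → Γ.Dart) :=
  Subtype.val_injective

theorem under_rev (h : (Γ.contract y).Dart) : under ((Γ.contract y).rev h) = Γ.rev (under h) := rfl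

theorem label_contract (h : (Γ.contract y).Dart) :
    (Γ.contract y).label h = Γ.label (under h) := rfl

theorem bdry_contract_eq_iff {h k : (Γ.contract y).Dart} :
    (Γ.contract y).bdry h = k ↔ Next Γ.bdry (Γ.kept {y, Γ.rev y}) (under h) (under k) := by
  unfold contract
  rw [collapse_bdry]
  exact firstReturn_eq_iff

theorem next_contract_iff {L : Set Γ.Dart} (hL : L ⊆ Γ.kept {y, Γ.rev y})
    {h k : (Γ.contract y).Dart} :
    Next (Γ.contract y).bdry {l | under l ∈ L} h k ↔ Next Γ.bdry L (under h) (under k) := by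
  have := next_firstReturn_iff (f := Γ.bdry) hL (a := h) (b := k)
  rw [← collapse_bdry] at this
  exact this

theorem sameCycle_bdry_contract (h k : (Γ.contract y).Dart) :
    (Γ.contract y).bdry.SameCycle h k ↔ Γ.bdry.SameCycle (under h) (under k) := by
  have := sameCycle_firstReturn (f := Γ.bdry) (K := Γ.kept {y, Γ.rev y}) (a := h) (b := k)
  rw [← collapse_bdry] at this
  exact this

theorem Contractible.symm (hy : Γ.Contractible y) : Γ.Contractible (Γ.rev y) :=
  ⟨fun h => hy.not_loop (by rw [Γ.rev_rev] at h; exact h.symm), hy.rot_rev_ne,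
    by rw [Γ.rev_rev]; exact hy.rot_ne⟩

theorem Contractible.rot_kept (hy : Γ.Contractible y) : Γ.rot y ≠ y ∧ Γ.rot y ≠ Γ.rev y :=
  ⟨hy.rot_ne, fun e => hy.not_loop ⟨1, by simpa using e⟩⟩

theorem Contractible.rot_rev_kept (hy : Γ.Contractible y) :
    Γ.rot (Γ.rev y) ≠ y ∧ Γ.rot (Γ.rev y) ≠ Γ.rev y :=
  ⟨fun e => hy.symm.not_loop ⟨1, by simpa [Γ.rev_rev] using e⟩, hy.rot_rev_ne⟩

theorem Contractible.slip_kept (hy : Γ.Contractible y) (h : Γ.Dart) :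
    Γ.slip y h ≠ y ∧ Γ.slip y h ≠ Γ.rev y := by
  unfold slip
  split_ifs with h1 h2
  · exact hy.rot_rev_kept
  · exact hy.rot_kept
  · exact ⟨h1, h2⟩

theorem Contractible.under_rot (hy : Γ.Contractible y) (h : (Γ.contract y).Dart) :
    under ((Γ.contract y).rot h) = Γ.slip y (Γ.rot (under h)) := by
  have : (Γ.contract y).bdry ((Γ.contract y).rev h) = keep _ (hy.slip_kept (Γ.rot (under h))) := by
    rw [bdry_contract_eq_iff, under_rev, under_keep]
    by_cases hk : Γ.rot (under h) ∈ Γ.kept {y, Γ.rev y}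
    · rw [slip_of_kept ((mem_kept_pair Γ).1 hk)]
      exact .here (rot_eq _).symm hk
    · refine .skip (by rwa [← rot_eq]) ?_
      rw [← rot_eq]
      rw [mem_kept_pair, not_and_or, not_not, not_not] at hk
      rcases hk with e | e
      · rw [e, slip_left]; exact .here rfl ((mem_kept_pair Γ).2 hy.rot_rev_kept)
      · rw [e, slip_right]
        exact .here (by rw [bdry_apply, Γ.rev_rev]) ((mem_kept_pair Γ).2 hy.rot_kept)
  rw [rot_eq, this, under_keep]

theorem Contractible.rot_contract (hy : Γ.Contractible y) (h : (Γ.contract y).Dart) :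
    (Γ.contract y).rot h = keep _ (hy.slip_kept (Γ.rot (under h))) :=
  under_injective (hy.under_rot h)

theorem not_kept (hk : ¬ (h ≠ y ∧ h ≠ Γ.rev y)) : h = y ∨ h = Γ.rev y := by
  rwa [not_and_or, not_not, not_not] at hk

/-- Paths in the contracted graph are the paths in the graph that may use the contracted edge. -/
theorem Contractible.joined_iff (hy : Γ.Contractible y) (T : Set Γ.Dart)
    (h k : (Γ.contract y).Dart) :
    (Γ.contract y).Joined {l | under l ∈ T} h k ↔
      Γ.Joined (T ∪ {y, Γ.rev y}) (under h) (under k) := by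
  set T' : Set (Γ.contract y).Dart := {l | under l ∈ T} with hT'
  have hyy : Γ.Joined (T ∪ {y, Γ.rev y}) y (Γ.rev y) := joined_rev (by simp)
  have hslip : ∀ h, Γ.Joined (T ∪ {y, Γ.rev y}) h (Γ.slip y h) := by
    intro h
    unfold slip
    split_ifs with h1 h2
    · subst h1; exact hyy.trans (joined_rot _)
    · subst h2; exact hyy.symm.trans (joined_rot _)
    · exact .refl _
  constructor
  · intro H
    induction H with
    | rel h k H =>
      rcases H with rfl | ⟨hh, rfl⟩
      · rw [hy.under_rot]; exact (joined_rot _).trans (hslip _)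
      · exact joined_rev (Or.inl hh)
    | refl h => exact .refl _
    | symm h k _ ih => exact ih.symm
    | trans h k l _ _ ih ih' => exact ih.trans ih'
  · let ρ : Γ.Dart → (Γ.contract y).Dart := fun h => keep _ (hy.slip_kept h)
    have hρ : ∀ h : (Γ.contract y).Dart, ρ (under h) = h := fun h =>
      under_injective (slip_of_kept (under_ne h))
    have hrot : ∀ h : Γ.Dart, h ≠ y ∧ h ≠ Γ.rev y →
        (Γ.contract y).Joined T' (ρ h) (ρ (Γ.rot h)) := by
      intro h hh
      have := joined_rot (Γ := Γ.contract y) (S := T') (ρ h)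
      rwa [hy.rot_contract, show under (ρ h) = h from slip_of_kept hh] at this
    have e1 : ρ (Γ.rot y) = ρ (Γ.rev y) := under_injective (by
      change Γ.slip y (Γ.rot y) = Γ.slip y (Γ.rev y)
      rw [slip_of_kept hy.rot_kept, slip_right])
    have e2 : ρ (Γ.rot (Γ.rev y)) = ρ y := under_injective (by
      change Γ.slip y (Γ.rot (Γ.rev y)) = Γ.slip y y
      rw [slip_of_kept hy.rot_rev_kept, slip_left])
    -- Going once around the initial vertex of `y` leads from `rot y` back to `y`.
    have key : (Γ.contract y).Joined T' (ρ (Γ.rot y)) (ρ y) := by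
      have : ∀ n : ℕ, (Γ.contract y).Joined T' (ρ (Γ.rot y)) (ρ ((Γ.rot ^ (n + 1)) y)) := by
        intro n
        induction n with
        | zero => rw [zero_add, pow_one]; exact .refl _
        | succ n ih =>
          by_cases hk : (Γ.rot ^ (n + 1)) y ≠ y ∧ (Γ.rot ^ (n + 1)) y ≠ Γ.rev y
          · rw [pow_succ' _ (n + 1), Equiv.Perm.mul_apply]
            exact ih.trans (hrot _ hk)
          · rcases not_kept hk with e | e
            · rw [pow_succ' _ (n + 1), Equiv.Perm.mul_apply, e]; exact .refl _
            · exact absurd ⟨(n + 1 : ℕ), by rw [zpow_natCast, e]⟩ hy.not_loop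
      have h1 := this (orderOf Γ.rot - 1)
      rwa [Nat.sub_add_cancel (orderOf_pos _), pow_orderOf_eq_one] at h1
    intro H
    suffices ∀ h k, Γ.Joined (T ∪ {y, Γ.rev y}) h k → (Γ.contract y).Joined T' (ρ h) (ρ k) by
      have := this _ _ H
      rwa [hρ, hρ] at this
    intro h k H
    induction H with
    | rel h k H =>
      rcases H with rfl | ⟨hh, rfl⟩
      · by_cases hk : h ≠ y ∧ h ≠ Γ.rev y
        · exact hrot h hk
        · rcases not_kept hk with rfl | rfl
          · exact key.symm
          · rw [e2, ← e1]; exact key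
      · by_cases hk : h ≠ y ∧ h ≠ Γ.rev y
        · have hT : h ∈ T := hh.resolve_right fun e => by
            rcases e with e | e; exacts [hk.1 e, hk.2 e]
          have hr : Γ.rev h ≠ y ∧ Γ.rev h ≠ Γ.rev y :=
            ⟨fun e => hk.2 (rev_eq_iff.1 e), fun e => hk.1 (Γ.rev_injective e)⟩
          have h2 : ρ (Γ.rev h) = (Γ.contract y).rev (ρ h) := under_injective (by
            rw [under_rev]
            change Γ.slip y _ = Γ.rev (Γ.slip y _)
            rw [slip_of_kept hk, slip_of_kept hr])
          rw [h2]
          refine joined_rev ?_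
          change Γ.slip y h ∈ T
          rwa [slip_of_kept hk]
        · rcases not_kept hk with rfl | rfl
          · rw [← e1]; exact key.symm
          · rw [Γ.rev_rev, ← e1]; exact key
    | refl h => exact .refl _
    | symm h k _ ih => exact ih.symm
    | trans h k l _ _ ih ih' => exact ih.trans ih'

theorem Contractible.sameCycle_iff (hy : Γ.Contractible y) (h k : (Γ.contract y).Dart) :
    (Γ.contract y).rot.SameCycle h k ↔ Γ.rot.SameCycle (under h) (under k) ∨
      (Γ.rot.SameCycle (under h) y ∧ Γ.rot.SameCycle (under k) (Γ.rev y)) ∨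
      (Γ.rot.SameCycle (under h) (Γ.rev y) ∧ Γ.rot.SameCycle (under k) y) := by
  have := hy.joined_iff ∅ h k
  rw [joined_union_iff] at this
  simpa only [joined_empty_iff, Set.mem_empty_iff_false,
    show ({l | False} : Set (Γ.contract y).Dart) = ∅ from rfl] using this

theorem Contractible.card_vertex (hy : Γ.Contractible y) :
    Nat.card (Γ.contract y).Vertex + 1 = Nat.card Γ.Vertex := by
  refine card_quotient_join
    (Equiv.Perm.SameCycle.setoid Γ.rot)
    (Equiv.Perm.SameCycle.setoid (Γ.contract y).rot) under y (Γ.rev y) hy.not_loop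
    (fun h k => hy.sameCycle_iff h k) ?_ ⟨keep (Γ.rot y) hy.rot_kept, Or.inl ⟨1, by simp⟩⟩
  intro a h1 h2
  refine ⟨keep a ⟨?_, ?_⟩, Equiv.Perm.SameCycle.refl _ _⟩
  · rintro rfl; exact h2 (Equiv.Perm.SameCycle.refl _ _)
  · rintro rfl; exact h1 (Equiv.Perm.SameCycle.refl _ _)

theorem sameCycle_rev_iff : Γ.rev.SameCycle h k ↔ k = h ∨ k = Γ.rev h := by
  constructor
  · intro H
    exact mem_of_sameCycle (W := {k | k = h ∨ k = Γ.rev h}) (by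
      rintro a (rfl | rfl)
      · exact Or.inr rfl
      · exact Or.inl (Γ.rev_rev _)) H (Or.inl rfl)
  · rintro (rfl | rfl)
    · exact Equiv.Perm.SameCycle.refl _ _
    · exact ⟨1, by simp⟩

theorem card_dart (Γ : RibbonGraph ι) : Nat.card Γ.Dart = 2 * Nat.card Γ.Edge := by
  classical
  let π : Γ.Dart → Γ.Edge := Quotient.mk''
  have h1 : Nat.card Γ.Dart = Nat.card (Σ e : Γ.Edge, {h // π h = e}) :=
    Nat.card_congr (Equiv.sigmaFiberEquiv π).symm
  have : Fintype Γ.Edge := Fintype.ofFinite _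
  have h2 : ∀ e : Γ.Edge, Nat.card {h // π h = e} = 2 := by
    intro e
    induction e using Quotient.ind with | _ h => ?_
    have : {k | π k = ⟦h⟧} = {h, Γ.rev h} := by
      ext k
      change π k = _ ↔ k = h ∨ k = Γ.rev h
      rw [← sameCycle_rev_iff]
      exact ⟨fun e => (Quotient.exact e : Γ.rev.SameCycle k h).symm,
        fun e => Quotient.sound (Equiv.Perm.SameCycle.symm e)⟩
    change Nat.card {k | π k = ⟦h⟧} = 2
    rw [this, Nat.card_coe_set_eq, Set.ncard_pair (Γ.rev_ne h).symm]
  rw [h1, Nat.card_sigma, Finset.sum_congr rfl fun e _ => h2 e]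
  simp [mul_comm]

theorem card_contract_dart (y : Γ.Dart) : Nat.card (Γ.contract y).Dart + 2 = Nat.card Γ.Dart := by
  have h1 : Γ.kept {y, Γ.rev y} = ({y, Γ.rev y} : Set Γ.Dart)ᶜ := by
    ext h; rw [mem_kept_pair]; simp
  have h2 := Set.ncard_add_ncard_compl ({y, Γ.rev y} : Set Γ.Dart)
  rw [Set.ncard_pair (Γ.rev_ne y).symm, ← h1, ← Nat.card_coe_set_eq] at h2
  rw [← h2, add_comm]; rfl

theorem card_edge_contract (y : Γ.Dart) : Nat.card (Γ.contract y).Edge + 1 = Nat.card Γ.Edge := by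
  have h1 := card_contract_dart y
  rw [card_dart, card_dart] at h1
  omega

theorem Contractible.rot_contract_ne (hy : Γ.Contractible y) (hne : ∀ h, Γ.rot h ≠ h)
    (h : (Γ.contract y).Dart) : (Γ.contract y).rot h ≠ h := by
  intro e
  have e := congrArg under e
  rw [hy.under_rot] at e
  generalize under h = h at e
  unfold slip at e
  split_ifs at e with h1 h2
  · refine hy.not_loop (Equiv.Perm.SameCycle.symm ⟨2, ?_⟩)
    change Γ.rot (Γ.rot (Γ.rev y)) = y
    rw [e, h1]
  · refine hy.not_loop ⟨2, ?_⟩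
    change Γ.rot (Γ.rot y) = _
    rw [e, h2]
  · exact hne h e

theorem Contractible.rot_rot_contract_ne (hy : Γ.Contractible y) (hne : ∀ h, Γ.rot (Γ.rot h) ≠ h)
    (h : (Γ.contract y).Dart) : (Γ.contract y).rot ((Γ.contract y).rot h) ≠ h := by
  intro e
  have e := congrArg under e
  rw [hy.under_rot, hy.under_rot] at e
  generalize under h = h at e
  have n1 : ∀ k, Γ.rot k = y → Γ.rot (Γ.rev y) ≠ k := fun k h1 h2 =>
    hy.not_loop (Equiv.Perm.SameCycle.symm ⟨2, by
      change Γ.rot (Γ.rot (Γ.rev y)) = y; rw [h2, h1]⟩)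
  have n2 : ∀ k, Γ.rot k = Γ.rev y → Γ.rot y ≠ k := fun k h1 h2 =>
    hy.not_loop ⟨2, by change Γ.rot (Γ.rot y) = _; rw [h2, h1]⟩
  have n3 : ∀ k, Γ.rot (Γ.rot k) = y → Γ.rot (Γ.rev y) ≠ k := fun k h1 h2 =>
    hy.not_loop (Equiv.Perm.SameCycle.symm ⟨3, by
      change Γ.rot (Γ.rot (Γ.rot (Γ.rev y))) = y; rw [h2, h1]⟩)
  have n4 : ∀ k, Γ.rot (Γ.rot k) = Γ.rev y → Γ.rot y ≠ k := fun k h1 h2 =>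
    hy.not_loop ⟨3, by change Γ.rot (Γ.rot (Γ.rot y)) = _; rw [h2, h1]⟩
  by_cases h1 : Γ.rot h = y
  · rw [h1, slip_left] at e
    unfold slip at e
    split_ifs at e with h2 h3
    · exact n1 _ h2 rfl
    · exact hne _ h3
    · exact n3 _ (by rw [e, h1]) rfl
  · by_cases h2 : Γ.rot h = Γ.rev y
    · rw [h2, slip_right] at e
      unfold slip at e
      split_ifs at e with h3 h4
      · exact hne _ h3
      · exact n2 _ h4 rfl
      · exact n4 _ (by rw [e, h2]) rfl
    · rw [slip_of_kept ⟨h1, h2⟩] at e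
      unfold slip at e
      split_ifs at e with h3 h4
      · exact n3 _ h3 e
      · exact n4 _ h4 e
      · exact hne _ e

end Contract

/-! ### Forests -/

section Forest

variable {ι : Type} {Γ : RibbonGraph ι} {S : Set Γ.Dart}

theorem IsForest.mono {T : Set Γ.Dart} (hS : Γ.IsForest S) (hT : T ⊆ S) : Γ.IsForest T :=
  fun h hh H => hS h (hT hh) (H.mono (Set.sdiff_subset_sdiff_left hT))

theorem IsForest.not_sameCycle (hS : Γ.IsForest S) {h : Γ.Dart} (hh : h ∈ S) :
    ¬ Γ.rot.SameCycle h (Γ.rev h) := fun H => hS h hh (joined_of_sameCycle H)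

/-- A boundary walk along edges of a forest does not return to its initial vertex: a closed walk in
a forest would have to turn back somewhere, and boundary walks only turn back at univalent
vertices. -/
theorem IsForest.not_sameCycle_bdry_pow (hS : Γ.IsForest S) (hne : ∀ h, Γ.rot h ≠ h) (m : ℕ) :
    ∀ h : Γ.Dart, 0 < m → (∀ i < m, (Γ.bdry ^ i) h ∈ S) →
      ¬ Γ.rot.SameCycle h ((Γ.bdry ^ m) h) := by
  induction m using Nat.strong_induction_on with
  | _ m ih =>
    intro h hm hi hc
    by_cases hx : ∃ i, 0 < i ∧ i < m ∧ ((Γ.bdry ^ i) h = h ∨ (Γ.bdry ^ i) h = Γ.rev h)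
    · obtain ⟨i, h0, him, e | e⟩ := hx
      · exact ih i him h h0 (fun j hj => hi j (by omega)) (by rw [e])
      · rcases Nat.lt_or_ge 1 i with h1 | h1
        · have hs : ∀ j, (Γ.bdry ^ j) (Γ.bdry h) = (Γ.bdry ^ (j + 1)) h := fun j => by
            rw [pow_succ, Equiv.Perm.mul_apply]
          refine ih (i - 1) (by omega) (Γ.bdry h) (by omega) (fun j hj => ?_) ?_
          · rw [hs]; exact hi _ (by omega)
          · rw [hs, Nat.sub_add_cancel (by omega), e, bdry_apply]
            exact Equiv.Perm.sameCycle_apply_left.2 (Equiv.Perm.SameCycle.refl _ _)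
        · have : i = 1 := by omega
          subst this
          exact hne (Γ.rev h) (by simpa [bdry_apply] using e)
    · push Not at hx
      refine hS h (by simpa using hi 0 hm) ?_
      have key : ∀ i, i < m → Γ.Joined (S \ {h, Γ.rev h}) (Γ.rev h) ((Γ.bdry ^ (i + 1)) h) := by
        intro i
        induction i with
        | zero => intro _; simpa [bdry_apply] using joined_rot _
        | succ i ihi =>
          intro him
          refine (ihi (by omega)).trans ?_
          rw [pow_succ' _ (i + 1), Equiv.Perm.mul_apply]
          refine joined_bdry ⟨hi _ him, ?_⟩
          have := hx (i + 1) (by omega) him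
          rintro (e | e)
          exacts [this.1 e, this.2 e]
      have h1 := key (m - 1) (by omega)
      rw [Nat.sub_add_cancel hm] at h1
      exact (joined_of_sameCycle hc).trans h1.symm

/-- The relation of being joined by edges in `S`. -/
def joinedSetoid (S : Set Γ.Dart) : Setoid Γ.Dart where
  r := Γ.Joined S
  iseqv := ⟨.refl, .symm, .trans⟩

/-- A forest with `e` edges on `v` vertices has `v - e` components. -/
theorem IsForest.card_components (n : ℕ) : ∀ S : Set Γ.Dart, Γ.IsForest S →
    (∀ h ∈ S, Γ.rev h ∈ S) → S.ncard = n →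
    2 * Nat.card (Quotient (joinedSetoid S)) + n = 2 * Nat.card Γ.Vertex := by
  induction n using Nat.strong_induction_on with
  | _ n ih =>
    intro S hS hrev hn
    rcases S.eq_empty_or_nonempty with rfl | ⟨h, hh⟩
    · rw [Set.ncard_empty] at hn
      subst hn
      have : Nat.card (Quotient (joinedSetoid (∅ : Set Γ.Dart))) = Nat.card Γ.Vertex :=
        Nat.card_congr (Quotient.congr (Equiv.refl _) fun a b => joined_empty_iff)
      omega
    · set T := S \ {h, Γ.rev h} with hT
      have hST : S = T ∪ {h, Γ.rev h} := by
        rw [hT, Set.sdiff_union_self, Set.union_eq_self_of_subset_right]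
        rintro k (rfl | rfl)
        exacts [hh, hrev _ hh]
      have hcard : T.ncard + 2 = n := by
        rw [← hn, ← Set.ncard_pair (Γ.rev_ne h).symm]
        refine Set.ncard_sdiff_add_ncard_of_subset ?_
        rintro k (rfl | rfl)
        exacts [hh, hrev _ hh]
      have h1 := ih T.ncard (by omega) T (hS.mono Set.sdiff_subset) (by
        rintro k ⟨hk, hk'⟩
        refine ⟨hrev k hk, fun e => hk' ?_⟩
        rcases e with e | e
        · exact Or.inr (rev_eq_iff.1 e)
        · exact Or.inl (Γ.rev_injective e)) rfl
      have h2 := card_quotient_join (joinedSetoid T) (joinedSetoid S) id h (Γ.rev h)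
        (hS h hh) (fun b c => by
          change Γ.Joined S b c ↔ _
          rw [hST, joined_union_iff]; rfl)
        (fun a _ _ => ⟨a, (joinedSetoid T).refl a⟩) ⟨h, Or.inl ((joinedSetoid T).refl h)⟩
      omega

end Forest

/-! ### Contracting an edge of a chord diagram -/

section ContractDiagram

variable {p q : ℕ} {G : RibbonGraph (Fin p ⊕ Fin q)} {g : ℕ} {y : G.Dart}

theorem mem_ghost_contract {h : (G.contract y).Dart} :
    h ∈ (G.contract y).ghost ↔ under h ∈ G.ghost := Iff.rfl

theorem isIncoming_contract {h : (G.contract y).Dart} :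
    (G.contract y).IsIncoming h ↔ G.IsIncoming (under h) := Iff.rfl

theorem rev_mem_ghost {h : G.Dart} (hh : h ∈ G.ghost) : G.rev h ∈ G.ghost :=
  ⟨hh.2, by rw [G.rev_rev]; exact hh.1⟩

theorem rev_mem_ghost_iff {h : G.Dart} : G.rev h ∈ G.ghost ↔ h ∈ G.ghost :=
  ⟨fun H => by have := rev_mem_ghost H; rwa [G.rev_rev] at this, rev_mem_ghost⟩

theorem IsWeakDiagram.label_bdry (H : G.IsWeakDiagram g) (h : G.Dart) :
    G.label (G.bdry h) = G.label h :=
  (H.label_eq_iff _ _).2 (Equiv.Perm.sameCycle_apply_left.2 (Equiv.Perm.SameCycle.refl _ _))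

/-- Every boundary cycle of a diagram contains an oriented edge that is not a ghost. -/
theorem IsWeakDiagram.exists_circular (H : G.IsWeakDiagram g) (i : Fin p ⊕ Fin q) :
    ∃ h, G.label h = i ∧ h ∉ G.ghost := by
  by_contra! hx
  obtain ⟨h, hh⟩ := H.label_surjective i
  have hl : ∀ n : ℕ, G.label ((G.bdry ^ n) h) = i := by
    intro n
    induction n with
    | zero => simpa using hh
    | succ n ih => rw [pow_succ', Equiv.Perm.mul_apply, H.label_bdry, ih]
  refine H.forest.not_sameCycle_bdry_pow H.rot_ne (orderOf G.bdry) h (orderOf_pos _)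
    (fun i _ => hx _ (hl i)) ?_
  rw [pow_orderOf_eq_one]; exact Equiv.Perm.SameCycle.refl _ _

theorem IsWeakDiagram.contractible (H : G.IsWeakDiagram g)
    (hy : ¬ G.rot.SameCycle y (G.rev y)) : G.Contractible y :=
  ⟨hy, H.rot_ne _, H.rot_ne _⟩

/-- An edge of a diagram that is not a loop can be contracted, provided that the contraction neither
joins two circles nor closes a cycle of ghost edges. -/
theorem IsWeakDiagram.contract (H : G.IsWeakDiagram g) (hy : ¬ G.rot.SameCycle y (G.rev y))
    (hinc : ∀ h k, G.IsIncoming h → G.IsIncoming k → h ≠ y → k ≠ G.rev y →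
      G.rot.SameCycle h y → G.rot.SameCycle k (G.rev y) → False)
    (hf : y ∈ G.ghost ∨ ¬ G.Joined G.ghost y (G.rev y)) : (G.contract y).IsWeakDiagram g := by
  have hc := H.contractible hy
  refine ⟨⟨keep _ hc.rot_kept⟩, fun h k => ?_, hc.rot_contract_ne H.rot_ne, fun h k => ?_,
    fun i => ?_, ?_, fun h k hh hk E => ?_, fun h hh E => ?_⟩
  · exact (hc.joined_iff Set.univ h k).2 ((H.connected _ _).mono Set.subset_union_left)
  · rw [label_contract, label_contract, H.label_eq_iff, sameCycle_bdry_contract]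
  · obtain ⟨h, rfl⟩ := H.label_surjective i
    by_cases hk : h ≠ y ∧ h ≠ G.rev y
    · exact ⟨keep h hk, rfl⟩
    · rcases not_kept hk with rfl | rfl
      · exact ⟨keep _ hc.rot_rev_kept, H.label_bdry h⟩
      · refine ⟨keep _ hc.rot_kept, ?_⟩
        have := H.label_bdry (G.rev y)
        rwa [bdry_apply, G.rev_rev] at this
  · have h1 := hc.card_vertex
    have h2 := card_edge_contract y
    have h3 := H.euler
    rw [← h1, ← h2] at h3
    push_cast at h3
    linarith
  · refine under_injective ?_
    rw [isIncoming_contract] at hh hk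
    rcases (hc.sameCycle_iff h k).1 E with E | ⟨E, E'⟩ | ⟨E, E'⟩
    · exact H.circles _ _ hh hk E
    · exact (hinc _ _ hh hk (under_ne h).1 (under_ne k).2 E E').elim
    · exact (hinc _ _ hk hh (under_ne k).1 (under_ne h).2 E' E).elim
  · rw [mem_ghost_contract] at hh
    have E' : G.Joined (G.ghost \ {under h, G.rev (under h)} ∪ {y, G.rev y}) (under h)
        (G.rev (under h)) := by
      refine (hc.joined_iff _ _ _).1 (E.mono ?_)
      rintro k ⟨hk, hk'⟩
      refine ⟨hk, fun e => hk' ?_⟩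
      rcases e with e | e
      · exact Or.inl (under_injective e)
      · exact Or.inr (under_injective e)
    rcases hf with hf | hf
    · refine H.forest _ hh (E'.mono ?_)
      rintro k (hk | hk | hk)
      · exact hk
      · subst hk
        exact ⟨hf, by
          rintro (e | e)
          exacts [(under_ne h).1 e.symm, (under_ne h).2 (rev_eq_iff.1 e.symm)]⟩
      · obtain rfl : k = G.rev y := hk
        exact ⟨rev_mem_ghost hf, by
          rintro (e | e)
          exacts [(under_ne h).2 e.symm, (under_ne h).1 (G.rev_injective e.symm)]⟩
    · have hsub : G.ghost \ {under h, G.rev (under h)} ⊆ G.ghost := Set.sdiff_subset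
      have hj : G.Joined G.ghost (under h) (G.rev (under h)) := joined_rev hh
      rcases joined_union_iff.1 E' with E | ⟨E, E''⟩ | ⟨E, E''⟩
      · exact H.forest _ hh E
      · exact hf ((E.mono hsub).symm.trans (hj.trans (E''.mono hsub)))
      · exact hf ((E''.mono hsub).symm.trans (hj.symm.trans (E.mono hsub)))

/-- A graph is a diagram if it becomes one when a ghost edge is contracted and if this ghost edge
does not close a cycle. -/
theorem IsWeakDiagram.of_contract (hc : G.Contractible y) (hne : ∀ h, G.rot h ≠ h)
    (hlab : ∀ h, G.label (G.bdry h) = G.label h) (hyg : y ∈ G.ghost)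
    (hsep : ¬ G.Joined (G.ghost \ {y, G.rev y}) y (G.rev y))
    (H : (G.contract y).IsWeakDiagram g) : G.IsWeakDiagram g := by
  have hkept : ∀ h : G.Dart, ∃ k : (G.contract y).Dart, G.bdry.SameCycle h (under k) ∧
      G.Joined Set.univ h (under k) := by
    intro h
    by_cases hk : h ≠ y ∧ h ≠ G.rev y
    · exact ⟨keep h hk, Equiv.Perm.SameCycle.refl _ _, .refl _⟩
    · rcases not_kept hk with rfl | rfl
      · exact ⟨keep _ hc.rot_rev_kept, ⟨1, by simp [bdry_apply]⟩, joined_bdry trivial⟩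
      · refine ⟨keep _ hc.rot_kept, ⟨1, by simp [bdry_apply, G.rev_rev]⟩, ?_⟩
        have := joined_bdry (Γ := G) (S := Set.univ) (h := G.rev y) trivial
        rwa [bdry_apply, G.rev_rev] at this
  have hlab' : ∀ h k, G.bdry.SameCycle h k → G.label h = G.label k := by
    intro h k hk
    refine (mem_of_sameCycle (W := {k | G.label k = G.label h}) (fun a ha => ?_) hk rfl).symm
    exact (hlab a).trans ha
  refine ⟨H.nonempty.map under, fun h k => ?_, hne, fun h k => ⟨fun E => ?_, hlab' h k⟩,
    fun i => ?_, ?_, fun h k hh hk E => ?_, fun h hh E => ?_⟩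
  · obtain ⟨h', -, h1⟩ := hkept h
    obtain ⟨k', -, h2⟩ := hkept k
    exact h1.trans ((((hc.joined_iff Set.univ h' k').1 (H.connected h' k')).mono
      (Set.subset_univ _)).trans h2.symm)
  · obtain ⟨h', h1, -⟩ := hkept h
    obtain ⟨k', h2, -⟩ := hkept k
    refine h1.trans (Equiv.Perm.SameCycle.trans ?_ h2.symm)
    rw [← sameCycle_bdry_contract, ← H.label_eq_iff, label_contract, label_contract,
      ← hlab' _ _ h1, ← hlab' _ _ h2, E]
  · obtain ⟨h, rfl⟩ := H.label_surjective i
    exact ⟨under h, rfl⟩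
  · have h1 := hc.card_vertex
    have h2 := card_edge_contract y
    have h3 := H.euler
    rw [← h1, ← h2]
    push_cast
    linarith
  · have hk' : ∀ h, G.IsIncoming h → h ≠ y ∧ h ≠ G.rev y := by
      rintro h hh
      exact ⟨fun e => hyg.1 (e ▸ hh), fun e => hyg.2 (e ▸ hh)⟩
    exact congrArg under (H.circles (keep h (hk' h hh)) (keep k (hk' k hk)) hh hk
      ((hc.sameCycle_iff _ _).2 (Or.inl E)))
  · by_cases hk : h ≠ y ∧ h ≠ G.rev y
    · refine H.forest (keep h hk) hh ?_
      refine ((hc.joined_iff (G.ghost \ {h, G.rev h}) (keep h hk)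
        ((G.contract y).rev (keep h hk))).2 (Joined.mono Set.subset_union_left E)).mono ?_
      rintro k ⟨hk, hk'⟩
      refine ⟨hk, fun e => hk' ?_⟩
      rcases e with e | e
      · exact Or.inl (congrArg under e)
      · exact Or.inr (congrArg under e)
    · rcases not_kept hk with rfl | rfl
      · exact hsep E
      · rw [G.rev_rev, Set.pair_comm] at E
        exact hsep E.symm

/-- An edge that is not a loop is a forest. -/
theorem Contractible.isForest (hc : G.Contractible y) : G.IsForest {y, G.rev y} := by
  rintro h (rfl | rfl) H
  · rw [Set.sdiff_self, joined_empty_iff] at H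
    exact hc.not_loop H
  · rw [G.rev_rev, Set.pair_comm, Set.sdiff_self, joined_empty_iff] at H
    exact hc.not_loop H.symm

end ContractDiagram

end RibbonGraph

/-! ### Paths in the space of marked metric chord diagrams -/

section Topology

open RibbonGraph

variable {g p q : ℕ} {Γ Γ' : RibbonGraph (Fin p ⊕ Fin q)}

/-- The diagram `Γ'` arises from `Γ` by collapsing a forest. -/
structure Contracts (g : ℕ) (Γ Γ' : RibbonGraph (Fin p ⊕ Fin q)) : Prop where
  left : Γ.IsChordDiagram g
  right : Γ'.IsChordDiagram g
  collapse : ∃ S : Set Γ.Dart, (∀ h ∈ S, Γ.rev h ∈ S) ∧ Γ.IsForest S ∧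
    Nonempty ((Γ.collapse S).Iso Γ')

/-- The two graphs are connected by a sequence of collapses of forests and inverses of such
collapses, all of them between chord diagrams of genus `g`. -/
def Linked (g : ℕ) : RibbonGraph (Fin p ⊕ Fin q) → RibbonGraph (Fin p ⊕ Fin q) → Prop :=
  Relation.EqvGen (Contracts g)

namespace RibbonGraph

/-- The dart of the diagram that a dart of `S(c)` comes from. -/
def base (h : Γ.core.Dart) : Γ.Dart := Subtype.val (p := (· ∈ Γ.kept Γ.ghost)) h

/-- A dart that is not a ghost, as a dart of `S(c)`. -/
def toCore (h : Γ.Dart) (hh : h ∉ Γ.ghost) : Γ.core.Dart :=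
  (⟨h, hh, fun H => hh (rev_mem_ghost_iff.1 H)⟩ : Γ.kept Γ.ghost)

theorem sameCycle_core {h k : Γ.core.Dart} :
    Γ.core.bdry.SameCycle h k ↔ Γ.bdry.SameCycle (base h) (base k) := by
  have := sameCycle_firstReturn (f := Γ.bdry) (K := Γ.kept Γ.ghost) (a := h) (b := k)
  rw [← collapse_bdry] at this
  exact this

theorem label_core (h : Γ.core.Dart) : Γ.core.label h = Γ.label (base h) := rfl

theorem base_not_mem (h : Γ.core.Dart) : base h ∉ Γ.ghost :=
  (Subtype.property (p := (· ∈ Γ.kept Γ.ghost)) h).1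

theorem IsChordDiagram.core_label_eq_iff (hΓ : Γ.IsChordDiagram g) (h k : Γ.core.Dart) :
    Γ.core.label h = Γ.core.label k ↔ Γ.core.bdry.SameCycle h k := by
  rw [label_core, label_core, hΓ.label_eq_iff, sameCycle_core]

theorem IsChordDiagram.nonempty_markedEdges (hΓ : Γ.IsChordDiagram g) : Nonempty Γ.MarkedEdges := by
  choose f hf hf' using hΓ.weak.exists_circular
  exact ⟨⟨fun i => toCore (f i) (hf' i), hf⟩⟩

/-- Moving the marked edges forward along the boundary cycles of `S(c)`, by `k i` edges on the
`i`-th one. -/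
noncomputable def advance (hΓ : Γ.IsChordDiagram g) (m : Γ.MarkedEdges) (k : Fin p ⊕ Fin q → ℕ) :
    Γ.MarkedEdges :=
  ⟨fun i => (Γ.core.bdry ^ k i) (m.1 i), fun i => by
    rw [← m.2 i, hΓ.core_label_eq_iff]
    rw [m.2 i]
    exact Equiv.Perm.SameCycle.symm ⟨k i, by simp⟩⟩

theorem advance_succ (hΓ : Γ.IsChordDiagram g) (m : Γ.MarkedEdges) (k : Fin p ⊕ Fin q → ℕ) (t : ℕ)
    (i : Fin p ⊕ Fin q) :
    (k i ≤ t ∧ (advance hΓ m fun i => min (t + 1) (k i)).1 i =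
      (advance hΓ m fun i => min t (k i)).1 i) ∨
    (t < k i ∧ (advance hΓ m fun i => min t (k i)).1 i = (Γ.core.bdry ^ t) (m.1 i) ∧
      (advance hΓ m fun i => min (t + 1) (k i)).1 i =
      Γ.core.bdry ((advance hΓ m fun i => min t (k i)).1 i)) := by
  unfold advance
  rcases Nat.lt_or_ge t (k i) with h | h
  · refine Or.inr ⟨h, ?_, ?_⟩
    · dsimp only; rw [min_eq_left h.le]
    · dsimp only; rw [min_eq_left h.le, min_eq_left h, pow_succ', Equiv.Perm.mul_apply]
  · refine Or.inl ⟨h, ?_⟩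
    dsimp only; rw [min_eq_right h, min_eq_right (by omega)]

end RibbonGraph

/-- The point of the space given by a point of a chart. -/
def toSpace {D : MarkedDiagram g p q} (x : Chart D) : MarkedChordDiagramSpace g p q :=
  Quot.mk _ ⟨D, x⟩

theorem continuous_toSpace {D : MarkedDiagram g p q} :
    Continuous (toSpace : Chart D → MarkedChordDiagramSpace g p q) := by
  have h1 : Continuous (Quot.mk (Glue (g := g) (p := p) (q := q))) := continuous_quot_mk
  exact h1.comp continuous_sigmaMk

/-- A point of a chart all of whose edges have positive length. -/
def posPoint (D : MarkedDiagram g p q) (l : D.graph.Dart → ℝ) (s : Fin p ⊕ Fin q → ℝ)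
    (hl : ∀ h, 0 < l h) (hrev : ∀ h, l (D.graph.rev h) = l h)
    (hs : ∀ i, 0 ≤ s i ∧ s i ≤ l (D.dart i)) : Chart D :=
  ⟨(l, s), fun h => (hl h).le, hrev, by
    have : {h | l h = 0} = ∅ := Set.eq_empty_of_forall_notMem fun h hh => (hl h).ne' hh
    change D.graph.IsForest {h | l h = 0} ∧
      (D.graph.collapse {h | l h = 0}).IsChordDiagram g ∧ _
    rw [this]
    exact ⟨fun h hh => hh.elim, D.isChordDiagram.of_iso (collapseEmptyIso _).symm, hs⟩⟩

/-- In a chart, the segment from a point with positive edge lengths to any other point is contained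
in the chart, because all points of the segment but possibly the end point have positive edge
lengths. -/
theorem joined_of_pos {D : MarkedDiagram g p q} (x y : Chart D) (hx : ∀ h, 0 < x.len h) :
    Joined (toSpace x) (toSpace y) := by
  let l : unitInterval → D.graph.Dart → ℝ := fun t h => (1 - t) * x.len h + t * y.len h
  let s : unitInterval → Fin p ⊕ Fin q → ℝ := fun t i => (1 - t) * x.pos i + t * y.pos i
  have hmem : ∀ t, ∃ z : Chart D, z.1 = (l t, s t) := by
    intro t
    rcases eq_or_ne t 1 with rfl | ht
    · refine ⟨y, Prod.ext (funext fun h => ?_) (funext fun i => ?_)⟩ <;>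
        simp [l, s, Chart.len, Chart.pos]
    · have h0 : (0 : ℝ) ≤ t := t.2.1
      have h1 : (0 : ℝ) < 1 - t := by
        have : (t : ℝ) < 1 := lt_of_le_of_ne t.2.2 fun e => ht (Subtype.ext e)
        linarith
      refine ⟨posPoint D (l t) (s t) (fun h => ?_) (fun h => ?_) fun i => ⟨?_, ?_⟩, rfl⟩
      · exact add_pos_of_pos_of_nonneg (mul_pos h1 (hx h)) (mul_nonneg h0 (y.2.1 h))
      · have h2 : x.len (D.graph.rev h) = x.len h := x.2.2.1 h
        have h3 : y.len (D.graph.rev h) = y.len h := y.2.2.1 h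
        simp only [l, h2, h3]
      · exact add_nonneg (mul_nonneg h1.le (x.2.2.2.2.2 i).1) (mul_nonneg h0 (y.2.2.2.2.2 i).1)
      · exact add_le_add (mul_le_mul_of_nonneg_left (x.2.2.2.2.2 i).2 h1.le)
          (mul_le_mul_of_nonneg_left (y.2.2.2.2.2 i).2 h0)
  choose z hz using hmem
  have hcont : Continuous z := by
    refine continuous_induced_rng.2 ?_
    have : Continuous fun t => (l t, s t) :=
      Continuous.prodMk (continuous_pi fun h => by fun_prop) (continuous_pi fun i => by fun_prop)
    exact this.congr fun t => (hz t).symm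
  refine ⟨⟨⟨fun t => toSpace (z t), continuous_toSpace.comp hcont⟩, ?_, ?_⟩⟩
  · refine congrArg toSpace (Subtype.ext ?_)
    rw [hz]
    exact Prod.ext (funext fun h => by simp [l, Chart.len])
      (funext fun i => by simp [s, Chart.pos])
  · refine congrArg toSpace (Subtype.ext ?_)
    rw [hz]
    exact Prod.ext (funext fun h => by simp [l, Chart.len])
      (funext fun i => by simp [s, Chart.pos])

/-- The point of a chart at which all edges have length `1` and the marked points are the initial
points of the marked edges. -/
def unitPoint (D : MarkedDiagram g p q) : Chart D :=
  posPoint D (fun _ => 1) (fun _ => 0) (fun _ => one_pos) (fun _ => rfl)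
    fun _ => ⟨le_rfl, zero_le_one⟩

theorem joined_unitPoint_unitPoint (hΓ : Γ.IsChordDiagram g) (m n : Γ.MarkedEdges) :
    Joined (toSpace (unitPoint ⟨Γ, hΓ, m⟩)) (toSpace (unitPoint ⟨Γ, hΓ, n⟩)) := by
  classical
  have hk : ∀ i, ∃ k : ℕ, (Γ.core.bdry ^ k) (m.1 i) = n.1 i := fun i =>
    exists_pow_eq_of_sameCycle ((hΓ.core_label_eq_iff _ _).1 (by rw [m.2, n.2]))
  choose k hk using hk
  have key : ∀ t, Joined (toSpace (unitPoint ⟨Γ, hΓ, m⟩))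
      (toSpace (unitPoint ⟨Γ, hΓ, advance hΓ m fun i => min t (k i)⟩)) := by
    intro t
    induction t with
    | zero =>
      have : (advance hΓ m fun i => min 0 (k i)) = m :=
        Subtype.ext (funext fun i => by simp [advance])
      rw [this]
    | succ t ih =>
      refine ih.trans ?_
      -- Push the marked points that have to move to the ends of their edges.
      let x : Chart ⟨Γ, hΓ, advance hΓ m fun i => min t (k i)⟩ :=
        posPoint _ (fun _ => 1) (fun i => if t < k i then 1 else 0) (fun _ => one_pos)
          (fun _ => rfl) fun i => by split_ifs <;> norm_num
      refine (joined_of_pos _ x fun _ => one_pos).trans ?_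
      have : toSpace x = toSpace (unitPoint ⟨Γ, hΓ, advance hΓ m fun i => min (t + 1) (k i)⟩) := by
        refine Quot.sound (Glue.slide Γ hΓ _ _ _ _ rfl fun i => ?_)
        rcases advance_succ hΓ m k t i with ⟨h, e⟩ | ⟨h, -, e⟩
        · exact Or.inl ⟨e, (if_neg (by omega)).symm⟩
        · exact Or.inr ⟨e, if_pos h, rfl⟩
      rw [this]
  have h1 := key (∑ i, k i)
  have : (advance hΓ m fun i => min (∑ i, k i) (k i)) = n := Subtype.ext (funext fun i => by
    have : k i ≤ ∑ i, k i := Finset.single_le_sum (fun _ _ => Nat.zero_le _) (Finset.mem_univ i)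
    simp only [advance]
    rw [min_eq_right this, hk])
  rwa [this] at h1

theorem glue_of_zero_eq (D E : MarkedDiagram g p q) (x : Chart D) (y : Chart E)
    {S : Set D.graph.Dart} (hS : x.zero = S) (e : (D.graph.collapse S).Iso E.graph)
    (hlen : ∀ h : D.graph.kept S, y.len (e.toEquiv h) = x.len h)
    (hdart : ∀ i, ∃ h : D.graph.kept S, h = D.dart i ∧ e.toEquiv h = E.dart i)
    (hpos : y.pos = x.pos) : Glue ⟨D, x⟩ ⟨E, y⟩ := by
  subst hS
  exact Glue.collapse D E x y e hlen hdart hpos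

theorem Contracts.joined (H : Contracts g Γ Γ') (m : Γ.MarkedEdges) (n : Γ'.MarkedEdges) :
    Joined (toSpace (unitPoint ⟨Γ, H.left, m⟩)) (toSpace (unitPoint ⟨Γ', H.right, n⟩)) := by
  classical
  obtain ⟨S, hS, hf, ⟨e⟩⟩ := H.collapse
  -- The marked edges of `Γ'` come from edges of `Γ` that are not collapsed.
  let d : Fin p ⊕ Fin q → Γ.kept S := fun i => e.toEquiv.symm (base (n.1 i))
  have hd : ∀ i, e.toEquiv (d i) = base (n.1 i) := fun i => Equiv.apply_symm_apply _ _
  have hd' : ∀ i, (d i : Γ.Dart) ∉ Γ.ghost := by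
    intro i hi
    refine base_not_mem (n.1 i) ?_
    rw [← hd, e.mem_ghost_iff]
    exact hi
  let m' : Γ.MarkedEdges := ⟨fun i => toCore (d i) (hd' i), fun i => by
    rw [label_core]
    change (Γ.collapse S).label (d i) = i
    rw [← e.map_label, hd, ← label_core]
    exact n.2 i⟩
  refine (joined_unitPoint_unitPoint H.left m m').trans ?_
  let D : MarkedDiagram g p q := ⟨Γ, H.left, m'⟩
  let l : Γ.Dart → ℝ := fun h => if h ∈ S then 0 else 1
  have hl : {h | l h = 0} = S := by
    ext h
    change l h = 0 ↔ _
    simp [l]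
  have hl0 : ∀ h, 0 ≤ l h := fun h => by simp only [l]; split_ifs <;> norm_num
  let x : Chart D := ⟨(l, fun _ => 0), hl0, fun h => by
      have : Γ.rev h ∈ S ↔ h ∈ S := ⟨fun H => by simpa [Γ.rev_rev] using hS _ H, hS h⟩
      change l (Γ.rev h) = l h
      simp only [l, this], by
      change Γ.IsForest {h | l h = 0} ∧ (Γ.collapse {h | l h = 0}).IsChordDiagram g ∧ _
      rw [hl]
      exact ⟨hf, H.right.of_iso e.symm, fun i => ⟨le_rfl, hl0 _⟩⟩⟩
  refine (joined_of_pos _ x fun _ => one_pos).trans ?_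
  have : toSpace x = toSpace (unitPoint ⟨Γ', H.right, n⟩) := by
    refine Quot.sound (glue_of_zero_eq D _ x _ hl e (fun h => ?_) (fun i => ?_) rfl)
    · change (1 : ℝ) = l h
      simp only [l, if_neg h.2.1]
    · exact ⟨d i, rfl, hd i⟩
  rw [this]

theorem Linked.isChordDiagram_iff (H : Linked g Γ Γ') :
    Γ.IsChordDiagram g ↔ Γ'.IsChordDiagram g := by
  induction H with
  | rel _ _ H => exact ⟨fun _ => H.right, fun _ => H.left⟩
  | refl => exact Iff.rfl
  | symm _ _ _ ih => exact ih.symm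
  | trans _ _ _ _ _ ih ih' => exact ih.trans ih'

theorem Linked.joined (H : Linked g Γ Γ') (hΓ : Γ.IsChordDiagram g) (hΓ' : Γ'.IsChordDiagram g)
    (m : Γ.MarkedEdges) (n : Γ'.MarkedEdges) :
    Joined (toSpace (unitPoint ⟨Γ, hΓ, m⟩)) (toSpace (unitPoint ⟨Γ', hΓ', n⟩)) := by
  induction H with
  | rel _ _ H => exact H.joined m n
  | refl => exact joined_unitPoint_unitPoint _ m n
  | symm _ _ _ ih => exact (ih hΓ' hΓ n m).symm
  | trans Γ₁ Γ₂ Γ₃ H _ ih ih' =>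
    have h2 := (Linked.isChordDiagram_iff H).1 hΓ
    obtain ⟨l⟩ := h2.nonempty_markedEdges
    exact (ih hΓ h2 m l).trans (ih' h2 hΓ' l n)

/-- Every point of the space lies in the path component of a unit point: marked points on edges of
length zero are first moved on to edges of positive length, then the edges of length zero are
collapsed. -/
theorem exists_joined_unitPoint (P : MarkedChordDiagramSpace g p q) :
    ∃ D : MarkedDiagram g p q, Joined P (toSpace (unitPoint D)) := by
  classical
  induction P using Quot.ind with | _ P => ?_
  obtain ⟨⟨Γ, hΓ, m⟩, x⟩ := P
  set S : Set Γ.Dart := {h | x.len h = 0} with hS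
  have hrev : ∀ h, x.len (Γ.rev h) = x.len h := x.2.2.1
  have hE : (Γ.collapse S).IsChordDiagram g := x.2.2.2.2.1
  have hk : ∀ i, ∃ k : ℕ, x.len (base ((Γ.core.bdry ^ k) (m.1 i))) ≠ 0 := by
    intro i
    obtain ⟨h, hi, hh⟩ := hE.weak.exists_circular i
    let h' : Γ.kept S := h
    have hh' : (h' : Γ.Dart) ∉ Γ.ghost := hh
    obtain ⟨k, hk⟩ := exists_pow_eq_of_sameCycle ((hΓ.core_label_eq_iff (m.1 i) (toCore _ hh')).1
      ((m.2 i).trans hi.symm))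
    exact ⟨k, by rw [hk]; exact h'.2.1⟩
  let k : Fin p ⊕ Fin q → ℕ := fun i => Nat.find (hk i)
  have hk1 : ∀ i, x.len (base ((Γ.core.bdry ^ k i) (m.1 i))) ≠ 0 := fun i => Nat.find_spec (hk i)
  have hk2 : ∀ i t, t < k i → x.len (base ((Γ.core.bdry ^ t) (m.1 i))) = 0 := fun i t ht =>
    not_not.1 (Nat.find_min (hk i) ht)
  have hx : ∀ i, 0 ≤ x.pos i ∧ x.pos i ≤ x.len (base (m.1 i)) := x.2.2.2.2.2
  have hx0 : ∀ i, 0 < k i → x.pos i = 0 := fun i hi => by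
    have h1 := hx i
    have h2 := hk2 i 0 hi
    rw [pow_zero, Equiv.Perm.one_apply] at h2
    rw [h2] at h1
    exact le_antisymm h1.2 h1.1
  -- The same lengths and positions, with the markings moved forward across edges of length zero.
  have hy : ∀ t, ∀ i, 0 ≤ x.pos i ∧
      x.pos i ≤ x.len (base ((advance hΓ m fun i => min t (k i)).1 i)) := by
    intro t i
    rcases Nat.eq_zero_or_pos (k i) with h | h
    · have : (advance hΓ m fun i => min t (k i)).1 i = m.1 i := by simp [advance, h]
      rw [this]; exact hx i
    · rw [hx0 i h]; exact ⟨le_rfl, x.2.1 _⟩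
  let y : ∀ t, Chart ⟨Γ, hΓ, advance hΓ m fun i => min t (k i)⟩ := fun t =>
    ⟨x.1, x.2.1, x.2.2.1, x.2.2.2.1, x.2.2.2.2.1, hy t⟩
  have key : ∀ t, toSpace x = toSpace (y t) := by
    intro t
    induction t with
    | zero =>
      refine Quot.sound (Glue.slide Γ hΓ _ _ _ _ rfl fun i => Or.inl ⟨?_, rfl⟩)
      simp [advance]
    | succ t ih =>
      refine ih.trans (Quot.sound (Glue.slide Γ hΓ _ _ _ _ rfl fun i => ?_))
      rcases advance_succ hΓ m k t i with ⟨h, e⟩ | ⟨h, e', e⟩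
      · exact Or.inl ⟨e, rfl⟩
      · refine Or.inr ⟨e, ?_, hx0 i (by omega)⟩
        change x.pos i = x.len (base ((advance hΓ m fun i => min t (k i)).1 i))
        rw [e', hk2 i t h, hx0 i (by omega)]
  set t := ∑ i, k i with ht
  let n := advance hΓ m fun i => min t (k i)
  have hn : ∀ i, base (n.1 i) ∈ Γ.kept S := by
    intro i
    have h1 : k i ≤ t := Finset.single_le_sum (fun _ _ => Nat.zero_le _) (Finset.mem_univ i)
    have h2 : n.1 i = (Γ.core.bdry ^ k i) (m.1 i) := by
      simp only [n, advance]; rw [min_eq_right h1]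
    rw [h2]
    refine ⟨hk1 i, fun e => hk1 i ?_⟩
    rw [← hrev]; exact e
  let n' : (Γ.collapse S).MarkedEdges := ⟨fun i => toCore
    (show (Γ.collapse S).Dart from (⟨base (n.1 i), hn i⟩ : Γ.kept S)) (base_not_mem (n.1 i)),
    fun i => n.2 i⟩
  let E : MarkedDiagram g p q := ⟨Γ.collapse S, hE, n'⟩
  let z : Chart E := posPoint E (fun h => x.len (Subtype.val (p := (· ∈ Γ.kept S)) h)) x.pos
    (fun h => lt_of_le_of_ne (x.2.1 _) (Ne.symm (Subtype.property (p := (· ∈ Γ.kept S)) h).1))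
    (fun h => hrev _) (hy t)
  have hz : toSpace (y t) = toSpace z := by
    refine Quot.sound (Glue.collapse _ E (y t) z ⟨Equiv.refl _, fun _ => rfl, fun _ => rfl,
      fun _ => rfl⟩ (fun h => rfl) (fun i => ⟨⟨base (n.1 i), hn i⟩, rfl, rfl⟩) rfl)
  refine ⟨E, ?_⟩
  change Joined (toSpace x) _
  rw [key t, hz]
  refine joined_of_pos _ _ fun h => ?_
  exact lt_of_le_of_ne (x.2.1 _) (Ne.symm (Subtype.property (p := (· ∈ Γ.kept S)) h).1)

/-- The space is path connected if there are chord diagrams and any two of them are linked. -/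
theorem pathConnectedSpace_of_linked
    (hne : ∃ Γ : RibbonGraph (Fin p ⊕ Fin q), Γ.IsChordDiagram g)
    (h : ∀ Γ Γ' : RibbonGraph (Fin p ⊕ Fin q), Γ.IsChordDiagram g → Γ'.IsChordDiagram g →
      Linked g Γ Γ') : PathConnectedSpace (MarkedChordDiagramSpace g p q) where
  nonempty := by
    obtain ⟨Γ, hΓ⟩ := hne
    obtain ⟨m⟩ := hΓ.nonempty_markedEdges
    exact ⟨toSpace (unitPoint ⟨Γ, hΓ, m⟩)⟩
  joined P Q := by
    obtain ⟨⟨Γ, hΓ, m⟩, hP⟩ := exists_joined_unitPoint P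
    obtain ⟨⟨Γ', hΓ', n⟩, hQ⟩ := exists_joined_unitPoint Q
    exact hP.trans (((h Γ Γ' hΓ hΓ').joined hΓ hΓ' m n).trans hQ.symm)

end Topology

/-! ### Circles glued along vertices, as pairs of permutations -/

open Classical in
/-- The image of `z` under the permutation obtained from `f` by deleting `x` from its cycle. -/
noncomputable def skip {Z : Type} (x : Z) (f : Equiv.Perm Z) (z : Z) : Z :=
  if f z = x then f x else f z

section Skip

variable {X Z : Type} {x z : Z} {f : Equiv.Perm Z}

theorem skip_of_eq (h : f z = x) : skip x f z = f x := if_pos h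

theorem skip_of_ne (h : f z ≠ x) : skip x f z = f z := if_neg h

theorem firstReturn_ne_eq_skip [Finite Z] (u : {z : Z | z ≠ x}) :
    (firstReturn f {z | z ≠ x} u : Z) = skip x f u := by
  have hne : skip x f u ≠ x := by
    by_cases h : f u = x
    · rw [skip_of_eq h]; exact fun e => u.2 (f.injective (h.trans e.symm))
    · rwa [skip_of_ne h]
  have : firstReturn f {z | z ≠ x} u = ⟨skip x f u, hne⟩ := by
    rw [firstReturn_eq_iff]
    by_cases h : f u = x
    · refine .skip (fun h' => h' h) ?_
      rw [h]
      exact .here (skip_of_eq h).symm hne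
    · exact .here (skip_of_ne h).symm hne
  rw [this]

theorem sameCycle_of_skip [Finite X] [Finite Z] {f' : Equiv.Perm X} {j : X → Z}
    (hj : Function.Injective j) (hne : ∀ u, j u ≠ x) (hrange : ∀ z, z ≠ x → ∃ u, j u = z)
    (h : ∀ u, j (f' u) = skip x f (j u)) {u v : X} :
    f'.SameCycle u v ↔ f.SameCycle (j u) (j v) := by
  let J : X ≃ {z : Z | z ≠ x} := Equiv.ofBijective (fun u => ⟨j u, hne u⟩)
    ⟨fun u v e => hj (congrArg Subtype.val e), fun z => by
      obtain ⟨u, hu⟩ := hrange z z.2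
      exact ⟨u, Subtype.ext hu⟩⟩
  rw [← RibbonGraph.sameCycle_map_iff (f' := firstReturn f {z | z ≠ x}) J (fun u => Subtype.ext
    ((h u).trans (firstReturn_ne_eq_skip (J u)).symm)), sameCycle_firstReturn]
  rfl

end Skip

open Classical in
/-- The permutation obtained from `f` by inserting a new point after `a` in the cycle of `a`. -/
noncomputable def insertAfter {X : Type} (f : Equiv.Perm X) (a : X) : Equiv.Perm (Option X) :=
  Equiv.optionCongr f * Equiv.swap (some a) none

section InsertAfter

variable {X : Type} (f : Equiv.Perm X) (a : X)

theorem insertAfter_none : insertAfter f a none = some (f a) := by simp [insertAfter]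

theorem insertAfter_self : insertAfter f a (some a) = none := by simp [insertAfter]

variable {a} in
theorem insertAfter_some {x : X} (h : x ≠ a) : insertAfter f a (some x) = some (f x) := by
  classical
  have : Equiv.swap (some a) none (some x) = some x :=
    Equiv.swap_apply_of_ne_of_ne (by simpa using h) (by simp)
  simp [insertAfter, this]

theorem insertAfter_eq_skip (u : X) : some (f u) = skip none (insertAfter f a) (some u) := by
  by_cases h : u = a
  · subst h; rw [skip_of_eq (insertAfter_self f u), insertAfter_none]
  · rw [skip_of_ne (by rw [insertAfter_some f h]; exact Option.some_ne_none _),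
      insertAfter_some f h]

end InsertAfter

/-- The combinatorial data of a graph like `S(c)`: a set `X` of edges, each directed along the
incoming boundary cycle that it lies on. The cycles of `inn` are the incoming boundary cycles, and
those of `out` are the outgoing ones, in which the edges occur with the opposite direction. The
functions `li` and `lo` label the incoming and the outgoing cycles. -/
structure Core (p q : ℕ) where
  X : Type
  [finite : Finite X]
  inn : Equiv.Perm X
  out : Equiv.Perm X
  li : X → Fin p
  lo : X → Fin q

attribute [instance] Core.finite

namespace Core

variable {p q : ℕ}

/-- The cycles of `tau` are the vertices: `tau` maps an edge to the next edge, in the cyclic ordering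
at its initial vertex, that is directed away from this vertex. -/
def tau (c : Core p q) : Equiv.Perm c.X := c.inn * c.out

theorem tau_apply (c : Core p q) (x : c.X) : c.tau x = c.inn (c.out x) := rfl

/-- The labellings of the incoming and outgoing cycles are bijective. -/
structure IsLabelled (c : Core p q) : Prop where
  li_iff : ∀ x y, c.li x = c.li y ↔ c.inn.SameCycle x y
  lo_iff : ∀ x y, c.lo x = c.lo y ↔ c.out.SameCycle x y
  li_surj : Function.Surjective c.li
  lo_surj : Function.Surjective c.lo

/-- A labelled core with exactly one vertex. -/
structure IsOneVertex (c : Core p q) : Prop extends c.IsLabelled where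
  tau_sameCycle : ∀ x y, c.tau.SameCycle x y

theorem IsLabelled.li_inn {c : Core p q} (hc : c.IsLabelled) (x : c.X) :
    c.li (c.inn x) = c.li x :=
  (hc.li_iff _ _).2 (Equiv.Perm.sameCycle_apply_left.2 (Equiv.Perm.SameCycle.refl _ _))

theorem IsLabelled.lo_out {c : Core p q} (hc : c.IsLabelled) (x : c.X) :
    c.lo (c.out x) = c.lo x :=
  (hc.lo_iff _ _).2 (Equiv.Perm.sameCycle_apply_left.2 (Equiv.Perm.SameCycle.refl _ _))

/-- The core `c` arises from `e` by deleting the edge `x` from its incoming and its outgoing cycle.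
If `x` is not a loop, this is the contraction of `x`. -/
structure Del (e : Core p q) (x : e.X) (c : Core p q) (j : c.X → e.X) : Prop where
  inj : Function.Injective j
  ne : ∀ u, j u ≠ x
  range : ∀ z, z ≠ x → ∃ u, j u = z
  inn : ∀ u, j (c.inn u) = skip x e.inn (j u)
  out : ∀ u, j (c.out u) = skip x e.out (j u)
  li : ∀ u, c.li u = e.li (j u)
  lo : ∀ u, c.lo u = e.lo (j u)

/-- The core has exactly two vertices, and the edge `x` joins them. -/
structure Splits (e : Core p q) (x : e.X) : Prop where
  not_loop : ¬ e.tau.SameCycle x (e.inn x)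
  two : ∀ z, e.tau.SameCycle x z ∨ e.tau.SameCycle (e.inn x) z

theorem Splits.inn_ne {e : Core p q} {x : e.X} (h : e.Splits x) : e.inn x ≠ x := fun E =>
  h.not_loop (by rw [E])

theorem Splits.out_ne {e : Core p q} {x : e.X} (h : e.Splits x) : e.out x ≠ x := fun E =>
  h.not_loop ⟨1, by rw [zpow_one, tau_apply, E]⟩

theorem Splits.of_not_loop {e : Core p q} {x y : e.X} (h : e.Splits x)
    (hy : ¬ e.tau.SameCycle y (e.inn y)) : e.Splits y := by
  refine ⟨hy, fun z => ?_⟩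
  rcases h.two y with h1 | h1 <;> rcases h.two (e.inn y) with h2 | h2
  · exact absurd (h1.symm.trans h2) hy
  · exact (h.two z).imp h1.symm.trans h2.symm.trans
  · exact (h.two z).symm.imp h1.symm.trans h2.symm.trans
  · exact absurd (h1.symm.trans h2) hy

/-- The only edges that end at a bivalent vertex are its two neighbours. -/
theorem Splits.tau_ne {e : Core p q} {x y : e.X} (hx : e.Splits x) (hy : e.Splits y) (hxy : x ≠ y)
    (h1 : ¬ (e.inn y = x ∧ e.out x = y)) (h2 : ¬ (e.inn x = y ∧ e.out y = x)) (z : e.X) :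
    e.tau z ≠ z := by
  intro hz
  have hw : ∀ w, e.tau.SameCycle w z → w = z := by
    intro w hw
    exact mem_of_sameCycle (W := {w | w = z}) (by rintro a rfl; exact hz) hw.symm rfl
  have hx' : x = z ∨ e.inn x = z := (hx.two z).imp (hw _) (hw _)
  have hy' : y = z ∨ e.inn y = z := (hy.two z).imp (hw _) (hw _)
  rcases hx' with rfl | hx' <;> rcases hy' with hy' | hy'
  · exact hxy hy'.symm
  · exact h1 ⟨hy', e.inn.injective (hz.trans hy'.symm)⟩
  · subst hy'
    exact h2 ⟨hx', e.inn.injective (hz.trans hx'.symm)⟩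
  · exact hxy (e.inn.injective (hx'.trans hy'.symm))

namespace Del

variable {e c : Core p q} {x : e.X} {j : c.X → e.X}

theorem card (H : Del e x c j) : Nat.card c.X + 1 = Nat.card e.X := by
  rw [← Finite.card_option]
  classical
  refine Nat.card_congr (((Equiv.ofBijective (fun u => (⟨j u, H.ne u⟩ : {z // z ≠ x}))
    ⟨fun u v e => H.inj (congrArg Subtype.val e), fun z => ?_⟩).optionCongr).trans
    (Equiv.optionSubtypeNe x))
  obtain ⟨u, hu⟩ := H.range z z.2
  exact ⟨u, Subtype.ext hu⟩

theorem tau_of_out_eq (H : Del e x c j) {u : c.X} (h : e.out (j u) = x) (hx : e.tau x ≠ x) :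
    j (c.tau u) = e.tau x := by
  rw [tau_apply, H.inn, H.out, skip_of_eq h]
  exact skip_of_ne hx

theorem tau_of_out_eq' (H : Del e x c j) {u : c.X} (h : e.out (j u) = x) (hx : e.tau x = x) :
    j (c.tau u) = e.inn x := by
  rw [tau_apply, H.inn, H.out, skip_of_eq h]
  exact skip_of_eq hx

theorem tau_of_tau_eq (H : Del e x c j) {u : c.X} (h : e.out (j u) ≠ x) (hx : e.tau (j u) = x) :
    j (c.tau u) = e.inn x := by
  rw [tau_apply, H.inn, H.out, skip_of_ne h]
  exact skip_of_eq hx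

theorem tau_of_ne (H : Del e x c j) {u : c.X} (h : e.out (j u) ≠ x) (hx : e.tau (j u) ≠ x) :
    j (c.tau u) = e.tau (j u) := by
  rw [tau_apply, H.inn, H.out, skip_of_ne h]
  exact skip_of_ne hx

/-- If deleting the edge `x` leaves a single vertex, then `x` joins two vertices. -/
theorem splits (H : Del e x c j) (hc : ∀ u v, c.tau.SameCycle u v) (h1 : e.inn x ≠ x)
    (h2 : e.out x ≠ x) : e.Splits x := by
  obtain ⟨u₀, hu₀⟩ := H.range _ h1
  have hb : e.out (e.out.symm x) = x := e.out.apply_symm_apply x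
  have hbx : e.out.symm x ≠ x := fun E => h2 (by rwa [E] at hb)
  obtain ⟨ub, hub⟩ := H.range _ hbx
  have hfwd : ∀ z, e.tau.SameCycle z (e.tau z) := fun z =>
    Equiv.Perm.sameCycle_apply_right.2 (Equiv.Perm.SameCycle.refl _ _)
  constructor
  · -- Otherwise the edges from `inn x` up to the return to `x` would be a union of cycles of
    -- `c.tau` that does not contain the edge before `x` on its outgoing cycle.
    intro hs
    have hex : ∃ n : ℕ, (e.tau ^ n) (e.inn x) = x := exists_pow_eq_of_sameCycle hs.symm
    classical
    set n := Nat.find hex with hn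
    have hn1 : (e.tau ^ n) (e.inn x) = x := Nat.find_spec hex
    have hn2 : ∀ i < n, (e.tau ^ i) (e.inn x) ≠ x := fun i hi => Nat.find_min hex hi
    have hn0 : 0 < n := by
      rcases Nat.eq_zero_or_pos n with h | h
      · rw [h] at hn1; exact absurd hn1 h1
      · exact h
    have hQ : ∀ i < n, (e.tau ^ i) (e.inn x) ≠ j ub := by
      intro i hi E
      have h3 : (e.tau ^ (i + 1)) (e.inn x) = e.inn x := by
        rw [pow_succ', Equiv.Perm.mul_apply, E, hub, tau_apply, hb]
      refine hn2 (n - (i + 1)) (by omega) ?_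
      rw [← h3, ← Equiv.Perm.mul_apply, ← pow_add, Nat.sub_add_cancel (by omega), hn1]
    have := mem_of_sameCycle (W := {u | ∃ i < n, (e.tau ^ i) (e.inn x) = j u}) ?_ (hc u₀ ub)
      ⟨0, hn0, hu₀.symm⟩
    · obtain ⟨i, hi, E⟩ := this
      exact hQ i hi E
    · rintro u ⟨i, hi, E⟩
      by_cases h3 : e.out (j u) = x
      · have : j u = j ub := by rw [hub, ← h3, Equiv.symm_apply_apply]
        exact absurd (E.trans this) (hQ i hi)
      · have h5 : (e.tau ^ (i + 1)) (e.inn x) = e.tau (j u) := by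
          rw [pow_succ', Equiv.Perm.mul_apply, E]
        by_cases h4 : e.tau (j u) = x
        · exact ⟨0, hn0, (H.tau_of_tau_eq h3 h4).symm⟩
        · refine ⟨i + 1, lt_of_le_of_ne hi fun E' => h4 ?_, h5.trans (H.tau_of_ne h3 h4).symm⟩
          rw [← h5, E', hn1]
  · intro z
    by_cases hz : z = x
    · subst hz; exact Or.inl (Equiv.Perm.SameCycle.refl _ _)
    obtain ⟨u, rfl⟩ := H.range z hz
    refine mem_of_sameCycle (W := {u | e.tau.SameCycle x (j u) ∨ e.tau.SameCycle (e.inn x) (j u)})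
      ?_ (hc u₀ u) (Or.inr (by rw [hu₀]))
    intro u hu
    change _ ∨ _
    by_cases h3 : e.out (j u) = x
    · by_cases h4 : e.tau x = x
      · rw [H.tau_of_out_eq' h3 h4]; exact Or.inr (Equiv.Perm.SameCycle.refl _ _)
      · rw [H.tau_of_out_eq h3 h4]; exact Or.inl (hfwd x)
    · by_cases h4 : e.tau (j u) = x
      · rw [H.tau_of_tau_eq h3 h4]; exact Or.inr (Equiv.Perm.SameCycle.refl _ _)
      · rw [H.tau_of_ne h3 h4]
        exact hu.imp (fun h => h.trans (hfwd _)) (fun h => h.trans (hfwd _))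

/-- Contracting an edge that joins the two vertices of a core leaves a single vertex. -/
theorem tau_sameCycle (H : Del e x c j) (hx : e.Splits x) (u v : c.X) : c.tau.SameCycle u v := by
  obtain ⟨u₁, hu₁⟩ := H.range _ hx.inn_ne
  have hb : e.out (e.out.symm x) = x := e.out.apply_symm_apply x
  have hbx : e.out.symm x ≠ x := fun E => hx.out_ne (by rwa [E] at hb)
  obtain ⟨ub, hub⟩ := H.range _ hbx
  have hτb : e.tau (j ub) = e.inn x := by rw [hub, tau_apply, hb]
  have hfwd : ∀ u, c.tau.SameCycle u (c.tau u) := fun z =>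
    Equiv.Perm.sameCycle_apply_right.2 (Equiv.Perm.SameCycle.refl _ _)
  have hub' : ∀ u, e.out (j u) = x → u = ub := fun u h => H.inj (by
    rw [hub, ← h, Equiv.symm_apply_apply])
  have claim1 : ∀ n : ℕ, ∀ u, j u = (e.tau ^ n) (e.inn x) → c.tau.SameCycle u₁ u := by
    intro n
    induction n with
    | zero =>
      intro u hu
      rw [H.inj (hu₁.trans (hu.trans (by simp)).symm)]
    | succ n ih =>
      intro u hu
      have hw : (e.tau ^ n) (e.inn x) ≠ x := fun E =>
        hx.not_loop (Equiv.Perm.SameCycle.symm ⟨n, by simpa using E⟩)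
      obtain ⟨v, hv⟩ := H.range _ hw
      rw [pow_succ', Equiv.Perm.mul_apply, ← hv] at hu
      by_cases h3 : e.out (j v) = x
      · rw [tau_apply, h3] at hu
        rw [H.inj (hu₁.trans hu.symm)]
      · have : u = c.tau v := H.inj (by
          rw [H.tau_of_ne h3 (by rw [← hu]; exact H.ne u), hu])
        rw [this]
        exact (ih v hv).trans (hfwd v)
  have hub₁ : c.tau.SameCycle u₁ ub := by
    have : e.tau.SameCycle (e.inn x) (j ub) := by
      rw [← hτb]; exact Equiv.Perm.sameCycle_apply_left.2 (Equiv.Perm.SameCycle.refl _ _)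
    obtain ⟨n, hn⟩ := exists_pow_eq_of_sameCycle this
    exact claim1 n ub hn.symm
  have claim2 : ∀ n : ℕ, ∀ u, j u = (e.tau ^ n) x → c.tau.SameCycle ub u := by
    intro n
    induction n with
    | zero => intro u hu; exact absurd hu (by simpa using H.ne u)
    | succ n ih =>
      intro u hu
      rw [pow_succ', Equiv.Perm.mul_apply] at hu
      by_cases hw : (e.tau ^ n) x = x
      · rw [hw] at hu
        have h3 : e.out (j ub) = x := by rw [hub, hb]
        have : u = c.tau ub := H.inj (by
          rw [H.tau_of_out_eq h3 (by rw [← hu]; exact H.ne u), hu])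
        rw [this]; exact hfwd ub
      · obtain ⟨v, hv⟩ := H.range _ hw
        rw [← hv] at hu
        by_cases h3 : e.out (j v) = x
        · rw [hub' v h3] at hv
          refine absurd ⟨(n + 1 : ℕ), ?_⟩ hx.not_loop
          rw [zpow_natCast, pow_succ', Equiv.Perm.mul_apply, ← hv, hτb]
        · have : u = c.tau v := H.inj (by
            rw [H.tau_of_ne h3 (by rw [← hu]; exact H.ne u), hu])
          rw [this]
          exact (ih v hv).trans (hfwd v)
  have all : ∀ u, c.tau.SameCycle u₁ u := by
    intro u
    rcases hx.two (j u) with h | h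
    · obtain ⟨n, hn⟩ := exists_pow_eq_of_sameCycle h
      exact hub₁.trans (claim2 n u hn.symm)
    · obtain ⟨n, hn⟩ := exists_pow_eq_of_sameCycle h
      exact claim1 n u hn.symm
  exact (all u).symm.trans (all v)

theorem inn_sameCycle (H : Del e x c j) {u v : c.X} :
    c.inn.SameCycle u v ↔ e.inn.SameCycle (j u) (j v) :=
  sameCycle_of_skip H.inj H.ne H.range H.inn

theorem out_sameCycle (H : Del e x c j) {u v : c.X} :
    c.out.SameCycle u v ↔ e.out.SameCycle (j u) (j v) :=
  sameCycle_of_skip H.inj H.ne H.range H.out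

theorem isLabelled (H : Del e x c j) (he : e.IsLabelled) (h1 : e.inn x ≠ x) (h2 : e.out x ≠ x) :
    c.IsLabelled where
  li_iff u v := by rw [H.li, H.li, he.li_iff, H.inn_sameCycle]
  lo_iff u v := by rw [H.lo, H.lo, he.lo_iff, H.out_sameCycle]
  li_surj i := by
    obtain ⟨z, rfl⟩ := he.li_surj i
    by_cases hz : z = x
    · subst hz
      obtain ⟨u, hu⟩ := H.range _ h1
      exact ⟨u, by rw [H.li, hu, he.li_inn]⟩
    · obtain ⟨u, rfl⟩ := H.range _ hz
      exact ⟨u, H.li u⟩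
  lo_surj i := by
    obtain ⟨z, rfl⟩ := he.lo_surj i
    by_cases hz : z = x
    · subst hz
      obtain ⟨u, hu⟩ := H.range _ h2
      exact ⟨u, by rw [H.lo, hu, he.lo_out]⟩
    · obtain ⟨u, rfl⟩ := H.range _ hz
      exact ⟨u, H.lo u⟩

theorem isOneVertex (H : Del e x c j) (he : e.IsLabelled) (hx : e.Splits x) : c.IsOneVertex :=
  ⟨H.isLabelled he hx.inn_ne hx.out_ne, H.tau_sameCycle hx⟩

theorem isLabelled_of_del (H : Del e x c j) (hc : c.IsLabelled) (h1 : e.inn x ≠ x)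
    (h2 : e.out x ≠ x) (hl1 : e.li (e.inn x) = e.li x) (hl2 : e.lo (e.out x) = e.lo x) :
    e.IsLabelled := by
  obtain ⟨u₁, hu₁⟩ := H.range _ h1
  obtain ⟨u₂, hu₂⟩ := H.range _ h2
  have k1 : ∀ z, ∃ u, e.li z = c.li u ∧ e.inn.SameCycle z (j u) := by
    intro z
    by_cases hz : z = x
    · subst hz
      refine ⟨u₁, by rw [H.li, hu₁, hl1], ?_⟩
      rw [hu₁]; exact Equiv.Perm.sameCycle_apply_right.2 (Equiv.Perm.SameCycle.refl _ _)
    · obtain ⟨u, rfl⟩ := H.range z hz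
      exact ⟨u, (H.li u).symm, Equiv.Perm.SameCycle.refl _ _⟩
  have k2 : ∀ z, ∃ u, e.lo z = c.lo u ∧ e.out.SameCycle z (j u) := by
    intro z
    by_cases hz : z = x
    · subst hz
      refine ⟨u₂, by rw [H.lo, hu₂, hl2], ?_⟩
      rw [hu₂]; exact Equiv.Perm.sameCycle_apply_right.2 (Equiv.Perm.SameCycle.refl _ _)
    · obtain ⟨u, rfl⟩ := H.range z hz
      exact ⟨u, (H.lo u).symm, Equiv.Perm.SameCycle.refl _ _⟩
  refine ⟨fun z w => ?_, fun z w => ?_, fun i => ?_, fun i => ?_⟩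
  · obtain ⟨u, h, h'⟩ := k1 z
    obtain ⟨v, k, k'⟩ := k1 w
    rw [h, k, hc.li_iff, H.inn_sameCycle]
    exact ⟨fun H => h'.trans (H.trans k'.symm), fun H => h'.symm.trans (H.trans k')⟩
  · obtain ⟨u, h, h'⟩ := k2 z
    obtain ⟨v, k, k'⟩ := k2 w
    rw [h, k, hc.lo_iff, H.out_sameCycle]
    exact ⟨fun H => h'.trans (H.trans k'.symm), fun H => h'.symm.trans (H.trans k')⟩
  · obtain ⟨u, rfl⟩ := hc.li_surj i
    exact ⟨j u, (H.li u).symm⟩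
  · obtain ⟨u, rfl⟩ := hc.lo_surj i
    exact ⟨j u, (H.lo u).symm⟩

end Del

theorem exists_del (e : Core p q) (x : e.X) : ∃ (c : Core p q) (j : c.X → e.X), Del e x c j :=
  ⟨{ X := {z : e.X | z ≠ x}
     inn := firstReturn e.inn _
     out := firstReturn e.out _
     li := fun z => e.li z
     lo := fun z => e.lo z },
   Subtype.val, Subtype.val_injective, fun u => u.2, fun z hz => ⟨⟨z, hz⟩, rfl⟩,
   firstReturn_ne_eq_skip, firstReturn_ne_eq_skip, fun _ => rfl, fun _ => rfl⟩

section Insert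

variable (c : Core p q) (a b : c.X)

/-- The core with a new edge, inserted after `a` in an incoming cycle and after `b` in an outgoing
cycle. -/
noncomputable abbrev insert : Core p q where
  X := Option c.X
  inn := insertAfter c.inn a
  out := insertAfter c.out b
  li := fun z => z.elim (c.li a) c.li
  lo := fun z => z.elim (c.lo b) c.lo

theorem del_insert : Del (c.insert a b) none c some where
  inj := Option.some_injective _
  ne u := Option.some_ne_none u
  range z hz := by
    cases z with
    | none => exact absurd rfl hz
    | some u => exact ⟨u, rfl⟩
  inn u := insertAfter_eq_skip c.inn a u
  out u := insertAfter_eq_skip c.out b u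
  li u := rfl
  lo u := rfl

variable {c}

theorem insert_inn_ne : (c.insert a b).inn none ≠ none := by
  rw [insertAfter_none]; exact Option.some_ne_none _

theorem insert_out_ne : (c.insert a b).out none ≠ none := by
  rw [insertAfter_none]; exact Option.some_ne_none _

theorem IsLabelled.insert (hc : c.IsLabelled) : (c.insert a b).IsLabelled :=
  (c.del_insert a b).isLabelled_of_del hc (insert_inn_ne a b) (insert_out_ne a b)
    (by rw [insertAfter_none]; exact hc.li_inn a) (by rw [insertAfter_none]; exact hc.lo_out b)

theorem IsOneVertex.splits_insert (hc : c.IsOneVertex) : (c.insert a b).Splits none :=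
  (c.del_insert a b).splits hc.tau_sameCycle (insert_inn_ne a b) (insert_out_ne a b)

end Insert

/-- An isomorphism of cores. -/
structure Iso (c c' : Core p q) where
  toEquiv : c.X ≃ c'.X
  inn : ∀ x, toEquiv (c.inn x) = c'.inn (toEquiv x)
  out : ∀ x, toEquiv (c.out x) = c'.out (toEquiv x)
  li : ∀ x, c'.li (toEquiv x) = c.li x
  lo : ∀ x, c'.lo (toEquiv x) = c.lo x

/-- Both cores are contractions of a core with two vertices, neither of which is bivalent. -/
def Step (c c' : Core p q) : Prop :=
  ∃ (e : Core p q) (x y : e.X) (j : c.X → e.X) (j' : c'.X → e.X), e.IsLabelled ∧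
    Del e x c j ∧ Del e y c' j' ∧ e.Splits x ∧ e.Splits y ∧ x ≠ y ∧ ∀ z, e.tau z ≠ z

/-- Both cores have one vertex, and they are isomorphic or related by an expansion followed by a
contraction. -/
structure Adjacent (c c' : Core p q) : Prop where
  left : c.IsOneVertex
  right : c'.IsOneVertex
  cases : Nonempty (c.Iso c') ∨ Step c c'

/-- The equivalence relation on one-vertex cores generated by expansions and contractions. -/
def Related : Core p q → Core p q → Prop := Relation.EqvGen Adjacent

variable {c c' c'' : Core p q}

theorem Related.refl (c : Core p q) : Related c c := Relation.EqvGen.refl _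

theorem Related.symm (h : Related c c') : Related c' c := Relation.EqvGen.symm _ _ h

theorem Related.trans (h : Related c c') (h' : Related c' c'') : Related c c'' :=
  Relation.EqvGen.trans _ _ _ h h'

theorem Adjacent.related (h : Adjacent c c') : Related c c' := Relation.EqvGen.rel _ _ h

theorem Adjacent.card_eq (h : Adjacent c c') : Nat.card c.X = Nat.card c'.X := by
  rcases h.cases with ⟨⟨f⟩⟩ | ⟨e, x, y, j, j', -, h1, h2, -⟩
  · exact Nat.card_congr f.toEquiv
  · have := h1.card; have := h2.card; omega

theorem Related.card_eq (h : Related c c') : Nat.card c.X = Nat.card c'.X := by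
  induction h with
  | rel _ _ h => exact h.card_eq
  | refl => rfl
  | symm _ _ _ ih => exact ih.symm
  | trans _ _ _ _ _ ih ih' => exact ih.trans ih'

theorem Related.isOneVertex_iff (h : Related c c') : c.IsOneVertex ↔ c'.IsOneVertex := by
  induction h with
  | rel _ _ h => exact ⟨fun _ => h.right, fun _ => h.left⟩
  | refl => exact Iff.rfl
  | symm _ _ _ ih => exact ih.symm
  | trans _ _ _ _ _ ih ih' => exact ih.trans ih'

/-- Insert a new edge into a one-vertex core and contract the edge `y` instead. -/
theorem IsOneVertex.exists_related (hc : c.IsOneVertex) (a b y : c.X)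
    (hy : ¬ (c.insert a b).tau.SameCycle (some y) ((c.insert a b).inn (some y)))
    (h1 : ¬ ((c.insert a b).inn (some y) = none ∧ (c.insert a b).out none = some y))
    (h2 : ¬ ((c.insert a b).inn none = some y ∧ (c.insert a b).out (some y) = none)) :
    ∃ (c' : Core p q) (j' : c'.X → Option c.X), c'.IsOneVertex ∧ Related c c' ∧
      Del (c.insert a b) (some y) c' j' := by
  obtain ⟨c', j', hj⟩ := exists_del (c.insert a b) (some y)
  have hx := hc.splits_insert a b
  have hy' := hx.of_not_loop hy
  have he := hc.toIsLabelled.insert a b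
  have hc' := hj.isOneVertex he hy'
  have hne : (none : Option c.X) ≠ some y := (Option.some_ne_none y).symm
  refine ⟨c', j', hc', Adjacent.related ⟨hc, hc', Or.inr ⟨_, _, _, _, _, he, c.del_insert a b, hj,
    hx, hy', hne, ?_⟩⟩, hj⟩
  exact hx.tau_ne hy' hne h1 h2

end Core

namespace Core

variable {p q : ℕ} {c c' e : Core p q}

/-! ### Symmetry and isomorphisms of cores -/

/-- Exchange the incoming and the outgoing cycles. -/
abbrev swap (c : Core p q) : Core q p where
  X := c.X
  inn := c.out
  out := c.inn
  li := c.lo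
  lo := c.li

theorem tau_swap_sameCycle {x y : c.X} :
    c.swap.tau.SameCycle (c.out x) (c.out y) ↔ c.tau.SameCycle x y :=
  RibbonGraph.sameCycle_map_iff (f := c.tau) (f' := c.swap.tau) c.out fun _ => rfl

theorem IsLabelled.swap (h : c.IsLabelled) : c.swap.IsLabelled :=
  ⟨h.lo_iff, h.li_iff, h.lo_surj, h.li_surj⟩

theorem IsOneVertex.swap (h : c.IsOneVertex) : c.swap.IsOneVertex :=
  ⟨h.toIsLabelled.swap, fun x y => by
    obtain ⟨x, rfl⟩ := c.out.surjective x
    obtain ⟨y, rfl⟩ := c.out.surjective y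
    exact tau_swap_sameCycle.2 (h.tau_sameCycle x y)⟩

theorem Splits.swap {x : e.X} (h : e.Splits x) : e.swap.Splits x := by
  obtain ⟨a, rfl⟩ := e.out.surjective x
  have ha : e.tau.SameCycle a (e.inn (e.out a)) := ⟨1, by rw [zpow_one]; rfl⟩
  constructor
  · change ¬ e.swap.tau.SameCycle (e.out a) (e.out (e.out a))
    rw [tau_swap_sameCycle]
    exact fun H => h.not_loop (H.symm.trans ha)
  · intro z
    obtain ⟨z, rfl⟩ := e.out.surjective z
    change e.swap.tau.SameCycle (e.out a) _ ∨ e.swap.tau.SameCycle (e.out (e.out a)) _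
    rw [tau_swap_sameCycle, tau_swap_sameCycle]
    exact (h.two z).symm.imp_left ha.trans

theorem Step.swap (h : Step c c') : Step c.swap c'.swap := by
  obtain ⟨e, x, y, j, j', he, h1, h2, hx, hy, hxy, hne⟩ := h
  refine ⟨e.swap, x, y, j, j', he.swap,
    ⟨h1.inj, h1.ne, h1.range, h1.out, h1.inn, h1.lo, h1.li⟩,
    ⟨h2.inj, h2.ne, h2.range, h2.out, h2.inn, h2.lo, h2.li⟩, hx.swap, hy.swap, hxy, ?_⟩
  intro z hz
  exact hne (e.inn z) (congrArg e.inn hz)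

/-- The inverse isomorphism. -/
def Iso.symm (f : c.Iso c') : c'.Iso c where
  toEquiv := f.toEquiv.symm
  inn x := by rw [Equiv.symm_apply_eq, f.inn, Equiv.apply_symm_apply]
  out x := by rw [Equiv.symm_apply_eq, f.out, Equiv.apply_symm_apply]
  li x := by rw [← f.li, Equiv.apply_symm_apply]
  lo x := by rw [← f.lo, Equiv.apply_symm_apply]

theorem Related.swap (h : Related c c') : Related c.swap c'.swap := by
  induction h with
  | rel c c' h =>
    refine Adjacent.related ⟨h.left.swap, h.right.swap, ?_⟩
    rcases h.cases with ⟨⟨f⟩⟩ | h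
    · exact Or.inl ⟨⟨f.toEquiv, f.out, f.inn, f.lo, f.li⟩⟩
    · exact Or.inr h.swap
  | refl => exact .refl _
  | symm _ _ _ ih => exact ih.symm
  | trans _ _ _ _ _ ih ih' => exact ih.trans ih'

theorem Iso.isOneVertex (f : c.Iso c') (h : c.IsOneVertex) : c'.IsOneVertex := by
  refine ⟨⟨fun x y => ?_, fun x y => ?_, fun i => ?_, fun i => ?_⟩, fun x y => ?_⟩
  · obtain ⟨x, rfl⟩ := f.toEquiv.surjective x
    obtain ⟨y, rfl⟩ := f.toEquiv.surjective y
    rw [f.li, f.li, h.li_iff, RibbonGraph.sameCycle_map_iff f.toEquiv f.inn]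
  · obtain ⟨x, rfl⟩ := f.toEquiv.surjective x
    obtain ⟨y, rfl⟩ := f.toEquiv.surjective y
    rw [f.lo, f.lo, h.lo_iff, RibbonGraph.sameCycle_map_iff f.toEquiv f.out]
  · obtain ⟨x, rfl⟩ := h.li_surj i
    exact ⟨_, f.li x⟩
  · obtain ⟨x, rfl⟩ := h.lo_surj i
    exact ⟨_, f.lo x⟩
  · obtain ⟨x, rfl⟩ := f.toEquiv.surjective x
    obtain ⟨y, rfl⟩ := f.toEquiv.surjective y
    exact (RibbonGraph.sameCycle_map_iff f.toEquiv fun a => by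
      rw [tau_apply, tau_apply, f.inn, f.out]).2 (h.tau_sameCycle x y)

theorem Iso.related (f : c.Iso c') (h : c.IsOneVertex) : Related c c' :=
  Adjacent.related ⟨h, f.isOneVertex h, Or.inl ⟨f⟩⟩

/-! ### Adding an incoming cycle of length one -/

/-- Add an edge that forms an incoming cycle of its own and that is inserted after `s` in an outgoing
cycle. -/
noncomputable abbrev addLoop (c : Core p q) (s : c.X) : Core (p + 1) q where
  X := Option c.X
  inn := Equiv.optionCongr c.inn
  out := insertAfter c.out s
  li := fun z => z.elim (Fin.last p) fun x => (c.li x).castSucc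
  lo := fun z => z.elim (c.lo s) c.lo

theorem sameCycle_optionCongr_some {X : Type} [Finite X] {f : Equiv.Perm X} {x y : X} :
    Equiv.Perm.SameCycle (Equiv.optionCongr f) (some x) (some y) ↔ f.SameCycle x y :=
  (sameCycle_of_skip (x := none) (f := Equiv.optionCongr f) (Option.some_injective _)
    Option.some_ne_none (fun z hz => by
      cases z with
      | none => exact absurd rfl hz
      | some u => exact ⟨u, rfl⟩) fun u =>
        (skip_of_ne (show Equiv.optionCongr f (some u) ≠ none from Option.some_ne_none _)).symm).symm

theorem tau_addLoop_sameCycle {s x y : c.X} :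
    (c.addLoop s).tau.SameCycle (some x) (some y) ↔ c.tau.SameCycle x y := by
  refine (sameCycle_of_skip (x := (none : Option c.X)) (f := (c.addLoop s).tau)
    (Option.some_injective _)
    Option.some_ne_none (fun z hz => by
      cases z with
      | none => exact absurd rfl hz
      | some u => exact ⟨u, rfl⟩) fun u => ?_).symm
  by_cases h : u = s
  · subst h
    rw [skip_of_eq (by rw [tau_apply, insertAfter_self]; rfl), tau_apply, tau_apply,
      insertAfter_none]
    rfl
  · have : (c.addLoop s).tau (some u) = some (c.tau u) := by
      rw [tau_apply, insertAfter_some _ h]; rfl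
    rw [skip_of_ne (by rw [this]; exact Option.some_ne_none _), this]

theorem tau_addLoop_none (c : Core p q) (s : c.X) : (c.addLoop s).tau none = some (c.tau s) := by
  rw [tau_apply, insertAfter_none]; rfl

theorem IsLabelled.addLoop (h : c.IsLabelled) (s : c.X) : (c.addLoop s).IsLabelled := by
  refine ⟨fun x y => ?_, fun x => ?_, fun i => ?_, fun i => ?_⟩
  · have h0 : ∀ y, Equiv.Perm.SameCycle (Equiv.optionCongr c.inn) none y → y = none :=
      fun y hy => mem_of_sameCycle (W := {z | z = none}) (by rintro a rfl; rfl) hy rfl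
    cases x with
    | none =>
      cases y with
      | none => exact ⟨fun _ => Equiv.Perm.SameCycle.refl _ _, fun _ => rfl⟩
      | some y =>
        refine ⟨fun H => absurd H (Fin.castSucc_lt_last _).ne', fun H => absurd (h0 _ H) (by simp)⟩
    | some x =>
      cases y with
      | none =>
        refine ⟨fun H => absurd H (Fin.castSucc_lt_last _).ne, fun H => absurd (h0 _ H.symm) (by simp)⟩
      | some y =>
        change (c.li x).castSucc = (c.li y).castSucc ↔ _
        rw [Fin.castSucc_inj, h.li_iff, sameCycle_optionCongr_some]
  · exact (h.insert s s).lo_iff x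
  · refine Fin.lastCases ⟨none, rfl⟩ (fun i => ?_) i
    obtain ⟨x, rfl⟩ := h.li_surj i
    exact ⟨some x, rfl⟩
  · obtain ⟨x, rfl⟩ := h.lo_surj i
    exact ⟨some x, rfl⟩

theorem IsOneVertex.addLoop (h : c.IsOneVertex) (s : c.X) : (c.addLoop s).IsOneVertex := by
  refine ⟨h.toIsLabelled.addLoop s, ?_⟩
  have key : ∀ z, (c.addLoop s).tau.SameCycle (some s) z := by
    intro z
    cases z with
    | some x => exact tau_addLoop_sameCycle.2 (h.tau_sameCycle s x)
    | none =>
      have : (c.addLoop s).tau.SameCycle none (some (c.tau s)) :=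
        ⟨1, by rw [zpow_one, tau_addLoop_none]⟩
      exact (this.trans (tau_addLoop_sameCycle.2 (h.tau_sameCycle _ _))).symm
  exact fun x y => (key x).symm.trans (key y)

/-- The place at which the loop is added does not matter: expand the circle of length one by a
second edge at the new place, and contract the first edge. -/
theorem IsOneVertex.addLoop_related (h : c.IsOneVertex) (s s' : c.X) :
    Related (c.addLoop s) (c.addLoop s') := by
  by_cases hss : s = s'
  · subst hss; exact .refl _
  have hc := h.addLoop s
  let e := (c.addLoop s).insert none (some s')
  have hin : e.inn none = some none := by
    change insertAfter _ _ _ = _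
    rw [insertAfter_none]; rfl
  have hin' : e.inn (some none) = none := insertAfter_self _ _
  have hin'' : ∀ u : c.X, e.inn (some (some u)) = some (some (c.inn u)) := fun u => by
    change insertAfter _ _ _ = _
    rw [insertAfter_some _ (Option.some_ne_none u)]; rfl
  have ho : e.out none = some (some (c.out s')) := by
    change insertAfter _ _ _ = _
    rw [insertAfter_none]
    change some (insertAfter c.out s _) = _
    rw [insertAfter_some _ (Ne.symm hss)]
  have ho1 : e.out (some none) = some (some (c.out s)) := by
    change insertAfter _ _ _ = _
    rw [insertAfter_some _ (Option.some_ne_none s').symm]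
    change some (insertAfter c.out s _) = _
    rw [insertAfter_none]
  have ho2 : e.out (some (some s)) = some none := by
    change insertAfter _ _ _ = _
    rw [insertAfter_some _ (by simpa using hss)]
    change some (insertAfter c.out s _) = _
    rw [insertAfter_self]
  have ho3 : e.out (some (some s')) = none := insertAfter_self _ _
  have ho4 : ∀ u : c.X, u ≠ s → u ≠ s' → e.out (some (some u)) = some (some (c.out u)) := by
    intro u hu hu'
    change insertAfter _ _ _ = _
    rw [insertAfter_some _ (by simpa using hu')]
    change some (insertAfter c.out s _) = _
    rw [insertAfter_some _ hu]
  have he : e.IsLabelled := hc.toIsLabelled.insert _ _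
  let j' : (c.addLoop s').X → e.X := fun z => z.elim none fun x => some (some x)
  have hd : Del e (some none) (c.addLoop s') j' := by
    refine ⟨?_, ?_, ?_, ?_, ?_, ?_, ?_⟩
    · rintro (_ | u) (_ | v) huv
      · rfl
      · exact absurd huv (by simp [j'])
      · exact absurd huv (by simp [j'])
      · exact congrArg some (Option.some.inj (Option.some.inj huv))
    · rintro (_ | u)
      · exact (Option.some_ne_none _).symm
      · exact fun E => Option.some_ne_none u (Option.some.inj E)
    · rintro (_ | _ | u) hz
      · exact ⟨none, rfl⟩
      · exact absurd rfl hz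
      · exact ⟨some u, rfl⟩
    · rintro (_ | u)
      · change (none : e.X) = skip (some none) e.inn none
        rw [skip_of_eq hin, hin']
      · change (some (some (c.inn u)) : e.X) = skip (some none) e.inn (some (some u))
        rw [skip_of_ne (by rw [hin'']; simp), hin'']
    · rintro (_ | u)
      · change j' (insertAfter c.out s' none) = skip (some none) e.out none
        rw [insertAfter_none, skip_of_ne (by rw [ho]; simp), ho]; rfl
      · change j' (insertAfter c.out s' (some u)) = skip (some none) e.out (some (some u))
        by_cases h1 : u = s
        · subst h1
          rw [insertAfter_some _ hss, skip_of_eq ho2, ho1]; rfl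
        · by_cases h2 : u = s'
          · subst h2
            rw [insertAfter_self, skip_of_ne (by rw [ho3]; simp), ho3]; rfl
          · rw [insertAfter_some _ h2, skip_of_ne (by rw [ho4 u h1 h2]; simp), ho4 u h1 h2]; rfl
    · rintro (_ | u) <;> rfl
    · rintro (_ | u) <;> rfl
  have hx : e.Splits none := hc.splits_insert _ _
  have hy : e.Splits (some none) := hd.splits (h.addLoop s').tau_sameCycle
    (by rw [hin']; exact (Option.some_ne_none _).symm)
    (by rw [ho1]; exact fun E => Option.some_ne_none _ (Option.some.inj E))
  refine Adjacent.related ⟨hc, h.addLoop s', Or.inr ⟨e, none, some none, some, j', he,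
    Core.del_insert _ _ _, hd, hx, hy, by simp, hx.tau_ne hy (by simp) ?_ ?_⟩⟩
  · rw [ho]; exact fun E => Option.some_ne_none _ (Option.some.inj E.2)
  · rw [ho1]; exact fun E => Option.some_ne_none _ E.2

theorem Iso.addLoop (f : c.Iso c') (s : c.X) :
    Nonempty ((c.addLoop s).Iso (c'.addLoop (f.toEquiv s))) := by
  refine ⟨⟨f.toEquiv.optionCongr, ?_, ?_, ?_, ?_⟩⟩
  · rintro (_ | x)
    · rfl
    · exact congrArg some (f.inn x)
  · rintro (_ | x)
    · change f.toEquiv.optionCongr (insertAfter _ _ _) = insertAfter _ _ _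
      rw [insertAfter_none]
      exact (congrArg some (f.out s)).trans (insertAfter_none _ _).symm
    · change f.toEquiv.optionCongr (insertAfter _ _ _) = insertAfter _ _ (some (f.toEquiv x))
      by_cases h : x = s
      · subst h
        rw [insertAfter_self, insertAfter_self]; rfl
      · rw [insertAfter_some _ h, insertAfter_some _ (fun E => h (f.toEquiv.injective E)), ← f.out]
        rfl
  · rintro (_ | x)
    · rfl
    · exact congrArg Fin.castSucc (f.li x)
  · rintro (_ | x)
    · exact f.lo s
    · exact f.lo x

theorem Del.addLoop {x : e.X} {j : c.X → e.X} (H : Del e x c j) (u : c.X) :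
    Del (e.addLoop (j u)) (some x) (c.addLoop u) (Option.map j) where
  inj := Option.map_injective H.inj
  ne := by
    rintro (_ | v)
    · simp
    · simpa using H.ne v
  range := by
    rintro (_ | z) hz
    · exact ⟨none, rfl⟩
    · obtain ⟨v, rfl⟩ := H.range z fun E => hz (congrArg some E)
      exact ⟨some v, rfl⟩
  inn := by
    rintro (_ | v)
    · change none = skip _ _ none
      rw [skip_of_ne (by simp)]; rfl
    · change some (j (c.inn v)) = skip (some x) _ (some (j v))
      rw [H.inn]
      by_cases h : e.inn (j v) = x
      · rw [skip_of_eq h, skip_of_eq (by simpa using h)]; rfl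
      · rw [skip_of_ne h, skip_of_ne (by simpa using h)]; rfl
  out := by
    have h0 : insertAfter e.out (j u) (some x) = some (e.out x) :=
      insertAfter_some _ (H.ne u).symm
    rintro (_ | v)
    · change Option.map j (insertAfter _ _ _) = skip (some x) (insertAfter _ _) none
      rw [insertAfter_none]
      change some (j _) = _
      rw [H.out]
      by_cases h : e.out (j u) = x
      · rw [skip_of_eq h, skip_of_eq (by rw [insertAfter_none, h]), h0]
      · rw [skip_of_ne h, skip_of_ne (by rw [insertAfter_none]; simpa using h), insertAfter_none]
    · change Option.map j (insertAfter _ _ _) = skip (some x) (insertAfter _ _) (some (j v))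
      by_cases hv : v = u
      · subst hv
        rw [insertAfter_self, skip_of_ne (by rw [insertAfter_self]; simp), insertAfter_self]; rfl
      · have hv' : insertAfter e.out (j u) (some (j v)) = some (e.out (j v)) :=
          insertAfter_some _ fun E => hv (H.inj E)
        rw [insertAfter_some _ hv]
        change some (j _) = _
        rw [H.out]
        by_cases h : e.out (j v) = x
        · rw [skip_of_eq h, skip_of_eq (by rw [hv', h]), h0]
        · rw [skip_of_ne h, skip_of_ne (by rw [hv']; simpa using h), hv']
  li := by
    rintro (_ | v)
    · rfl
    · exact congrArg Fin.castSucc (H.li v)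
  lo := by
    rintro (_ | v)
    · exact H.lo u
    · exact H.lo v

theorem Step.exists_ne (h : Step c c') : ∃ (e : Core p q) (x y z : e.X) (j : c.X → e.X)
    (j' : c'.X → e.X), e.IsLabelled ∧
    Del e x c j ∧ Del e y c' j' ∧ e.Splits x ∧ e.Splits y ∧ x ≠ y ∧ (∀ z, e.tau z ≠ z) ∧
    z ≠ x ∧ z ≠ y := by
  obtain ⟨e, x, y, j, j', he, h1, h2, hx, hy, hxy, hne⟩ := h
  by_cases hz : ∃ z, z ≠ x ∧ z ≠ y
  · obtain ⟨z, hz⟩ := hz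
    exact ⟨e, x, y, z, j, j', he, h1, h2, hx, hy, hxy, hne, hz⟩
  -- If `x` and `y` were the only edges, then they would be the only edges starting at their
  -- initial vertices, which would therefore be bivalent.
  · exfalso
    push Not at hz
    have h3 : e.inn x = y := hz _ hx.inn_ne
    have h4 : e.tau x = y := hz _ (hne x)
    refine hx.not_loop ⟨1, ?_⟩
    rw [zpow_one, h4, h3]

/-- Moves between cores extend to the cores with an additional incoming cycle of length one. This
cycle is added next to an edge that does not take part in the move. -/
theorem Adjacent.addLoop (h : Adjacent c c') (s : c.X) (s' : c'.X) :
    Related (c.addLoop s) (c'.addLoop s') := by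
  rcases h.cases with ⟨⟨f⟩⟩ | hs
  · obtain ⟨F⟩ := f.addLoop s
    exact (F.related (h.left.addLoop s)).trans (h.right.addLoop_related _ _)
  · obtain ⟨e, x, y, z, j, j', he, h1, h2, hx, hy, hxy, hne, hzx, hzy⟩ := hs.exists_ne
    obtain ⟨u, hu⟩ := h1.range z hzx
    obtain ⟨v, hv⟩ := h2.range z hzy
    refine (h.left.addLoop_related s u).trans (.trans ?_ (h.right.addLoop_related v s'))
    have g1 := h1.addLoop u
    have g2 := h2.addLoop v
    rw [hu] at g1
    rw [hv] at g2
    have he' := he.addLoop z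
    have i1 : ∀ w : e.X, e.Splits w → (e.addLoop z).inn (some w) ≠ some w := fun w hw => by
      simpa using hw.inn_ne
    have i2 : ∀ w : e.X, e.Splits w → w ≠ z → (e.addLoop z).out (some w) ≠ some w :=
      fun w hw hwz => by
        change insertAfter _ _ _ ≠ _
        rw [insertAfter_some _ hwz]; simpa using hw.out_ne
    refine Adjacent.related ⟨h.left.addLoop u, h.right.addLoop v, Or.inr ⟨e.addLoop z, some x,
      some y, _, _, he', g1, g2, ?_, ?_, by simpa using hxy, ?_⟩⟩
    · exact g1.splits (h.left.addLoop u).tau_sameCycle (i1 x hx) (i2 x hx hzx.symm)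
    · exact g2.splits (h.right.addLoop v).tau_sameCycle (i1 y hy) (i2 y hy hzy.symm)
    · rintro (_ | w)
      · rw [tau_addLoop_none]; simp
      · by_cases hw : w = z
        · subst hw
          rw [tau_apply]
          change Equiv.optionCongr e.inn (insertAfter e.out w (some w)) ≠ _
          rw [insertAfter_self]; simp
        · rw [tau_apply]
          change Equiv.optionCongr e.inn (insertAfter e.out z (some w)) ≠ _
          rw [insertAfter_some _ hw]
          exact fun E => hne w (Option.some.inj E)

theorem IsOneVertex.nonempty [NeZero p] (h : c.IsOneVertex) : Nonempty c.X :=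
  ⟨(h.li_surj 0).choose⟩

theorem Related.addLoop [NeZero p] (h : Related c c') (hc : c.IsOneVertex) (s : c.X) (s' : c'.X) :
    Related (c.addLoop s) (c'.addLoop s') := by
  induction h with
  | rel _ _ h => exact h.addLoop s s'
  | refl => exact hc.addLoop_related s s'
  | symm c c' h ih => exact (ih ((Related.isOneVertex_iff h).2 hc) s' s).symm
  | trans c c₁ c' h _ ih ih' =>
    have h1 := (Related.isOneVertex_iff h).1 hc
    obtain ⟨t⟩ := h1.nonempty
    exact (ih hc s t).trans (ih' h1 t s')

/-- A one-vertex core that has an incoming cycle of length one, besides other incoming cycles, is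
obtained by adding this cycle to another one-vertex core. -/
theorem IsOneVertex.exists_iso_addLoop {c : Core (p + 1) q} [NeZero p] (hc : c.IsOneVertex)
    {b : c.X} (hb : c.li b = Fin.last p) (hbb : c.inn b = b) :
    ∃ (d : Core p q) (s : d.X), d.IsOneVertex ∧ Nonempty (c.Iso (d.addLoop s)) := by
  classical
  have hli : ∀ x, c.li x = Fin.last p → x = b := by
    intro x hx
    have := (hc.li_iff b x).1 (hb.trans hx.symm)
    exact mem_of_sameCycle (W := {x | x = b}) (by rintro a rfl; exact hbb) this rfl
  obtain ⟨a, ha⟩ := hc.li_surj (Fin.castSucc 0)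
  have hab : a ≠ b := by
    rintro rfl
    exact (Fin.castSucc_lt_last (0 : Fin p)).ne (ha.symm.trans hb)
  have hob : c.out b ≠ b := by
    intro h
    have : c.tau b = b := by rw [tau_apply, h, hbb]
    exact hab (mem_of_sameCycle (W := {x | x = b}) (by rintro a rfl; exact this)
      (hc.tau_sameCycle b a) rfl)
  have hinn : ∀ z, z ≠ b → c.inn z ≠ b := fun z hz h => hz (c.inn.injective (h.trans hbb.symm))
  let d : Core p q :=
    { X := {z : c.X | z ≠ b}
      inn := firstReturn c.inn _
      out := firstReturn c.out _
      li := fun z => (c.li z).castPred fun h => z.2 (hli z h)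
      lo := fun z => c.lo z }
  have hdi : ∀ u : d.X, (Subtype.val (p := (· ∈ {z : c.X | z ≠ b})) (d.inn u)) = c.inn u.1 :=
    fun u => (firstReturn_ne_eq_skip u).trans (skip_of_ne (hinn _ u.2))
  have hdo : ∀ u : d.X, (Subtype.val (p := (· ∈ {z : c.X | z ≠ b})) (d.out u)) =
    skip b c.out u.1 := fun u => firstReturn_ne_eq_skip u
  have hcs : ∀ u : d.X, (d.li u).castSucc = c.li u.1 := fun u =>
    Fin.castSucc_castPred _ fun h => u.2 (hli u.1 h)
  have hd : d.IsOneVertex := by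
    refine ⟨⟨fun x y => ?_, fun x y => ?_, fun i => ?_, fun i => ?_⟩, fun x y => ?_⟩
    · rw [sameCycle_firstReturn, ← hc.li_iff]
      exact ⟨fun E => (hcs x).symm.trans ((congrArg Fin.castSucc E).trans (hcs y)), fun E => by simp only [d, E]⟩
    · rw [sameCycle_firstReturn, ← hc.lo_iff]
    · obtain ⟨x, hx⟩ := hc.li_surj i.castSucc
      have hxb : x ≠ b := by
        rintro rfl
        exact (Fin.castSucc_lt_last i).ne (hx.symm.trans hb)
      exact ⟨⟨x, hxb⟩, by simp only [d, hx, Fin.castPred_castSucc]⟩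
    · obtain ⟨x, hx⟩ := hc.lo_surj i
      by_cases hxb : x = b
      · exact ⟨⟨c.out b, hob⟩, by
          change c.lo (c.out b) = i
          rw [hc.lo_out, ← hx, hxb]⟩
      · exact ⟨⟨x, hxb⟩, hx⟩
    · refine (sameCycle_of_skip (x := b) (f := c.tau) (j := fun u : d.X => u.1)
        Subtype.val_injective (fun u => u.2) (fun z hz => ⟨⟨z, hz⟩, rfl⟩) fun u => ?_).2
        (hc.tau_sameCycle _ _)
      change Subtype.val (p := (· ∈ {z : c.X | z ≠ b})) (d.inn (d.out u)) = _
      rw [hdi]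
      change c.inn (Subtype.val (p := (· ∈ {z : c.X | z ≠ b})) (d.out u)) = _
      rw [hdo]
      by_cases h : c.out u.1 = b
      · rw [skip_of_eq h, skip_of_eq (by rw [tau_apply, h, hbb])]; rfl
      · rw [skip_of_ne h]; exact (skip_of_ne (f := c.tau) (hinn _ h)).symm
  have hs : c.out (c.out.symm b) = b := c.out.apply_symm_apply b
  let s : d.X := ⟨c.out.symm b, fun h => hob (by rwa [h] at hs)⟩
  refine ⟨d, s, hd, ⟨(Core.Iso.symm ⟨Equiv.optionSubtypeNe b, ?_, ?_, ?_, ?_⟩)⟩⟩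
  · rintro (_ | u)
    · exact hbb.symm
    · exact hdi u
  · rintro (_ | u)
    · change Equiv.optionSubtypeNe b (insertAfter d.out s none) = c.out b
      rw [insertAfter_none]
      exact (hdo s).trans (skip_of_eq hs)
    · change Equiv.optionSubtypeNe b (insertAfter d.out s (some u)) = c.out u.1
      by_cases h : u = s
      · subst h
        rw [insertAfter_self]; exact hs.symm
      · rw [insertAfter_some _ h]
        refine (hdo u).trans (skip_of_ne fun h' => h (Subtype.ext ?_))
        exact (c.out.symm_apply_apply _).symm.trans (congrArg c.out.symm h')
  · rintro (_ | u)
    · exact hb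
    · exact (hcs u).symm
  · rintro (_ | u)
    · change c.lo b = c.lo (c.out.symm b)
      rw [← hc.lo_out (c.out.symm b), hs]
    · rfl

end Core

namespace Core

variable {p q : ℕ}

/-! ### Shrinking an incoming cycle to length one -/

section InsertTau

variable {c : Core p q} {a b : c.X}

theorem insert_tau_some {u : c.X} (h1 : u ≠ b) (h2 : c.out u ≠ a) :
    (c.insert a b).tau (some u) = some (c.tau u) := by
  change insertAfter c.inn a (insertAfter c.out b (some u)) = _
  rw [insertAfter_some _ h1, insertAfter_some _ h2]; rfl

theorem insert_tau_self : (c.insert a b).tau (some b) = some (c.inn a) := by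
  change insertAfter c.inn a (insertAfter c.out b (some b)) = _
  rw [insertAfter_self, insertAfter_none]

end InsertTau

/-- If an incoming cycle has more than one edge, then a new edge can be inserted into another
incoming cycle in such a way that a given edge `y` of the first cycle is no loop any more. -/
theorem IsOneVertex.exists_insert {c : Core p q} (hc : c.IsOneVertex) {a y : c.X}
    (hay : c.li a ≠ c.li y) (hy : c.inn y ≠ y) : ∃ b : c.X,
    ¬ (c.insert a b).tau.SameCycle (some y) ((c.insert a b).inn (some y)) := by
  classical
  have hex : ∃ n : ℕ, (c.tau ^ n) (c.inn a) = y ∨ (c.tau ^ n) (c.inn a) = c.inn y := by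
    obtain ⟨n, hn⟩ := exists_pow_eq_of_sameCycle (hc.tau_sameCycle (c.inn a) y)
    exact ⟨n, Or.inl hn⟩
  obtain ⟨n, hn, hmin⟩ : ∃ n : ℕ, ((c.tau ^ n) (c.inn a) = y ∨ (c.tau ^ n) (c.inn a) = c.inn y) ∧
      ∀ m, ((c.tau ^ m) (c.inn a) = y ∨ (c.tau ^ m) (c.inn a) = c.inn y) → n ≤ m :=
    ⟨Nat.find hex, Nat.find_spec hex, fun m hm => Nat.find_min' hex hm⟩
  -- The new edge closes up the part from `inn a` to the first end of `y` of the cycle of `tau`.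
  refine ⟨(c.tau ^ n) (c.inn a), fun hs => ?_⟩
  set b := (c.tau ^ n) (c.inn a) with hb
  have hya : y ≠ a := by rintro rfl; exact hay rfl
  have hW : ∀ z ∈ {z : Option c.X | ∃ i ≤ n, z = some ((c.tau ^ i) (c.inn a))},
      (c.insert a b).tau z ∈ {z : Option c.X | ∃ i ≤ n, z = some ((c.tau ^ i) (c.inn a))} := by
    rintro z ⟨i, hi, rfl⟩
    by_cases hib : (c.tau ^ i) (c.inn a) = b
    · rw [hib, insert_tau_self]
      exact ⟨0, Nat.zero_le _, rfl⟩
    · have hin : i < n := lt_of_le_of_ne hi fun E => hib (by rw [E])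
      have h1 : (c.tau ^ (i + 1)) (c.inn a) = c.tau ((c.tau ^ i) (c.inn a)) := by
        rw [pow_succ', Equiv.Perm.mul_apply]
      rw [insert_tau_some hib, ← h1]
      · exact ⟨i + 1, hin, rfl⟩
      · intro hout
        rw [tau_apply, hout] at h1
        have h2 : (c.tau ^ (n - (i + 1))) (c.inn a) = b := by
          conv_lhs => rw [← h1]
          rw [← Equiv.Perm.mul_apply, ← pow_add, Nat.sub_add_cancel hin]
        have := hmin (n - (i + 1)) (by rw [h2]; exact hn)
        omega
  have hbW : some b ∈ {z : Option c.X | ∃ i ≤ n, z = some ((c.tau ^ i) (c.inn a))} :=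
    ⟨n, le_rfl, rfl⟩
  have hiy : (c.insert a b).inn (some y) = some (c.inn y) := insertAfter_some _ hya
  rw [hiy] at hs
  have hyW : ∃ i ≤ n, (some y : Option c.X) = some ((c.tau ^ i) (c.inn a)) := by
    rcases hn with hn | hn
    · rw [← hn]; exact hbW
    · rw [← hn] at hs; exact mem_of_sameCycle hW hs.symm hbW
  have hyW' : ∃ i ≤ n, (some (c.inn y) : Option c.X) = some ((c.tau ^ i) (c.inn a)) := by
    rcases hn with hn | hn
    · rw [← hn] at hs ⊢; exact mem_of_sameCycle hW hs hbW
    · rw [← hn]; exact hbW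
  obtain ⟨i, hi, hi'⟩ := hyW
  obtain ⟨k, hk, hk'⟩ := hyW'
  have hi'' := Option.some.inj hi'
  have hk'' := Option.some.inj hk'
  have e1 := hmin i (Or.inl hi''.symm)
  have e2 := hmin k (Or.inr hk''.symm)
  obtain rfl : i = k := by omega
  exact hy (hk''.trans hi''.symm)

/-- The last incoming cycle can be shrunk to length one: as long as it is longer, insert an edge into
another incoming cycle and contract an edge of the last one instead. -/
theorem IsOneVertex.exists_fixed {c : Core (p + 1) q} [NeZero p] (hc : c.IsOneVertex) :
    ∃ c' : Core (p + 1) q, c'.IsOneVertex ∧ Related c c' ∧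
      ∃ b, c'.li b = Fin.last p ∧ c'.inn b = b := by
  induction hn : Set.ncard {x | c.li x = Fin.last p} using Nat.strong_induction_on generalizing c with
  | _ n ih =>
  by_cases hb : ∃ b, c.li b = Fin.last p ∧ c.inn b = b
  · exact ⟨c, hc, .refl _, hb⟩
  push Not at hb
  obtain ⟨y, hy⟩ := hc.li_surj (Fin.last p)
  obtain ⟨a, ha⟩ := hc.li_surj (Fin.castSucc 0)
  have hl : (Fin.castSucc 0 : Fin (p + 1)) ≠ Fin.last p := (Fin.castSucc_lt_last _).ne
  have hay : c.li a ≠ c.li y := by rwa [ha, hy]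
  have hya : y ≠ a := by rintro rfl; exact hay rfl
  obtain ⟨b, hb'⟩ := hc.exists_insert hay (hb y hy)
  obtain ⟨c', j', hc', hr, hd⟩ := hc.exists_related a b y hb'
    (fun E => Option.some_ne_none _ ((insertAfter_some c.inn hya).symm.trans E.1))
    (fun E => hl (by
      have := Option.some.inj ((insertAfter_none c.inn a).symm.trans E.1)
      rw [← ha, ← hy, ← this, hc.li_inn]))
  have hlt : Set.ncard {x | c'.li x = Fin.last p} < n := by
    rw [← Set.ncard_image_of_injective _ hd.inj, ← hn,
      ← Set.ncard_image_of_injective {x | c.li x = Fin.last p} (Option.some_injective _)]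
    refine Set.ncard_lt_ncard ⟨?_, fun hsub => ?_⟩ (Set.toFinite _)
    · rintro _ ⟨u, hu, rfl⟩
      have hu' : (c.insert a b).li (j' u) = Fin.last p := (hd.li u).symm.trans hu
      revert hu'
      generalize j' u = z
      cases z with
      | none => intro hu'; exact absurd (ha.symm.trans hu') hl
      | some v => intro hu'; exact ⟨v, hu', rfl⟩
    · obtain ⟨u, -, hu⟩ := hsub ⟨y, hy, rfl⟩
      exact hd.ne u hu
  obtain ⟨c'', h1, h2, h3⟩ := ih _ hlt hc' rfl
  exact ⟨c'', h1, hr.trans h2, h3⟩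

/-! ### Cores with one incoming and one outgoing cycle -/

/-- If the two cycles agree along the part `A` of the core, except at its last edge `t`, then this
part can be extended until it is the whole core. -/
theorem IsOneVertex.exists_inn_eq_out {c : Core 1 1} (hc : c.IsOneVertex) (A : Set c.X) (t : c.X)
    (ht : t ∈ A) (hA : ∀ a ∈ A, a ≠ t → c.inn a = c.out a ∧ c.inn a ∈ A) :
    ∃ c' : Core 1 1, c'.IsOneVertex ∧ Related c c' ∧ ∀ x, c'.inn x = c'.out x := by
  induction hn : Set.ncard Aᶜ using Nat.strong_induction_on generalizing c with
  | _ n ih =>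
  by_cases hu : ∀ x, x ∈ A
  · refine ⟨c, hc, .refl _, fun x => ?_⟩
    by_cases hx : x = t
    · subst hx
      have hs : c.out (c.out.symm (c.inn x)) = c.inn x := c.out.apply_symm_apply _
      by_cases h : c.out.symm (c.inn x) = x
      · rw [h] at hs; exact hs.symm
      · have := (hA _ (hu _) h).1
        exact absurd (c.inn.injective (this.trans hs)) h
    · exact (hA x (hu x) hx).1
  push Not at hu
  obtain ⟨x₀, hx₀⟩ := hu
  have he := hc.toIsLabelled.insert t t
  have hsp := hc.splits_insert t t
  have hin0 : (c.insert t t).inn none = some (c.inn t) := insertAfter_none _ _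
  have hint : (c.insert t t).inn (some t) = none := insertAfter_self _ _
  have hin : ∀ a, a ≠ t → (c.insert t t).inn (some a) = some (c.inn a) :=
    fun a h => insertAfter_some _ h
  have hout0 : (c.insert t t).out none = some (c.out t) := insertAfter_none _ _
  have houtt : (c.insert t t).out (some t) = none := insertAfter_self _ _
  have hout : ∀ a, a ≠ t → (c.insert t t).out (some a) = some (c.out a) :=
    fun a h => insertAfter_some _ h
  have hex : ∃ y ∉ A, ¬ (c.insert t t).tau.SameCycle (some y) ((c.insert t t).inn (some y)) := by
    by_contra hcon
    push Not at hcon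
    -- Both ends of the new edge would be the vertex at which the edges outside `A` lie.
    have hin' : (c.insert t t).tau.SameCycle (some x₀) ((c.insert t t).inn none) := by
      refine (mem_of_sameCycle (f := (c.insert t t).inn) (a := none) (b := some x₀)
        (W := {z | (∃ y ∉ A, z = some y) → (c.insert t t).tau.SameCycle z
          ((c.insert t t).inn none)}) ?_ ((he.li_iff _ _).1 (Subsingleton.elim _ _)) ?_) ⟨x₀, hx₀, rfl⟩
      · rintro (_ | a) hz hz'
        · exact .refl _ _
        · by_cases ha : a ∈ A
          · exfalso
            obtain ⟨y, hy, hy'⟩ := hz'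
            by_cases hat : a = t
            · rw [hat, hint] at hy'; exact Option.some_ne_none _ hy'.symm
            · rw [hin a hat] at hy'
              exact hy (Option.some.inj hy' ▸ (hA a ha hat).2)
          · exact (hcon a ha).symm.trans (hz ⟨a, ha, rfl⟩)
      · rintro ⟨y, -, hy⟩; exact absurd hy.symm (Option.some_ne_none _)
    have hout' : (c.insert t t).tau.SameCycle (some x₀) none := by
      refine (mem_of_sameCycle (f := (c.insert t t).out) (a := none) (b := some x₀)
        (W := {z | (∃ y ∉ A, z = some y) → (c.insert t t).tau.SameCycle z none}) ?_
        ((he.lo_iff _ _).1 (Subsingleton.elim _ _)) ?_) ⟨x₀, hx₀, rfl⟩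
      · intro z hz hz'
        obtain ⟨y, hy, hy'⟩ := hz'
        have key : (c.insert t t).tau.SameCycle ((c.insert t t).out z) z := by
          have h1 := hcon y hy
          rw [← hy'] at h1
          exact h1.trans (Equiv.Perm.SameCycle.symm ⟨1, by rw [zpow_one]; rfl⟩)
        cases z with
        | none => exact key
        | some a =>
          refine key.trans (hz ?_)
          by_contra ha
          have ha' : a ∈ A := by
            by_contra h; exact ha ⟨a, h, rfl⟩
          by_cases hat : a = t
          · rw [hat, houtt] at hy'; exact Option.some_ne_none _ hy'.symm
          · rw [hout a hat] at hy'
            have := hA a ha' hat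
            rw [this.1] at this
            exact hy (Option.some.inj hy' ▸ this.2)
      · rintro ⟨y, -, hy⟩; exact absurd hy.symm (Option.some_ne_none _)
    exact hsp.not_loop (hout'.symm.trans hin')
  obtain ⟨y, hy, hyl⟩ := hex
  have hyt : y ≠ t := by rintro rfl; exact hy ht
  obtain ⟨c', j', hc', hr, hd⟩ := hc.exists_related t t y hyl
    (fun E => Option.some_ne_none _ ((hin y hyt).symm.trans E.1))
    (fun E => Option.some_ne_none _ ((hout y hyt).symm.trans E.2))
  obtain ⟨t', ht'⟩ := hd.range none (Option.some_ne_none y).symm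
  have hlt : Set.ncard {u | ¬ ∀ x, j' u = some x → x ∈ A} < n := by
    rw [← Set.ncard_image_of_injective _ hd.inj, ← hn,
      ← Set.ncard_image_of_injective _ (Option.some_injective c.X)]
    refine Set.ncard_lt_ncard ⟨?_, fun hsub => ?_⟩ (Set.toFinite _)
    · rintro _ ⟨u, hu, rfl⟩
      have hu' : ∃ x, j' u = some x ∧ x ∉ A := by
        by_contra h
        push Not at h
        exact hu h
      obtain ⟨x, hx, hxA⟩ := hu'
      exact ⟨x, hxA, hx.symm⟩
    · obtain ⟨u, -, hu⟩ := hsub ⟨y, hy, rfl⟩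
      exact hd.ne u hu
  have hA' : ∀ u ∈ {u | ∀ x, j' u = some x → x ∈ A}, u ≠ t' →
      c'.inn u = c'.out u ∧ c'.inn u ∈ {u | ∀ x, j' u = some x → x ∈ A} := by
    intro u hu hut
    obtain ⟨a, ha⟩ : ∃ a, j' u = some a := by
      cases h : j' u with
      | none => exact absurd (hd.inj (h.trans ht'.symm)) hut
      | some a => exact ⟨a, rfl⟩
    have haA := hu a ha
    by_cases hat : a = t
    · have e1 : j' (c'.inn u) = j' t' := by
        rw [hd.inn, ha, hat, skip_of_ne (by rw [hint]; exact (Option.some_ne_none _).symm), hint, ht']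
      have e2 : j' (c'.out u) = j' t' := by
        rw [hd.out, ha, hat, skip_of_ne (by rw [houtt]; exact (Option.some_ne_none _).symm), houtt,
          ht']
      refine ⟨hd.inj (e1.trans e2.symm), fun x hx => ?_⟩
      rw [e1, ht'] at hx
      exact absurd hx.symm (Option.some_ne_none x)
    · obtain ⟨h4, h5⟩ := hA a haA hat
      have h6 : (some (c.inn a) : Option c.X) ≠ some y := fun E => hy (Option.some.inj E ▸ h5)
      have e1 : j' (c'.inn u) = some (c.inn a) := by
        rw [hd.inn, ha, skip_of_ne (by rw [hin a hat]; exact h6), hin a hat]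
      have e2 : j' (c'.out u) = some (c.inn a) := by
        rw [hd.out, ha, skip_of_ne (by rw [hout a hat, ← h4]; exact h6), hout a hat, h4]
      refine ⟨hd.inj (e1.trans e2.symm), fun x hx => ?_⟩
      rw [e1] at hx
      exact Option.some.inj hx ▸ h5
  obtain ⟨c'', h1, h2, h3⟩ := ih _ hlt hc' {u | ∀ x, j' u = some x → x ∈ A} t'
    (fun x hx => absurd (ht'.symm.trans hx) (Option.some_ne_none x).symm) hA' rfl
  exact ⟨c'', h1, hr.trans h2, h3⟩

/-- Two transitive permutations of sets of the same size are conjugate. -/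
theorem exists_equiv_of_transitive {X X' : Type} [Finite X] [Finite X'] [Nonempty X]
    {f : Equiv.Perm X} {f' : Equiv.Perm X'} (hf : ∀ x y, f.SameCycle x y)
    (hf' : ∀ x y, f'.SameCycle x y) (hcard : Nat.card X = Nat.card X') :
    ∃ F : X ≃ X', ∀ x, F (f x) = f' (F x) := by
  classical
  have := Fintype.ofFinite X
  have := Fintype.ofFinite X'
  have hc : f.IsCycleOn ((Finset.univ : Finset X) : Set X) :=
    ⟨by simp, fun x _ y _ => hf x y⟩
  have hc' : f'.IsCycleOn ((Finset.univ : Finset X') : Set X') :=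
    ⟨by simp, fun x _ y _ => hf' x y⟩
  have hcard' : (Finset.univ : Finset X).card = (Finset.univ : Finset X').card := by
    rw [Finset.card_univ, Finset.card_univ, ← Nat.card_eq_fintype_card, hcard,
      Nat.card_eq_fintype_card]
  obtain ⟨x₀⟩ := ‹Nonempty X›
  have : Nonempty X' := (Nat.card_pos_iff.1 (hcard ▸ Nat.card_pos_iff.2 ⟨⟨x₀⟩, inferInstance⟩)).1
  obtain ⟨x₁⟩ := this
  choose n hn using fun x => exists_pow_eq_of_sameCycle (hf x₀ x)
  have key : ∀ k l : ℕ, (f ^ k) x₀ = (f ^ l) x₀ ↔ (f' ^ k) x₁ = (f' ^ l) x₁ := fun k l => by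
    rw [hc.pow_apply_eq_pow_apply (Finset.mem_univ _), hc'.pow_apply_eq_pow_apply
      (Finset.mem_univ _), hcard']
  have hinj : Function.Injective fun x => (f' ^ n x) x₁ := fun x y h => by
    rw [← hn x, ← hn y]; exact (key _ _).2 h
  refine ⟨Equiv.ofBijective _ ((Fintype.bijective_iff_injective_and_card _).2
    ⟨hinj, by simpa using hcard'⟩), fun x => ?_⟩
  change (f' ^ n (f x)) x₁ = f' ((f' ^ n x) x₁)
  rw [← Equiv.Perm.mul_apply, ← pow_succ', ← key, hn, pow_succ', Equiv.Perm.mul_apply, hn]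

theorem related_of_card_eq_one {c c' : Core 1 1} (hc : c.IsOneVertex) (hc' : c'.IsOneVertex)
    (hcard : Nat.card c.X = Nat.card c'.X) : Related c c' := by
  obtain ⟨t⟩ := hc.nonempty
  obtain ⟨t'⟩ := hc'.nonempty
  obtain ⟨d, hd, hr, h⟩ := hc.exists_inn_eq_out {t} t rfl fun a ha hat => absurd ha hat
  obtain ⟨d', hd', hr', h'⟩ := hc'.exists_inn_eq_out {t'} t' rfl fun a ha hat => absurd ha hat
  have := hd.nonempty
  obtain ⟨F, hF⟩ := exists_equiv_of_transitive (f := d.inn) (f' := d'.inn)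
    (fun x y => (hd.li_iff x y).1 (Subsingleton.elim _ _))
    (fun x y => (hd'.li_iff x y).1 (Subsingleton.elim _ _))
    (hr.card_eq.symm.trans (hcard.trans hr'.card_eq))
  have : Related d d' := Iso.related
    ⟨F, hF, fun x => by rw [← h, ← h', hF], fun x => Subsingleton.elim _ _,
      fun x => Subsingleton.elim _ _⟩ hd
  exact hr.trans (this.trans hr'.symm)

/-! ### One-vertex cores of equal size are related -/

theorem related_of_card_eq_succ [NeZero p]
    (ih : ∀ d d' : Core p q, d.IsOneVertex → d'.IsOneVertex → Nat.card d.X = Nat.card d'.X →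
      Related d d') {c c' : Core (p + 1) q} (hc : c.IsOneVertex) (hc' : c'.IsOneVertex)
    (hcard : Nat.card c.X = Nat.card c'.X) : Related c c' := by
  obtain ⟨c₁, h1, r1, b, hb, hbb⟩ := hc.exists_fixed
  obtain ⟨c₁', h1', r1', b', hb', hbb'⟩ := hc'.exists_fixed
  obtain ⟨d, s, hd, ⟨f⟩⟩ := h1.exists_iso_addLoop hb hbb
  obtain ⟨d', s', hd', ⟨f'⟩⟩ := h1'.exists_iso_addLoop hb' hbb'
  have e1 := Nat.card_congr f.toEquiv
  have e2 := Nat.card_congr f'.toEquiv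
  rw [Finite.card_option] at e1 e2
  have hdd : Related d d' := ih d d' hd hd' (by
    have := r1.card_eq; have := r1'.card_eq; omega)
  exact r1.trans ((f.related h1).trans ((hdd.addLoop hd s s').trans
    ((f'.related h1').symm.trans r1'.symm)))

theorem related_of_card_eq : ∀ (p q : ℕ) (c c' : Core (p + 1) (q + 1)), c.IsOneVertex →
    c'.IsOneVertex → Nat.card c.X = Nat.card c'.X → Related c c'
  | 0, 0, _, _, hc, hc', h => related_of_card_eq_one hc hc' h
  | 0, q + 1, c, c', hc, hc', h => by
    have : Related c.swap c'.swap := related_of_card_eq_succ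
      (fun d d' hd hd' h => (related_of_card_eq 0 q d.swap d'.swap hd.swap hd'.swap h).swap)
      hc.swap hc'.swap h
    exact this.swap
  | p + 1, q, _, _, hc, hc', h => related_of_card_eq_succ (related_of_card_eq p q) hc hc' h

theorem exists_isOneVertex (g : ℕ) : ∀ p q : ℕ, ∃ c : Core (p + 1) (q + 1), c.IsOneVertex ∧
    Nat.card c.X = 2 * g + p + q + 1
  | 0, 0 => by
    let f : Equiv.Perm (ZMod (2 * g + 1)) := Equiv.addRight 1
    have hf : ∀ (n : ℕ) (x : ZMod (2 * g + 1)), (f ^ n) x = x + n := fun n => by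
      induction n with
      | zero => simp
      | succ n ih =>
        intro x
        rw [pow_succ', Equiv.Perm.mul_apply, ih]
        simp [f, add_assoc]
    have hsc : ∀ x y, f.SameCycle x y := fun x y => ⟨((y - x).val : ℕ), by
      rw [zpow_natCast, hf, ZMod.natCast_zmod_val]; ring⟩
    refine ⟨⟨ZMod (2 * g + 1), f, f, fun _ => 0, fun _ => 0⟩, ⟨⟨fun x y => ⟨fun _ => hsc x y,
      fun _ => rfl⟩, fun x y => ⟨fun _ => hsc x y, fun _ => rfl⟩,
      fun i => ⟨0, (Fin.fin_one_eq_zero i).symm⟩, fun i => ⟨0, (Fin.fin_one_eq_zero i).symm⟩⟩, fun x y => ?_⟩,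
      by simp⟩
    -- `f = (f ^ 2) ^ (g + 1)`, since `2 (g + 1) = 1` modulo `2 g + 1`.
    have h1 : f = (f * f) ^ (g + 1) := by
      ext x
      rw [← pow_two, ← pow_mul, hf]
      have : ((2 * (g + 1) : ℕ) : ZMod (2 * g + 1)) = 1 := by
        have := ZMod.natCast_self (2 * g + 1)
        push_cast at this ⊢
        linear_combination this
      rw [this]; rfl
    obtain ⟨n, hn⟩ := hsc x y
    refine ⟨(g + 1 : ℕ) * n, ?_⟩
    change ((f * f) ^ _) x = y
    rw [zpow_mul, zpow_natCast, ← h1, hn]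
  | 0, q + 1 => by
    obtain ⟨c, hc, h⟩ := exists_isOneVertex g 0 q
    obtain ⟨s⟩ := hc.nonempty
    refine ⟨(c.swap.addLoop s).swap, (hc.swap.addLoop s).swap, ?_⟩
    change Nat.card (Option c.X) = _
    rw [Finite.card_option, h]; ring
  | p + 1, q => by
    obtain ⟨c, hc, h⟩ := exists_isOneVertex g p q
    obtain ⟨s⟩ := hc.nonempty
    refine ⟨c.addLoop s, hc.addLoop s, ?_⟩
    change Nat.card (Option c.X) = _
    rw [Finite.card_option, h]; ring

end Core

theorem Next.map {α β : Type} {f : Equiv.Perm α} {f' : Equiv.Perm β} {L : Set α} {L' : Set β}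
    (e : α → β) (he : ∀ a, e (f a) = f' (e a)) (hL : ∀ a, e a ∈ L' ↔ a ∈ L) {a b : α}
    (h : Next f L a b) : Next f' L' (e a) (e b) := by
  induction h with
  | here h hb => exact .here (by rw [← he, h]) ((hL _).2 hb)
  | skip hn _ ih =>
    refine .skip ?_ ?_
    · rwa [← he, hL]
    · rwa [← he]

namespace RibbonGraph

variable {p q : ℕ} {G G' : RibbonGraph (Fin p ⊕ Fin q)} {g : ℕ} {c c' : Core p q}

/-! ### The core of a diagram -/

/-- The core of `G` is `c`: the incoming oriented edges of `G` are indexed by `c.X`, and collapsing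
the ghost edges gives the boundary cycles of `c`. -/
structure HasCore (G : RibbonGraph (Fin p ⊕ Fin q)) (c : Core p q) (i : c.X → G.Dart) : Prop where
  inj : Function.Injective i
  isIncoming_iff : ∀ h, G.IsIncoming h ↔ ∃ x, i x = h
  bdry : ∀ x, G.bdry (i x) = i (c.inn x)
  next : ∀ x, Next G.bdry G.ghostᶜ (G.rev (i x)) (G.rev (i (c.out x)))
  label : ∀ x, G.label (i x) = Sum.inl (c.li x)
  label_rev : ∀ x, G.label (G.rev (i x)) = Sum.inr (c.lo x)

theorem not_isIncoming {h : G.Dart} {j : Fin q} (hh : G.label h = Sum.inr j) : ¬ G.IsIncoming h := by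
  rintro ⟨i, hi⟩
  rw [hh] at hi
  cases hi

theorem exists_label_eq {h : G.Dart} (hh : ¬ G.IsIncoming h) : ∃ j, G.label h = Sum.inr j := by
  rcases hl : G.label h with i | j
  · exact absurd ⟨i, hl⟩ hh
  · exact ⟨j, rfl⟩

namespace HasCore

variable {i : c.X → G.Dart}

theorem isIncoming (H : HasCore G c i) (x : c.X) : G.IsIncoming (i x) :=
  (H.isIncoming_iff _).2 ⟨x, rfl⟩

theorem not_isIncoming_rev (H : HasCore G c i) (x : c.X) : ¬ G.IsIncoming (G.rev (i x)) :=
  not_isIncoming (H.label_rev x)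

theorem not_mem_ghost (H : HasCore G c i) (x : c.X) : i x ∉ G.ghost := fun h => h.1 (H.isIncoming x)

theorem rev_not_mem_ghost (H : HasCore G c i) (x : c.X) : G.rev (i x) ∉ G.ghost := fun h =>
  H.not_mem_ghost x (rev_mem_ghost_iff.1 h)

theorem ne_of_mem_ghost (H : HasCore G c i) {y : G.Dart} (hy : y ∈ G.ghost) (x : c.X) :
    i x ≠ y ∧ i x ≠ G.rev y :=
  ⟨fun e => H.not_mem_ghost x (e ▸ hy), fun e => H.not_mem_ghost x (e ▸ rev_mem_ghost hy)⟩

theorem mem_ghost_iff (H : HasCore G c i) (h : G.Dart) :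
    h ∈ G.ghost ↔ ∀ x, i x ≠ h ∧ i x ≠ G.rev h := by
  change (¬ _ ∧ ¬ _) ↔ _
  rw [H.isIncoming_iff, H.isIncoming_iff]
  push Not
  rw [forall_and]

theorem rot_rev (H : HasCore G c i) (x : c.X) : G.rot (G.rev (i x)) = i (c.inn x) := H.bdry x

theorem sameCycle_inn_iff (H : HasCore G c i) {x y : c.X} :
    G.bdry.SameCycle (i x) (i y) ↔ c.inn.SameCycle x y := by
  constructor
  · intro h
    obtain ⟨z, hz, hz'⟩ := mem_of_sameCycle (W := {h | ∃ z, i z = h ∧ c.inn.SameCycle x z})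
      (by
        rintro _ ⟨z, rfl, hz⟩
        exact ⟨c.inn z, (H.bdry z).symm, Equiv.Perm.sameCycle_apply_right.2 hz⟩) h
      ⟨x, rfl, .refl _ _⟩
    rwa [← H.inj hz]
  · intro h
    exact mem_of_sameCycle (W := {z | G.bdry.SameCycle (i x) (i z)})
      (fun z hz => by
        change G.bdry.SameCycle _ _
        rw [← H.bdry]; exact Equiv.Perm.sameCycle_apply_right.2 hz) h (.refl _ _)

theorem sameCycle_out_iff (H : HasCore G c i) {x y : c.X} :
    G.bdry.SameCycle (G.rev (i x)) (G.rev (i y)) ↔ c.out.SameCycle x y := by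
  constructor
  · intro h
    obtain ⟨z, hz, hz'⟩ := mem_of_sameCycle (W := {h | ∃ z, c.out.SameCycle x z ∧
        (h = G.rev (i z) ∨ Next G.bdry G.ghostᶜ h (G.rev (i z)))})
      (by
        have key : ∀ h z, c.out.SameCycle x z → Next G.bdry G.ghostᶜ h (G.rev (i z)) →
            ∃ z, c.out.SameCycle x z ∧
              (G.bdry h = G.rev (i z) ∨ Next G.bdry G.ghostᶜ (G.bdry h) (G.rev (i z))) := by
          intro h z hz hn
          refine ⟨z, hz, ?_⟩
          cases hn with
          | here e _ => exact Or.inl e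
          | skip _ hn => exact Or.inr hn
        rintro h ⟨z, hz, rfl | hn⟩
        · exact key _ _ (Equiv.Perm.sameCycle_apply_right.2 hz) (H.next z)
        · exact key _ _ hz hn) h ⟨x, .refl _ _, Or.inl rfl⟩
    rcases hz' with e | hn
    · rwa [H.inj (G.rev_injective e)]
    · have := H.inj (G.rev_injective (hn.unique (H.next y)))
      rw [this] at hz
      exact Equiv.Perm.sameCycle_apply_right.1 hz
  · intro h
    exact mem_of_sameCycle (W := {z | G.bdry.SameCycle (G.rev (i x)) (G.rev (i z))})
      (fun z hz => hz.trans (H.next z).sameCycle) h (.refl _ _)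

theorem isLabelled (H : HasCore G c i) (hG : G.IsWeakDiagram g) : c.IsLabelled where
  li_iff x y := by
    rw [← H.sameCycle_inn_iff, ← hG.label_eq_iff, H.label, H.label, Sum.inl_injective.eq_iff]
  lo_iff x y := by
    rw [← H.sameCycle_out_iff, ← hG.label_eq_iff, H.label_rev, H.label_rev,
      Sum.inr_injective.eq_iff]
  li_surj j := by
    obtain ⟨h, hh⟩ := hG.label_surjective (Sum.inl j)
    obtain ⟨x, rfl⟩ := (H.isIncoming_iff h).1 ⟨j, hh⟩
    exact ⟨x, Sum.inl_injective ((H.label x).symm.trans hh)⟩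
  lo_surj j := by
    obtain ⟨h, hh, hg⟩ := hG.exists_circular (Sum.inr j)
    have h1 : G.IsIncoming (G.rev h) := by
      by_contra h2
      exact hg ⟨not_isIncoming hh, h2⟩
    obtain ⟨x, hx⟩ := (H.isIncoming_iff _).1 h1
    refine ⟨x, Sum.inr_injective ((H.label_rev x).symm.trans ?_)⟩
    rw [hx, G.rev_rev, hh]

theorem of_iso (H : HasCore G c i) (e : G.Iso G') : HasCore G' c fun x => e.toEquiv (i x) where
  inj := e.toEquiv.injective.comp H.inj
  isIncoming_iff h := by
    obtain ⟨h, rfl⟩ := e.toEquiv.surjective h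
    rw [e.isIncoming_iff, H.isIncoming_iff]
    simp only [e.toEquiv.injective.eq_iff]
  bdry x := by rw [← e.map_bdry, H.bdry]
  next x := by
    rw [← e.map_rev, ← e.map_rev]
    exact (H.next x).map e.toEquiv e.map_bdry fun h => not_congr (e.mem_ghost_iff h)
  label x := by rw [e.map_label, H.label]
  label_rev x := by rw [← e.map_rev, e.map_label, H.label_rev]

theorem comp_iso {i : c'.X → G.Dart} (H : HasCore G c' i) (f : c.Iso c') :
    HasCore G c fun x => i (f.toEquiv x) where
  inj := H.inj.comp f.toEquiv.injective
  isIncoming_iff h := by rw [H.isIncoming_iff, ← f.toEquiv.exists_congr_left.symm]; simp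
  bdry x := by rw [f.inn, H.bdry]
  next x := by rw [f.out]; exact H.next _
  label x := by rw [H.label, f.li]
  label_rev x := by rw [H.label_rev, f.lo]

/-- Contracting a ghost edge does not change the core. -/
theorem contract_iff {y : G.Dart} (hy : y ∈ G.ghost)
    (hlab : ∀ h, G.label (G.bdry h) = G.label h) {i : c.X → (G.contract y).Dart} :
    HasCore (G.contract y) c i ↔ HasCore G c fun x => under (i x) := by
  have hsub : G.ghostᶜ ⊆ G.kept {y, G.rev y} := fun h hh => (mem_kept_pair G).2
    ⟨fun e => hh (e ▸ hy), fun e => hh (e ▸ rev_mem_ghost hy)⟩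
  constructor
  · intro H
    refine ⟨under_injective.comp H.inj, fun h => ⟨fun hh => ?_, ?_⟩, fun x => ?_, fun x => ?_,
      H.label, H.label_rev⟩
    · obtain ⟨x, hx⟩ := (H.isIncoming_iff (keep h ((mem_kept_pair G).1 (hsub fun E => E.1 hh)))).1 hh
      exact ⟨x, congrArg under hx⟩
    · rintro ⟨x, rfl⟩; exact H.isIncoming x
    · have h1 := bdry_contract_eq_iff.1 (H.bdry x)
      have h2 : G.bdry (under (i x)) ∈ G.kept {y, G.rev y} := by
        refine hsub fun E => E.1 ⟨c.li x, ?_⟩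
        rw [hlab]; exact H.label x
      exact (Next.here rfl h2).unique h1
    · exact (next_contract_iff hsub).1 (H.next x)
  · intro H
    refine ⟨fun x y e => H.inj (congrArg under e), fun h => ?_, fun x => ?_, fun x => ?_,
      H.label, H.label_rev⟩
    · rw [isIncoming_contract, H.isIncoming_iff]
      simp only [under_injective.eq_iff]
    · exact bdry_contract_eq_iff.2 (.here (H.bdry x) (hsub (H.not_mem_ghost _)))
    · exact (next_contract_iff hsub).2 (H.next x)

theorem contract {y : G.Dart} (H : HasCore G c i) (hy : y ∈ G.ghost)
    (hlab : ∀ h, G.label (G.bdry h) = G.label h) :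
    HasCore (G.contract y) c fun x => keep (i x) (H.ne_of_mem_ghost hy x) :=
  (contract_iff hy hlab).2 H

/-- Contracting a circular edge of a diagram deletes this edge from the core. -/
theorem contract_del (H : HasCore G c i) {y : c.X} {j : c'.X → c.X} (hd : Core.Del c y c' j)
    (hy : c.inn y ≠ y) (hy' : c.out y ≠ y) : ∃ i', HasCore (G.contract (i y)) c' i' := by
  have hne : ∀ x, x ≠ y → i x ≠ i y ∧ i x ≠ G.rev (i y) := fun x hx =>
    ⟨fun e => hx (H.inj e), fun e => H.not_isIncoming_rev y (e ▸ H.isIncoming x)⟩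
  have hk : ∀ x, x ≠ y → i x ∈ G.kept {i y, G.rev (i y)} := fun x hx =>
    (mem_kept_pair G).2 (hne x hx)
  refine ⟨fun u => keep (i (j u)) (hne _ (hd.ne u)), fun u v e => hd.inj (H.inj (congrArg under e)),
    fun h => ⟨fun hh => ?_, ?_⟩, fun u => ?_, fun u => ?_, fun u => ?_, fun u => ?_⟩
  · obtain ⟨x, hx⟩ := (H.isIncoming_iff _).1 (isIncoming_contract.1 hh)
    obtain ⟨u, rfl⟩ := hd.range x (by rintro rfl; exact (under_ne h).1 hx.symm)
    exact ⟨u, under_injective hx⟩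
  · rintro ⟨u, rfl⟩; exact isIncoming_contract.2 (H.isIncoming _)
  · refine bdry_contract_eq_iff.2 ?_
    rw [under_keep, under_keep, hd.inn]
    by_cases h : c.inn (j u) = y
    · rw [skip_of_eq h]
      refine .skip ?_ (.here ?_ (hk _ hy))
      · rw [H.bdry, h, mem_kept_pair]; exact fun E => E.1 rfl
      · rw [H.bdry, h, H.bdry]
    · rw [skip_of_ne h]
      exact .here (H.bdry _) (hk _ h)
  · let L : Set G.Dart := {h | h ∉ G.ghost ∧ h ∈ G.kept {i y, G.rev (i y)}}
    have hL : L ⊆ G.kept {i y, G.rev (i y)} := fun h hh => hh.2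
    have e1 : ((G.contract (i y)).ghost)ᶜ = {l | under l ∈ L} := by
      ext l
      exact ⟨fun hl => ⟨hl, (mem_kept_pair G).2 (under_ne l)⟩, fun hl => hl.1⟩
    have hkr : ∀ x, x ≠ y → G.rev (i x) ∈ L := fun x hx =>
      ⟨H.rev_not_mem_ghost x, G.rev_mem_kept (hk x hx)⟩
    rw [e1]
    refine (next_contract_iff hL).2 ?_
    rw [under_rev, under_rev, under_keep, under_keep, hd.out]
    have hsub : L ⊆ G.ghostᶜ := fun h hh => hh.1
    by_cases h : c.out (j u) = y
    · rw [skip_of_eq h]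
      have h1 := H.next (j u)
      rw [h] at h1
      exact h1.trans hsub (fun E => ((mem_kept_pair G).1 E.2).2 rfl)
        ((H.next y).mono hsub (hkr _ hy'))
    · rw [skip_of_ne h]
      exact (H.next _).mono hsub (hkr _ h)
  · rw [label_contract, under_keep, H.label, hd.li]
  · rw [label_contract, under_rev, under_keep, H.label_rev, hd.lo]

end HasCore

theorem IsWeakDiagram.not_isIncoming_rev (H : G.IsWeakDiagram g) {h : G.Dart} (hh : G.IsIncoming h) :
    ¬ G.IsIncoming (G.rev h) := by
  rintro ⟨j, hj⟩
  -- Otherwise the circles containing `h` and `rev h` would meet at the initial vertex of `h`.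
  have h1 : G.label (G.rot h) = Sum.inl j := by rw [rot_eq, H.label_bdry, hj]
  exact H.rot_ne h (H.circles h _ hh ⟨j, h1⟩
    (Equiv.Perm.sameCycle_apply_right.2 (.refl _ _))).symm

theorem IsWeakDiagram.exists_hasCore (H : G.IsWeakDiagram g) :
    ∃ (c : Core p q) (i : c.X → G.Dart), HasCore G c i := by
  have hin : ∀ h, G.IsIncoming h ↔ G.IsIncoming (G.bdry h) := fun h => by
    unfold IsIncoming; rw [H.label_bdry]
  let R : Set G.Dart := {h | G.IsIncoming (G.rev h)}
  let e : {h // G.IsIncoming h} ≃ R :=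
    { toFun := fun h => ⟨G.rev h, by change G.IsIncoming _; rw [G.rev_rev]; exact h.2⟩
      invFun := fun h => ⟨G.rev h, h.2⟩
      left_inv := fun h => Subtype.ext (G.rev_rev _)
      right_inv := fun h => Subtype.ext (G.rev_rev _) }
  choose li hli using fun h : {h // G.IsIncoming h} => h.2
  choose lo hlo using fun h : {h // G.IsIncoming h} => exists_label_eq (H.not_isIncoming_rev h.2)
  let c : Core p q :=
    { X := {h // G.IsIncoming h}
      inn := G.bdry.subtypePerm fun h => (hin h).symm
      out := (e.trans (firstReturn G.bdry R)).trans e.symm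
      li := li
      lo := lo }
  refine ⟨c, Subtype.val, Subtype.val_injective, fun h => ⟨fun hh => ⟨⟨h, hh⟩, rfl⟩, ?_⟩,
    fun x => rfl, fun x => ?_, hli, hlo⟩
  · rintro ⟨x, rfl⟩; exact x.2
  · have h1 : Next G.bdry R (G.rev x.1) (G.rev (c.out x).1) := by
      have := next_firstReturn G.bdry R (e x)
      rwa [show G.rev (c.out x).1 = (firstReturn G.bdry R (e x)).1 from G.rev_rev _]
    have hsub : R ⊆ G.ghostᶜ := fun h hh E => E.2 hh
    obtain ⟨k, hk⟩ := exists_next (.refl G.bdry (G.rev x.1)) (hsub (e x).2)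
    have hkR : k ∈ R := by
      by_contra hk'
      refine hk.mem ⟨fun ⟨j, hj⟩ => H.not_isIncoming_rev x.2 ⟨j, ?_⟩, hk'⟩
      rw [(H.label_eq_iff _ _).2 hk.sameCycle, hj]
    rwa [← (hk.mono hsub hkR).unique h1]

end RibbonGraph

theorem Contracts.linked {p q g : ℕ} {G G' : RibbonGraph (Fin p ⊕ Fin q)} (h : Contracts g G G') :
    Linked g G G' := Relation.EqvGen.rel _ _ h

namespace RibbonGraph

/-! ### Expanding an edge -/

section Expand

variable {ι : Type} (G : RibbonGraph ι) (a b : G.Dart)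

open Classical in
/-- The boundary permutation of `expand`. -/
noncomputable def expandBdry : Equiv.Perm (G.Dart ⊕ Bool) :=
  Equiv.sumCongr G.bdry (Equiv.refl Bool) * Equiv.swap (Sum.inl a) (Sum.inr true) *
    Equiv.swap (Sum.inl b) (Sum.inr false)

/-- The graph with a new edge, whose two orientations are inserted into the boundary cycles after
`a` and `b`. If `a` and `b` end at the same vertex, then this vertex is split into two, and the new
edge joins them. -/
noncomputable abbrev expand : RibbonGraph ι where
  Dart := G.Dart ⊕ Bool
  rev := Equiv.sumCongr G.rev Equiv.boolNot
  rot := G.expandBdry a b * Equiv.sumCongr G.rev Equiv.boolNot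
  rev_rev := by
    rintro (h | h)
    · exact congrArg Sum.inl (G.rev_rev h)
    · exact congrArg Sum.inr (Bool.not_not h)
  rev_ne := by
    rintro (h | h) e
    · exact G.rev_ne h (Sum.inl_injective e)
    · exact Bool.not_ne_self h (Sum.inr_injective e)
  label := Sum.elim G.label fun s => if s then G.label a else G.label b

variable {G a b}

theorem expandBdry_of_ne {h : G.Dart} (h1 : h ≠ a) (h2 : h ≠ b) :
    G.expandBdry a b (Sum.inl h) = Sum.inl (G.bdry h) := by
  classical
  unfold expandBdry
  rw [Equiv.Perm.mul_apply, Equiv.swap_apply_of_ne_of_ne (fun e => h2 (Sum.inl_injective e))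
    Sum.inl_ne_inr, Equiv.Perm.mul_apply, Equiv.swap_apply_of_ne_of_ne
    (fun e => h1 (Sum.inl_injective e)) Sum.inl_ne_inr]
  rfl

theorem expandBdry_left (hab : a ≠ b) : G.expandBdry a b (Sum.inl a) = Sum.inr true := by
  classical
  unfold expandBdry
  rw [Equiv.Perm.mul_apply, Equiv.swap_apply_of_ne_of_ne (fun e => hab (Sum.inl_injective e))
    Sum.inl_ne_inr, Equiv.Perm.mul_apply, Equiv.swap_apply_left]
  rfl

theorem expandBdry_right : G.expandBdry a b (Sum.inl b) = Sum.inr false := by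
  classical
  unfold expandBdry
  rw [Equiv.Perm.mul_apply, Equiv.swap_apply_left, Equiv.Perm.mul_apply,
    Equiv.swap_apply_of_ne_of_ne Sum.inr_ne_inl (by simp)]
  rfl

theorem expandBdry_true : G.expandBdry a b (Sum.inr true) = Sum.inl (G.bdry a) := by
  classical
  unfold expandBdry
  rw [Equiv.Perm.mul_apply, Equiv.swap_apply_of_ne_of_ne Sum.inr_ne_inl (by simp),
    Equiv.Perm.mul_apply, Equiv.swap_apply_right]
  rfl

theorem expandBdry_false (hab : a ≠ b) :
    G.expandBdry a b (Sum.inr false) = Sum.inl (G.bdry b) := by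
  classical
  unfold expandBdry
  rw [Equiv.Perm.mul_apply, Equiv.swap_apply_right, Equiv.Perm.mul_apply,
    Equiv.swap_apply_of_ne_of_ne (fun e => hab (Sum.inl_injective e).symm) Sum.inl_ne_inr]
  rfl

theorem bdry_expand : (G.expand a b).bdry = G.expandBdry a b :=
  Equiv.ext fun h => congrArg (G.expandBdry a b) ((G.expand a b).rev_rev h)

theorem inl_ne_expand (h : G.Dart) : (Sum.inl h : (G.expand a b).Dart) ≠ Sum.inr true ∧
    (Sum.inl h : (G.expand a b).Dart) ≠ (G.expand a b).rev (Sum.inr true) :=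
  ⟨Sum.inl_ne_inr, Sum.inl_ne_inr⟩

theorem label_bdry_expand (hab : a ≠ b) (hlab : ∀ h, G.label (G.bdry h) = G.label h)
    (h : (G.expand a b).Dart) :
    (G.expand a b).label ((G.expand a b).bdry h) = (G.expand a b).label h := by
  rw [bdry_expand]
  rcases h with h | (_ | _)
  · by_cases h1 : h = a
    · subst h1; rw [expandBdry_left hab]; rfl
    · by_cases h2 : h = b
      · subst h2; rw [expandBdry_right]; rfl
      · rw [expandBdry_of_ne h1 h2]; exact hlab h
  · rw [expandBdry_false hab]; exact hlab b
  · rw [expandBdry_true]; exact hlab a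

/-- Contracting the new edge gives back the graph. -/
noncomputable def contractExpandIso (hab : a ≠ b) :
    G.Iso ((G.expand a b).contract (Sum.inr true)) := by
  have hk : ∀ h : G.Dart, (Sum.inl h : (G.expand a b).Dart) ∈
      (G.expand a b).kept {Sum.inr true, (G.expand a b).rev (Sum.inr true)} :=
    fun h => (mem_kept_pair _).2 (inl_ne_expand h)
  have hb : ∀ h : G.Dart, ((G.expand a b).contract (Sum.inr true)).bdry
      (keep (Sum.inl h) (inl_ne_expand h)) = keep (Sum.inl (G.bdry h)) (inl_ne_expand _) := by
    intro h
    refine bdry_contract_eq_iff.2 ?_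
    rw [under_keep, under_keep]
    by_cases h1 : h = a
    · subst h1
      refine .skip ?_ (.here ?_ (hk _)) <;> rw [bdry_expand, expandBdry_left hab]
      · rw [mem_kept_pair]; exact fun E => E.1 rfl
      · exact expandBdry_true
    · by_cases h2 : h = b
      · subst h2
        refine .skip ?_ (.here ?_ (hk _)) <;> rw [bdry_expand, expandBdry_right]
        · rw [mem_kept_pair]; exact fun E => E.2 rfl
        · exact expandBdry_false hab
      · exact .here (by rw [bdry_expand, expandBdry_of_ne h1 h2]) (hk _)
  refine ⟨Equiv.ofBijective (fun h => keep (Γ := G.expand a b)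
    (y := Sum.inr true) (Sum.inl h) (inl_ne_expand h)) ⟨fun h k e =>
    Sum.inl_injective (congrArg under e), fun h => ?_⟩, fun h => rfl, fun h => ?_, fun h => rfl⟩
  · have h1 := under_ne h
    rcases hu : under h with k | (_ | _)
    · exact ⟨k, under_injective hu.symm⟩
    · exact absurd hu h1.2
    · exact absurd hu h1.1
  · change keep (Γ := G.expand a b) (y := Sum.inr true) (Sum.inl (G.rot h)) (inl_ne_expand _) =
      ((G.expand a b).contract (Sum.inr true)).rot (keep (Sum.inl h) (inl_ne_expand h))
    rw [rot_eq (Γ := (G.expand a b).contract (Sum.inr true))]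
    refine Eq.trans ?_ (hb (G.rev h)).symm
    simp only [rot_eq]

end Expand

/-! ### Reduced diagrams -/

section Reduced

variable {p q : ℕ} {G G' : RibbonGraph (Fin p ⊕ Fin q)} {g : ℕ} {c c' : Core p q}
  {i : c.X → G.Dart}

theorem IsWeakDiagram.contracts (H : G.IsChordDiagram g) {y : G.Dart}
    (hy : ¬ G.rot.SameCycle y (G.rev y)) (hw : (G.contract y).IsWeakDiagram g) :
    Contracts g G (G.contract y) := by
  have hc := H.weak.contractible hy
  refine ⟨H, isChordDiagram_iff.2 ⟨hw, hc.rot_rot_contract_ne (isChordDiagram_iff.1 H).2⟩,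
    {y, G.rev y}, ?_, hc.isForest, ⟨⟨Equiv.refl _, fun _ => rfl, fun _ => rfl, fun _ => rfl⟩⟩⟩
  rintro h (rfl | rfl)
  · exact Or.inr rfl
  · exact Or.inl (G.rev_rev _)

theorem Iso.contracts (e : G.Iso G') (H : G.IsChordDiagram g) : Contracts g G G' :=
  ⟨H, H.of_iso e, ∅, by simp, fun h hh => hh.elim,
    ⟨⟨(collapseEmptyIso G).toEquiv.trans e.toEquiv,
      fun h => (congrArg e.toEquiv ((collapseEmptyIso G).map_rev h)).trans (e.map_rev _),
      fun h => (congrArg e.toEquiv ((collapseEmptyIso G).map_rot h)).trans (e.map_rot _),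
      fun h => (e.map_label _).trans ((collapseEmptyIso G).map_label h)⟩⟩⟩

/-- A diagram is reduced if the vertices on the circles are trivalent and if every ghost edge has an
end on a circle. -/
structure IsReduced (G : RibbonGraph (Fin p ⊕ Fin q)) (i : c.X → G.Dart) : Prop where
  rot_rot_rot : ∀ x, G.rot (G.rot (G.rot (i x))) = i x
  ghost : ∀ h ∈ G.ghost, ∃ x, h = G.rot (i x) ∨ G.rev h = G.rot (i x)

/-- In the cyclic ordering at a vertex on a circle, the edge of the circle that starts there is
followed by a ghost edge. If it were followed by the other edge of the circle, then the vertex would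
be bivalent. -/
theorem HasCore.rot_mem_ghost (HC : HasCore G c i) (H : G.IsChordDiagram g) (x : c.X) :
    G.rot (i x) ∈ G.ghost := by
  refine ⟨fun h => ?_, fun h => ?_⟩
  · exact H.weak.rot_ne _ (H.circles _ _ (HC.isIncoming x) h
      (Equiv.Perm.sameCycle_apply_right.2 (.refl _ _))).symm
  · obtain ⟨y, hy⟩ := (HC.isIncoming_iff _).1 h
    have h1 : G.rot (G.rot (i x)) = i (c.inn y) := by
      rw [← HC.rot_rev, hy, G.rev_rev]
    refine (isChordDiagram_iff.1 H).2 (i x) (h1.trans ?_)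
    refine (H.circles _ _ (HC.isIncoming x) (HC.isIncoming _) ?_).symm
    rw [← h1]
    exact Equiv.Perm.sameCycle_apply_right.2 (Equiv.Perm.sameCycle_apply_right.2 (.refl _ _))

/-- Split off from the vertex at which `i x` starts a trivalent vertex on the circle. -/
theorem HasCore.exists_expand (HC : HasCore G c i) (H : G.IsChordDiagram g) {x : c.X}
    (hx : G.rot (G.rot (G.rot (i x))) ≠ i x) :
    ∃ (G' : RibbonGraph (Fin p ⊕ Fin q)) (i' : c.X → G'.Dart), G'.IsChordDiagram g ∧
      HasCore G' c i' ∧ Linked g G G' ∧ G'.rot (G'.rot (G'.rot (i' x))) = i' x ∧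
      ∀ y, G.rot (G.rot (G.rot (i y))) = i y → G'.rot (G'.rot (G'.rot (i' y))) = i' y := by
  -- `m`, `l`, `i x` are consecutive half-edges, and so are `i x`, `inr true`, `l` after the expansion
  obtain ⟨z, hz⟩ := c.inn.surjective x
  set l := G.rev (i z) with hl
  have hlx : G.rot l = i x := by rw [hl, HC.rot_rev, hz]
  obtain ⟨m, hm⟩ := G.rot.surjective l
  have hne := H.weak.rot_ne
  have hne2 := (isChordDiagram_iff.1 H).2
  have hmx : m ≠ i x := by rintro rfl; exact hne2 _ (by rw [hm, hlx])
  have hmx' : G.rot (i x) ≠ m := by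
    rintro e; exact hx (by rw [e, hm, hlx])
  have hlx' : l ≠ i x := by rintro e; exact hne l (by rw [hlx, e])
  have hml : m ≠ l := by intro e; rw [e] at hm; exact hne l hm
  have hab : G.rev (i x) ≠ G.rev m := fun e => hmx (G.rev_injective e).symm
  have hba : G.bdry (G.rev m) = l := by rw [← rot_eq, hm]
  set E := G.expand (G.rev (i x)) (G.rev m) with hE
  have r1 : E.rot (Sum.inl (i x)) = Sum.inr true := expandBdry_left hab
  have r2 : E.rot (Sum.inr true) = Sum.inl l := by
    rw [← hba]; exact expandBdry_false hab
  have r3 : E.rot (Sum.inr false) = Sum.inl (G.rot (i x)) := by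
    rw [rot_eq (i x)]; exact expandBdry_true (b := G.rev m)
  have r4 : E.rot (Sum.inl m) = Sum.inr false := expandBdry_right
  have r5 : ∀ h, h ≠ i x → h ≠ m → E.rot (Sum.inl h) = Sum.inl (G.rot h) := fun h h1 h2 => by
    rw [rot_eq h]
    exact expandBdry_of_ne (fun e => h1 (G.rev_injective e)) (fun e => h2 (G.rev_injective e))
  have r6 : E.rot (Sum.inl l) = Sum.inl (i x) := by rw [r5 l hlx' hml.symm, hlx]
  have hEne : ∀ h, E.rot h ≠ h := by
    rintro (h | (_ | _))
    · by_cases h1 : h = i x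
      · subst h1; rw [r1]; exact Sum.inr_ne_inl
      · by_cases h2 : h = m
        · subst h2; rw [r4]; exact Sum.inr_ne_inl
        · rw [r5 h h1 h2]; exact fun e => hne h (Sum.inl_injective e)
    · rw [r3]; exact Sum.inl_ne_inr
    · rw [r2]; exact Sum.inl_ne_inr
  have hEne2 : ∀ h, E.rot (E.rot h) ≠ h := by
    rintro (h | (_ | _))
    · by_cases h1 : h = i x
      · subst h1; rw [r1, r2]; exact fun e => hlx' (Sum.inl_injective e)
      · by_cases h2 : h = m
        · subst h2; rw [r4, r3]; exact fun e => hmx' (Sum.inl_injective e)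
        · rw [r5 h h1 h2]
          by_cases h3 : G.rot h = i x
          · rw [h3, r1]; exact Sum.inr_ne_inl
          · by_cases h4 : G.rot h = m
            · rw [h4, r4]; exact Sum.inr_ne_inl
            · rw [r5 _ h3 h4]; exact fun e => hne2 h (Sum.inl_injective e)
    · rw [r3]
      by_cases h1 : G.rot (i x) = m
      · exact absurd h1 hmx'
      · rw [r5 _ (hne _) h1]; exact Sum.inl_ne_inr
    · rw [r2, r6]; exact Sum.inl_ne_inr
  have hinl : ∀ h, (Sum.inl h : E.Dart) ∈ E.ghost ↔ h ∈ G.ghost := fun h => Iff.rfl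
  have hlg : l ∉ G.ghost := HC.rev_not_mem_ghost z
  have hxg : i x ∉ G.ghost := HC.not_mem_ghost x
  have hlab1 : ∀ h k, G.bdry h = k → G.label k = G.label h := fun h k e => by
    rw [← e, H.weak.label_bdry]
  have htrue : ¬ E.IsIncoming (Sum.inr true) := by
    rintro ⟨j, hj⟩
    exact HC.not_isIncoming_rev x ⟨j, hj⟩
  have hfalse : ¬ E.IsIncoming (Sum.inr false) := by
    rintro ⟨j, hj⟩
    refine HC.not_isIncoming_rev z ⟨j, ?_⟩
    rw [hlab1 _ _ hba]; exact hj
  have hgh : (Sum.inr true : E.Dart) ∈ E.ghost := ⟨htrue, hfalse⟩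
  -- The new vertex on the circle has only one ghost edge.
  have hsep : ¬ E.Joined (E.ghost \ {Sum.inr true, E.rev (Sum.inr true)}) (Sum.inr true)
      (E.rev (Sum.inr true)) := by
    intro hj
    have := hj.apply_eq (fun h : E.Dart => h = Sum.inr true ∨ h = Sum.inl l ∨ h = Sum.inl (i x))
      ?_ ?_
    · have : (E.rev (Sum.inr true) : E.Dart) = Sum.inr true ∨ _ := this ▸ Or.inl rfl
      rcases this with e | e | e
      · exact E.rev_ne _ e
      · exact Sum.inr_ne_inl e
      · exact Sum.inr_ne_inl e
    · intro h
      refine propext ⟨fun e => ?_, ?_⟩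
      · rcases e with e | e | e
        · exact Or.inr (Or.inr (E.rot.injective (e.trans r1.symm)))
        · exact Or.inl (E.rot.injective (e.trans r2.symm))
        · exact Or.inr (Or.inl (E.rot.injective (e.trans r6.symm)))
      · rintro (rfl | rfl | rfl)
        · exact Or.inr (Or.inl r2)
        · exact Or.inr (Or.inr r6)
        · exact Or.inl r1
    · rintro h ⟨hg1, hg2⟩
      refine propext ⟨fun e => ?_, fun e => ?_⟩
      · exfalso
        rcases e with e | e | e
        · exact hg2 (Or.inr (E.rev_injective (e.trans (E.rev_rev _).symm)))
        · rw [← rev_mem_ghost_iff, e, hinl] at hg1; exact hlg hg1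
        · rw [← rev_mem_ghost_iff, e, hinl] at hg1; exact hxg hg1
      · exfalso
        rcases e with e | e | e
        · exact hg2 (Or.inl e)
        · rw [e, hinl] at hg1; exact hlg hg1
        · rw [e, hinl] at hg1; exact hxg hg1
  have hloop : ¬ E.rot.SameCycle (Sum.inr true) (E.rev (Sum.inr true)) := fun h =>
    hsep (joined_of_sameCycle h)
  have hElab := label_bdry_expand hab H.weak.label_bdry
  let e := contractExpandIso hab
  have hEw : E.IsWeakDiagram g := IsWeakDiagram.of_contract ⟨hloop, hEne _, hEne _⟩ hEne hElab hgh
    hsep (H.weak.of_iso e)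
  have hEc : E.IsChordDiagram g := isChordDiagram_iff.2 ⟨hEw, hEne2⟩
  have hEH : HasCore E c fun x => Sum.inl (i x) :=
    (HasCore.contract_iff hgh hElab).1 (HC.of_iso e)
  refine ⟨E, _, hEc, hEH, ?_, by rw [r1, r2, r6], fun y hy => ?_⟩
  · exact (Iso.contracts e H).linked.trans _ _ _
      (Relation.EqvGen.symm _ _ (IsWeakDiagram.contracts hEc hloop (H.weak.of_iso e)).linked)
  · have hyx : ∀ h, G.rot.SameCycle (i y) h → h ≠ i x ∧ h ≠ m := by
      have h0 : ¬ G.rot.SameCycle (i y) (i x) := fun h => hx (by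
        rw [← H.circles _ _ (HC.isIncoming y) (HC.isIncoming x) h, hy])
      refine fun h hh => ⟨?_, ?_⟩
      · rintro rfl; exact h0 hh
      · rintro rfl
        refine h0 (hh.trans ⟨2, ?_⟩)
        change G.rot (G.rot h) = _
        rw [hm, hlx]
    have k1 := hyx _ (.refl _ _)
    have k2 := hyx _ (Equiv.Perm.sameCycle_apply_right.2 (.refl _ _))
    have k3 := hyx _ (Equiv.Perm.sameCycle_apply_right.2
      (Equiv.Perm.sameCycle_apply_right.2 (.refl _ _)))
    rw [r5 _ k1.1 k1.2, r5 _ k2.1 k2.2, r5 _ k3.1 k3.2, hy]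

theorem HasCore.exists_cubic (HC : HasCore G c i) (H : G.IsChordDiagram g) :
    ∃ (G' : RibbonGraph (Fin p ⊕ Fin q)) (i' : c.X → G'.Dart), G'.IsChordDiagram g ∧
      HasCore G' c i' ∧ Linked g G G' ∧ ∀ y, G'.rot (G'.rot (G'.rot (i' y))) = i' y := by
  induction hn : Set.ncard {x | G.rot (G.rot (G.rot (i x))) ≠ i x} using
    Nat.strong_induction_on generalizing G with
  | _ n ih =>
  by_cases hx : ∃ x, G.rot (G.rot (G.rot (i x))) ≠ i x
  · obtain ⟨x, hx⟩ := hx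
    obtain ⟨G', i', h1, h2, h3, h4, h5⟩ := HC.exists_expand H hx
    have hlt : Set.ncard {x | G'.rot (G'.rot (G'.rot (i' x))) ≠ i' x} < n := by
      rw [← hn]
      exact Set.ncard_lt_ncard ⟨fun y hy hy' => hy (h5 y hy'), fun hs => hs hx h4⟩ (Set.toFinite _)
    obtain ⟨G'', i'', k1, k2, k3, k4⟩ := ih _ hlt h2 h1 rfl
    exact ⟨G'', i'', k1, k2, h3.trans _ _ _ k3, k4⟩
  · push Not at hx
    exact ⟨G, i, H, HC, .refl _, hx⟩

/-- Every chord diagram can be changed into a reduced one with the same core: split off trivalent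
vertices on the circles, and then contract the ghost edges that do not meet a circle. -/
theorem HasCore.exists_isReduced (HC : HasCore G c i) (H : G.IsChordDiagram g) :
    ∃ (G' : RibbonGraph (Fin p ⊕ Fin q)) (i' : c.X → G'.Dart), G'.IsChordDiagram g ∧
      HasCore G' c i' ∧ Linked g G G' ∧ IsReduced G' i' := by
  obtain ⟨G', i', h1, h2, h3, h4⟩ := HC.exists_cubic H
  suffices ∃ (G'' : RibbonGraph (Fin p ⊕ Fin q)) (i'' : c.X → G''.Dart), G''.IsChordDiagram g ∧
      HasCore G'' c i'' ∧ Linked g G' G'' ∧ IsReduced G'' i'' by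
    obtain ⟨G'', i'', k1, k2, k3, k4⟩ := this
    exact ⟨G'', i'', k1, k2, h3.trans _ _ _ k3, k4⟩
  clear h3 HC H
  induction hn : Nat.card G'.Dart using Nat.strong_induction_on generalizing G' with
  | _ n ih =>
  by_cases hy : ∀ h ∈ G'.ghost, ∃ x, h = G'.rot (i' x) ∨ G'.rev h = G'.rot (i' x)
  · exact ⟨G', i', h1, h2, .refl _, h4, hy⟩
  push Not at hy
  obtain ⟨y, hyg, hy⟩ := hy
  have hloop : ¬ G'.rot.SameCycle y (G'.rev y) := h1.forest.not_sameCycle hyg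
  have hcirc : ∀ h, G'.IsIncoming h → ∀ k ∈ G'.ghost, G'.rot.SameCycle h k →
      ∃ x, k = G'.rot (i' x) := by
    intro h hh k hk hs
    obtain ⟨x, rfl⟩ := (h2.isIncoming_iff h).1 hh
    refine ⟨x, ?_⟩
    have := mem_of_sameCycle (W := {k | k = i' x ∨ k = G'.rot (i' x) ∨
      k = G'.rot (G'.rot (i' x))}) (by
        rintro _ (rfl | rfl | rfl)
        · exact Or.inr (Or.inl rfl)
        · exact Or.inr (Or.inr rfl)
        · exact Or.inl (h4 x)) hs (Or.inl rfl)
    rcases this with rfl | rfl | rfl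
    · exact absurd hk (h2.not_mem_ghost x)
    · rfl
    · obtain ⟨z, rfl⟩ := c.inn.surjective x
      have h5 := h4 (c.inn z)
      rw [← h2.rot_rev, G'.rot.injective.eq_iff] at h5
      rw [← h2.rot_rev, h5] at hk
      exact absurd hk (h2.rev_not_mem_ghost z)
  have hw : (G'.contract y).IsWeakDiagram g := by
    refine h1.weak.contract hloop (fun h k hh hk _ _ hs _ => ?_) (Or.inl hyg)
    obtain ⟨x, hx⟩ := hcirc h hh y hyg hs
    exact (hy x).1 hx
  have hc := IsWeakDiagram.contracts h1 hloop hw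
  have h5 := h2.contract hyg h1.weak.label_bdry
  have hcy := h1.weak.contractible hloop
  have hcard := card_contract_dart y
  obtain ⟨G'', i'', k1, k2, k3, k4⟩ := ih _ (by omega) (G'.contract y) _ hc.right h5 (fun x => by
    have e1 : under ((G'.contract y).rot (keep (i' x) (h2.ne_of_mem_ghost hyg x))) =
        G'.rot (i' x) := by
      rw [hcy.under_rot, under_keep]
      exact slip_of_kept ⟨fun e => (hy x).1 e.symm, fun e => (hy x).2 e.symm⟩
    have e2 : under ((G'.contract y).rot ((G'.contract y).rot
        (keep (i' x) (h2.ne_of_mem_ghost hyg x)))) = G'.rot (G'.rot (i' x)) := by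
      rw [hcy.under_rot, e1]
      refine slip_of_kept ⟨fun e => ?_, fun e => ?_⟩
      · obtain ⟨x', hx'⟩ := hcirc _ (h2.isIncoming x) y hyg ⟨2, e⟩
        exact (hy x').1 hx'
      · obtain ⟨x', hx'⟩ := hcirc _ (h2.isIncoming x) _ (rev_mem_ghost hyg) ⟨2, e⟩
        exact (hy x').2 hx'
    refine under_injective ?_
    rw [hcy.under_rot, e2, h4, under_keep]
    exact slip_of_kept (h2.ne_of_mem_ghost hyg x)) rfl
  exact ⟨G'', i'', k1, k2, hc.linked.trans _ _ _ k3, k4⟩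

end Reduced

end RibbonGraph

theorem Next.of_notMem {α : Type} {f : Equiv.Perm α} {L : Set α} {a b : α} (h : Next f L a b)
    (ha : f a ∉ L) : Next f L (f a) b := by
  cases h with
  | here e hb => exact absurd (e ▸ hb) ha
  | skip _ h => exact h

theorem Next.eq_of_mem {α : Type} {f : Equiv.Perm α} {L : Set α} {a b : α} (h : Next f L a b)
    (ha : f a ∈ L) : f a = b := (Next.here rfl ha).unique h

/-! ### Reduced diagrams are determined by their cores -/

/-- The oriented edges of a reduced diagram, in terms of the edges `x` of its core: `x` itself, with
its two orientations `inn x` and `out x`, and the ghost edge that starts at the initial vertex of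
`x`, with its two orientations `up x`, away from the circle, and `dn x`. -/
inductive StarDart (X : Type) : Type
  | inn (x : X)
  | out (x : X)
  | up (x : X)
  | dn (x : X)

namespace StarDart

variable {p q : ℕ}

instance {X : Type} [Finite X] : Finite (StarDart X) := by
  refine Finite.of_injective (β := Fin 4 × X) (fun d => match d with
    | inn x => (0, x) | out x => (1, x) | up x => (2, x) | dn x => (3, x)) ?_
  rintro (x | x | x | x) (y | y | y | y) h <;> simp_all

/-- Orientation reversal. -/
def rev {X : Type} : StarDart X → StarDart X
  | inn x => out x
  | out x => inn x
  | up x => dn x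
  | dn x => up x

/-- The cyclic orderings at the vertices. -/
def rot (c : Core p q) : StarDart c.X → StarDart c.X
  | inn x => up x
  | up x => out (c.inn.symm x)
  | out x => inn (c.inn x)
  | dn x => dn (c.tau x)

/-- The labels of the boundary cycles. -/
def label (c : Core p q) : StarDart c.X → Fin p ⊕ Fin q
  | inn x => Sum.inl (c.li x)
  | out x => Sum.inr (c.lo x)
  | up x => Sum.inr (c.lo x)
  | dn x => Sum.inr (c.lo (c.inn.symm x))

/-- An edge of the core that starts at the vertex of the core at which the oriented edge starts. -/
def vertex (c : Core p q) : StarDart c.X → c.X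
  | inn x => x
  | out x => c.inn x
  | up x => x
  | dn x => x

/-- The oriented edge of `G` that is described by `d`. -/
def toDart {X : Type} {ι : Type} {G : RibbonGraph ι} (i : X → G.Dart) : StarDart X → G.Dart
  | inn x => i x
  | out x => G.rev (i x)
  | up x => G.rot (i x)
  | dn x => G.rev (G.rot (i x))

theorem toDart_rev {X : Type} {ι : Type} {G : RibbonGraph ι} (i : X → G.Dart) (d : StarDart X) :
    toDart i d.rev = G.rev (toDart i d) := by
  cases d
  · rfl
  · exact (G.rev_rev _).symm
  · rfl
  · exact (G.rev_rev _).symm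

theorem sameCycle_vertex_rot (c : Core p q) (d : StarDart c.X) :
    c.tau.SameCycle (vertex c (rot c d)) (vertex c d) := by
  rcases d with x | x | x | x
  · exact .refl _ _
  · exact .refl _ _
  · change c.tau.SameCycle (c.inn (c.inn.symm x)) x
    rw [Equiv.apply_symm_apply]
  · exact Equiv.Perm.sameCycle_apply_left.2 (.refl _ _)

end StarDart

namespace RibbonGraph

open StarDart

variable {p q : ℕ} {G G' : RibbonGraph (Fin p ⊕ Fin q)} {g : ℕ} {c : Core p q}
  {i : c.X → G.Dart} {i' : c.X → G'.Dart}

namespace IsReduced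

theorem rot_rot (HR : IsReduced G i) (HC : HasCore G c i) (x : c.X) :
    G.rot (G.rot (i x)) = G.rev (i (c.inn.symm x)) := by
  apply G.rot.injective
  rw [HR.rot_rot_rot, HC.rot_rev, Equiv.apply_symm_apply]

theorem next_up (HC : HasCore G c i) (H : G.IsChordDiagram g) (x : c.X) :
    Next G.bdry G.ghostᶜ (G.rot (i x)) (G.rev (i (c.out x))) := by
  have h1 := HC.rot_mem_ghost H x
  rw [rot_eq] at h1 ⊢
  exact (HC.next x).of_notMem fun h => h h1

theorem eq_tau_of_bdry (HR : IsReduced G i) (HC : HasCore G c i) {h : G.Dart} {x z : c.X}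
    (hn : Next G.bdry G.ghostᶜ h (G.rev (i (c.out x)))) (hz : G.rev h = G.rot (i z)) :
    z = c.tau x := by
  have h1 : G.bdry h = G.rev (i (c.inn.symm z)) := by rw [bdry_apply, hz, HR.rot_rot HC]
  have h2 := hn.eq_of_mem (by rw [h1]; exact HC.rev_not_mem_ghost _)
  rw [h1] at h2
  have h3 := HC.inj (G.rev_injective h2)
  rw [Core.tau_apply, ← h3, Equiv.apply_symm_apply]

/-- The ghost edge starting at `x` either connects two circles (in which case it is also the ghost
edge starting at `tau x`), or the next edge at its other end is the ghost edge starting at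
`tau x`. -/
theorem dn_cases (HR : IsReduced G i) (HC : HasCore G c i) (H : G.IsChordDiagram g) (x : c.X) :
    (G.rev (G.rot (i x)) = G.rot (i (c.tau x)) ∧ c.tau (c.tau x) = x) ∨
    (G.rot (G.rev (G.rot (i x))) = G.rev (G.rot (i (c.tau x))) ∧
      ∀ y, G.rev (G.rot (i x)) ≠ G.rot (i y)) := by
  by_cases hA : ∃ y, G.rev (G.rot (i x)) = G.rot (i y)
  · obtain ⟨y, hy⟩ := hA
    have h1 := HR.eq_tau_of_bdry HC (next_up HC H x) hy
    have h2 := HR.eq_tau_of_bdry HC (next_up HC H y) (rev_eq_iff.2 hy.symm)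
    subst h1
    exact Or.inl ⟨hy, h2.symm⟩
  · push Not at hA
    refine Or.inr ⟨?_, hA⟩
    have hK : G.rot (G.rev (G.rot (i x))) ∈ G.ghost := by
      rw [HC.mem_ghost_iff]
      refine fun z => ⟨fun hz => ?_, fun hz => hA (c.inn z) ?_⟩
      · obtain ⟨z, rfl⟩ := c.inn.surjective z
        rw [← HC.rot_rev] at hz
        have h1 := G.rev_injective (G.rot.injective hz)
        exact HC.not_mem_ghost z (h1 ▸ HC.rot_mem_ghost H x)
      · apply G.rot.injective
        rw [HR.rot_rot HC, Equiv.symm_apply_apply, hz, G.rev_rev]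
    obtain ⟨z, hz | hz⟩ := HR.ghost _ hK
    · have h1 := G.rot.injective hz
      exact absurd (rev_mem_ghost (HC.rot_mem_ghost H x)) (h1 ▸ HC.not_mem_ghost z)
    · have h2 := HR.eq_tau_of_bdry HC (x := x) ((next_up HC H x).of_notMem fun h => h hK) hz
      rw [← h2]
      exact rev_eq_iff.1 hz

theorem dn_eq_up (HR : IsReduced G i) (HC : HasCore G c i) (H : G.IsChordDiagram g) {x : c.X}
    (hx : c.tau (c.tau x) = x) : toDart i (dn x) = toDart i (up (c.tau x)) := by
  rcases HR.dn_cases HC H x with h | ⟨h, hA⟩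
  · exact h.1
  · exfalso
    rcases HR.dn_cases HC H (c.tau x) with h' | ⟨h', -⟩
    · rw [hx] at h'
      exact hA _ (rev_eq_iff.2 h'.1.symm)
    · rw [hx, ← h] at h'
      exact (isChordDiagram_iff.1 H).2 _ h'

theorem exists_toDart (HR : IsReduced G i) (HC : HasCore G c i) (h : G.Dart) :
    ∃ d, toDart i d = h := by
  by_cases hh : h ∈ G.ghost
  · obtain ⟨x, hx | hx⟩ := HR.ghost h hh
    · exact ⟨up x, hx.symm⟩
    · exact ⟨dn x, (rev_eq_iff.1 hx).symm⟩
  · rw [HC.mem_ghost_iff] at hh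
    push Not at hh
    obtain ⟨x, hx⟩ := hh
    by_cases h1 : i x = h
    · exact ⟨inn x, h1⟩
    · exact ⟨out x, (rev_eq_iff.2 (hx h1))⟩

theorem exists_rot (HR : IsReduced G i) (HC : HasCore G c i) (H : G.IsChordDiagram g)
    (h : G.Dart) : ∃ d, toDart i d = h ∧ toDart i (StarDart.rot c d) = G.rot h := by
  obtain ⟨d, rfl⟩ := HR.exists_toDart HC h
  have hup : ∀ x, toDart i (StarDart.rot c (up x)) = G.rot (toDart i (up x)) := fun x =>
    (HR.rot_rot HC x).symm
  rcases d with x | x | x | x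
  · exact ⟨inn x, rfl, rfl⟩
  · exact ⟨out x, rfl, (HC.rot_rev x).symm⟩
  · exact ⟨up x, rfl, hup x⟩
  · rcases HR.dn_cases HC H x with h | h
    · refine ⟨up (c.tau x), h.1.symm, ?_⟩
      rw [hup, HR.dn_eq_up HC H h.2]
    · exact ⟨dn x, rfl, h.1.symm⟩

theorem toDart_eq (HR : IsReduced G i) (HC : HasCore G c i) (H : G.IsChordDiagram g)
    {d d' : StarDart c.X} (h : toDart i d = toDart i d') : d = d' ∨ ∃ x, c.tau (c.tau x) = x ∧
      ((d = dn x ∧ d' = up (c.tau x)) ∨ (d' = dn x ∧ d = up (c.tau x))) := by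
  have hup : ∀ x, toDart i (up x) ∈ G.ghost := HC.rot_mem_ghost H
  have hdn : ∀ x, toDart i (dn x) ∈ G.ghost := fun x => rev_mem_ghost (hup x)
  have hin : ∀ x, toDart i (inn x) ∉ G.ghost := HC.not_mem_ghost
  have hout : ∀ x, toDart i (out x) ∉ G.ghost := HC.rev_not_mem_ghost
  have hio : ∀ x y, toDart i (inn x) ≠ toDart i (out y) := fun x y h =>
    HC.not_isIncoming_rev y ((show i x = G.rev (i y) from h) ▸ HC.isIncoming x)
  have key : ∀ x y, toDart i (dn x) = toDart i (up y) → c.tau (c.tau x) = x ∧ y = c.tau x := by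
    intro x y h
    rcases HR.dn_cases HC H x with h' | h'
    · exact ⟨h'.2, HC.inj (G.rot.injective (h.symm.trans h'.1))⟩
    · exact absurd h (h'.2 y)
  rcases d with x | x | x | x <;> rcases d' with y | y | y | y
  · exact Or.inl (congrArg inn (HC.inj h))
  · exact absurd h (hio x y)
  · exact absurd (hup y) (h ▸ hin x)
  · exact absurd (hdn y) (h ▸ hin x)
  · exact absurd h.symm (hio y x)
  · exact Or.inl (congrArg out (HC.inj (G.rev_injective h)))
  · exact absurd (hup y) (h ▸ hout x)
  · exact absurd (hdn y) (h ▸ hout x)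
  · exact absurd (hup x) (h ▸ hin y)
  · exact absurd (hup x) (h ▸ hout y)
  · exact Or.inl (congrArg up (HC.inj (G.rot.injective h)))
  · obtain ⟨h1, h2⟩ := key y x h.symm
    exact Or.inr ⟨y, h1, Or.inr ⟨rfl, congrArg up h2⟩⟩
  · exact absurd (hdn x) (h ▸ hin y)
  · exact absurd (hdn x) (h ▸ hout y)
  · obtain ⟨h1, h2⟩ := key x y h
    exact Or.inr ⟨x, h1, Or.inl ⟨rfl, congrArg up h2⟩⟩
  · exact Or.inl (congrArg dn (HC.inj (G.rot.injective (G.rev_injective h))))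

theorem label_toDart (HR : IsReduced G i) (HC : HasCore G c i) (H : G.IsChordDiagram g)
    (d : StarDart c.X) : G.label (toDart i d) = d.label c := by
  rcases d with x | x | x | x
  · exact HC.label x
  · exact HC.label_rev x
  · have := H.weak.label_bdry (G.rev (i x))
    rwa [← rot_eq, HC.label_rev] at this
  · have := H.weak.label_bdry (G.rev (G.rot (i x)))
    rw [← rot_eq, HR.rot_rot HC, HC.label_rev] at this
    exact this.symm

/-- Reduced diagrams with the same core are isomorphic. -/
theorem nonempty_iso (HR : IsReduced G i) (HC : HasCore G c i) (H : G.IsChordDiagram g)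
    (HR' : IsReduced G' i') (HC' : HasCore G' c i') (H' : G'.IsChordDiagram g) :
    Nonempty (G.Iso G') := by
  have key : ∀ {G G' : RibbonGraph (Fin p ⊕ Fin q)} {i : c.X → G.Dart} {i' : c.X → G'.Dart},
      IsReduced G i → HasCore G c i → G.IsChordDiagram g → IsReduced G' i' → HasCore G' c i' →
      G'.IsChordDiagram g → ∃ F : G.Dart → G'.Dart, ∀ d, F (toDart i d) = toDart i' d := by
    intro G G' i i' HR HC H HR' HC' H'
    choose d hd using HR.exists_toDart HC
    refine ⟨fun h => toDart i' (d h), fun d₀ => ?_⟩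
    rcases HR.toDart_eq HC H (hd (toDart i d₀)) with e | ⟨x, hx, ⟨e, e'⟩ | ⟨e, e'⟩⟩
    · exact congrArg _ e
    · change toDart i' (d (toDart i d₀)) = _
      rw [e, HR'.dn_eq_up HC' H' hx, e']
    · change toDart i' (d (toDart i d₀)) = _
      rw [e', ← HR'.dn_eq_up HC' H' hx, e]
  obtain ⟨F, hF⟩ := key HR HC H HR' HC' H'
  obtain ⟨F', hF'⟩ := key HR' HC' H' HR HC H
  refine ⟨⟨⟨F, F', fun h => ?_, fun h => ?_⟩, fun h => ?_, fun h => ?_, fun h => ?_⟩⟩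
  · obtain ⟨d, rfl⟩ := HR.exists_toDart HC h
    rw [hF, hF']
  · obtain ⟨d, rfl⟩ := HR'.exists_toDart HC' h
    rw [hF', hF]
  · obtain ⟨d, rfl⟩ := HR.exists_toDart HC h
    change F _ = G'.rev (F _)
    rw [← toDart_rev, hF, hF, toDart_rev]
  · obtain ⟨d, rfl, hd⟩ := HR.exists_rot HC H h
    obtain ⟨d', h1, h2⟩ := HR'.exists_rot HC' H' (toDart i' d)
    change F _ = G'.rot (F _)
    -- `d` and `d'` describe the same oriented edge in both graphs.
    have h3 : toDart i d' = toDart i d := by rw [← hF', h1, hF']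
    have h4 : toDart i (StarDart.rot c d') = G.rot (toDart i d) := by
      rcases HR.toDart_eq HC H h3 with e | ⟨x, hx, ⟨rfl, rfl⟩ | ⟨rfl, rfl⟩⟩
      · rw [e, hd]
      · exfalso
        have : toDart i' (dn (c.tau x)) = G'.rot (toDart i' (dn x)) := by
          rw [h1]; exact h2
        rw [HR'.dn_eq_up HC' H' hx] at this
        have h5 : toDart i' (dn (c.tau x)) = G'.rot (G'.rot (i' (c.tau x))) := this
        rw [HR'.rot_rot HC'] at h5
        exact HC'.rev_not_mem_ghost _ (by
          rw [← h5]; exact rev_mem_ghost (HC'.rot_mem_ghost H' (c.tau x)))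
      · rw [← h3]
        exact (HR.rot_rot HC _).symm
    rw [← h4, hF, h2, hF]
  · obtain ⟨d, rfl⟩ := HR.exists_toDart HC h
    change G'.label (F _) = _
    rw [hF, HR.label_toDart HC H, HR'.label_toDart HC' H']

end IsReduced

/-- Chord diagrams with the same core are linked. -/
theorem HasCore.linked (HC : HasCore G c i) (H : G.IsChordDiagram g) (HC' : HasCore G' c i')
    (H' : G'.IsChordDiagram g) : Linked g G G' := by
  obtain ⟨G₁, i₁, h1, h2, h3, h4⟩ := HC.exists_isReduced H
  obtain ⟨G₁', i₁', h1', h2', h3', h4'⟩ := HC'.exists_isReduced H'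
  obtain ⟨e⟩ := h4.nonempty_iso h2 h1 h4' h2' h1'
  exact h3.trans _ _ _ ((e.contracts h1).linked.trans _ _ _ (h3'.symm _ _))

/-! ### The vertices of the core -/

/-- Paths in a reduced diagram stay in the same vertex of the core, as long as the circular edges
that they use are loops of the core. -/
theorem IsReduced.sameCycle_of_joined (HR : IsReduced G i) (HC : HasCore G c i)
    (H : G.IsChordDiagram g) {T : Set G.Dart}
    (hT : ∀ x, i x ∈ T ∨ G.rev (i x) ∈ T → c.tau.SameCycle x (c.inn x)) {d d' : StarDart c.X}
    (hj : G.Joined T (toDart i d) (toDart i d')) : c.tau.SameCycle (vertex c d) (vertex c d') := by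
  have key : ∀ d d' : StarDart c.X, toDart i d = toDart i d' →
      c.tau.SameCycle (vertex c d) (vertex c d') := by
    intro d d' h
    rcases HR.toDart_eq HC H h with rfl | ⟨x, -, ⟨rfl, rfl⟩ | ⟨rfl, rfl⟩⟩
    · exact .refl _ _
    · exact Equiv.Perm.sameCycle_apply_right.2 (.refl _ _)
    · exact Equiv.Perm.sameCycle_apply_left.2 (.refl _ _)
  choose e he using HR.exists_toDart HC
  let f : G.Dart → Quotient (Equiv.Perm.SameCycle.setoid c.tau) := fun h => ⟦vertex c (e h)⟧
  have hf : ∀ d, f (toDart i d) = ⟦vertex c d⟧ := fun d => Quotient.sound (key _ _ (he _))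
  have := hj.apply_eq f (fun h => ?_) (fun h hh => ?_)
  · rw [hf, hf] at this
    exact Quotient.exact this
  · obtain ⟨d, rfl, hd⟩ := HR.exists_rot HC H h
    rw [← hd, hf, hf]
    exact Quotient.sound (sameCycle_vertex_rot c d)
  · obtain ⟨d, rfl⟩ := HR.exists_toDart HC h
    rw [← toDart_rev, hf, hf]
    refine Quotient.sound ?_
    rcases d with x | x | x | x
    · exact (hT x (Or.inl hh)).symm
    · exact hT x (Or.inr hh)
    · exact .refl _ _
    · exact .refl _ _

theorem Next.joined_ghost {h k : G.Dart} (hn : Next G.bdry G.ghostᶜ h k) :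
    G.Joined G.ghost (G.bdry h) k := by
  induction hn with
  | here e _ => rw [e]; exact .refl _
  | skip hn _ ih => exact (joined_bdry (by simpa using hn)).trans ih

theorem HasCore.joined_tau (HC : HasCore G c i) (x : c.X) :
    G.Joined G.ghost (i x) (i (c.tau x)) := by
  have h1 := Next.joined_ghost (HC.next x)
  rw [← rot_eq] at h1
  refine ((joined_rot _).trans h1).trans ?_
  rw [Core.tau_apply, ← HC.rot_rev]
  exact joined_rot _

theorem HasCore.joined_of_sameCycle (HC : HasCore G c i) {x y : c.X} (h : c.tau.SameCycle x y) :
    G.Joined G.ghost (i x) (i y) :=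
  mem_of_sameCycle (W := {y | G.Joined G.ghost (i x) (i y)})
    (fun z hz => hz.trans (HC.joined_tau z)) h (.refl _)

theorem HasCore.joined_vertex (HC : HasCore G c i) (H : G.IsChordDiagram g) (d : StarDart c.X) :
    G.Joined G.ghost (toDart i d) (i (vertex c d)) := by
  rcases d with x | x | x | x
  · exact .refl _
  · change G.Joined _ (G.rev (i x)) (i (c.inn x))
    rw [← HC.rot_rev]; exact joined_rot _
  · exact (joined_rot _).symm
  · exact (joined_rev (HC.rot_mem_ghost H x)).symm.trans (joined_rot _).symm

/-- The ghost edges of a diagram whose core has one vertex form a forest with one component, so its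
Euler characteristic determines the number of edges of the core. -/
theorem IsReduced.card_eq (HR : IsReduced G i) (HC : HasCore G c i) (H : G.IsChordDiagram g)
    (hc : c.IsOneVertex) : Nat.card c.X + 1 = 2 * g + p + q := by
  have h1 := H.forest.card_components _ G.ghost (fun _ => rev_mem_ghost) rfl
  have h2 : Nat.card (Quotient (joinedSetoid G.ghost)) = 1 := by
    rw [Nat.card_eq_one_iff_unique]
    refine ⟨⟨fun a b => ?_⟩, H.nonempty.map Quotient.mk''⟩
    induction a using Quotient.ind with | _ a => ?_
    induction b using Quotient.ind with | _ b => ?_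
    obtain ⟨d, rfl⟩ := HR.exists_toDart HC a
    obtain ⟨d', rfl⟩ := HR.exists_toDart HC b
    exact Quotient.sound ((HC.joined_vertex H d).trans
      ((HC.joined_of_sameCycle (hc.tau_sameCycle _ _)).trans (HC.joined_vertex H d').symm))
  have h3 : G.ghostᶜ = Set.range (Sum.elim i fun x => G.rev (i x)) := by
    ext h
    rw [Set.mem_compl_iff, HC.mem_ghost_iff]
    constructor
    · intro hh
      push Not at hh
      obtain ⟨x, hx⟩ := hh
      by_cases h1 : i x = h
      · exact ⟨Sum.inl x, h1⟩
      · exact ⟨Sum.inr x, rev_eq_iff.2 (hx h1)⟩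
    · rintro ⟨x | x, rfl⟩ hh
      · exact (hh x).1 rfl
      · exact (hh x).2 (G.rev_rev _).symm
  have h4 : G.ghostᶜ.ncard = 2 * Nat.card c.X := by
    rw [h3, ← Nat.card_coe_set_eq, Nat.card_range_of_injective, Nat.card_sum, two_mul]
    rintro (x | x) (y | y) e
    · exact congrArg Sum.inl (HC.inj e)
    · exact absurd (HC.isIncoming x) (by
        change i x = G.rev (i y) at e
        rw [e]; exact HC.not_isIncoming_rev y)
    · exact absurd (HC.isIncoming y) (by
        change G.rev (i x) = i y at e
        rw [← e]; exact HC.not_isIncoming_rev x)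
    · exact congrArg Sum.inr (HC.inj (G.rev_injective e))
  have h5 := Set.ncard_add_ncard_compl G.ghost
  have h6 := card_dart G
  have h7 := H.euler
  omega

/-- An edge of the core of a reduced diagram that is not a loop can be contracted. -/
theorem IsReduced.contracts (HR : IsReduced G i) (HC : HasCore G c i) (H : G.IsChordDiagram g)
    {y : c.X} (hy : ¬ c.tau.SameCycle y (c.inn y)) : Contracts g G (G.contract (i y)) := by
  have hj : ¬ G.Joined G.ghost (i y) (G.rev (i y)) := fun hj =>
    hy (HR.sameCycle_of_joined (d := inn y) (d' := out y) HC H (fun x hx => by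
      rcases hx with hx | hx
      · exact absurd hx (HC.not_mem_ghost x)
      · exact absurd hx (HC.rev_not_mem_ghost x)) hj)
  have hl : ¬ G.rot.SameCycle (i y) (G.rev (i y)) := fun h => hj (joined_of_sameCycle h)
  refine IsWeakDiagram.contracts H hl (H.weak.contract hl (fun h k hh hk hne _ hs _ => ?_)
    (Or.inr hj))
  exact hne (H.circles _ _ hh (HC.isIncoming y) hs)

/-- Every chord diagram can be changed into a diagram whose core has one vertex, by contracting
edges of the core. -/
theorem HasCore.exists_isOneVertex (HC : HasCore G c i) (H : G.IsChordDiagram g) :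
    ∃ (G' : RibbonGraph (Fin p ⊕ Fin q)) (c' : Core p q) (i' : c'.X → G'.Dart),
      G'.IsChordDiagram g ∧ HasCore G' c' i' ∧ Linked g G G' ∧ c'.IsOneVertex ∧
      Nat.card c'.X + 1 = 2 * g + p + q := by
  induction hn : Nat.card c.X using Nat.strong_induction_on generalizing G c with
  | _ n ih =>
  obtain ⟨G₁, i₁, h1, h2, h3, h4⟩ := HC.exists_isReduced H
  by_cases hy : ∃ y, ¬ c.tau.SameCycle y (c.inn y)
  · obtain ⟨y, hy⟩ := hy
    have hy1 : c.inn y ≠ y := fun e => hy (by rw [e])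
    have hy2 : c.out y ≠ y := fun e => hy ⟨1, by rw [zpow_one, Core.tau_apply, e]⟩
    obtain ⟨c', j, hd⟩ := Core.exists_del c y
    obtain ⟨i', hi'⟩ := h2.contract_del hd hy1 hy2
    have hcon := h4.contracts h2 h1 hy
    have hcard := hd.card
    obtain ⟨G'', c'', i'', k1, k2, k3, k4⟩ := ih _ (by omega) hi' hcon.right rfl
    exact ⟨G'', c'', i'', k1, k2, h3.trans _ _ _ (hcon.linked.trans _ _ _ k3), k4⟩
  · push Not at hy
    have hc : c.IsOneVertex := ⟨h2.isLabelled h1.weak, fun x y =>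
      h4.sameCycle_of_joined (d := inn x) (d' := inn y) h2 h1 (fun x _ => hy x)
        (h1.connected _ _)⟩
    exact ⟨G₁, c, i₁, h1, h2, h3, hc, h4.card_eq h2 h1 hc⟩

end RibbonGraph

namespace RibbonGraph

open StarDart

variable {p q : ℕ} {G : RibbonGraph (Fin p ⊕ Fin q)} {g : ℕ} {c c' : Core p q}

/-! ### Diagrams with a given core -/

/-- The diagram in which every edge `x` of the core starts at a vertex of its own, from which a ghost
edge leads to the centre of a star that corresponds to the vertex of the core. -/
abbrev starGraph (c : Core p q) : RibbonGraph (Fin p ⊕ Fin q) where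
  Dart := StarDart c.X
  rev := Function.Involutive.toPerm StarDart.rev fun d => by cases d <;> rfl
  rot :=
    { toFun := StarDart.rot c
      invFun := fun d => match d with
        | inn x => out (c.inn.symm x)
        | out x => up (c.inn x)
        | up x => inn x
        | dn x => dn (c.tau.symm x)
      left_inv := fun d => by cases d <;> simp [StarDart.rot]
      right_inv := fun d => by cases d <;> simp [StarDart.rot] }
  rev_rev d := by cases d <;> rfl
  rev_ne d e := by
    change d.rev = d at e
    cases d <;> cases e
  label := StarDart.label c

/-- The vertices of the star graph. -/
def starVertex (c : Core p q) : StarDart c.X → c.X ⊕ Quotient (Equiv.Perm.SameCycle.setoid c.tau)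
  | inn x => Sum.inl x
  | out x => Sum.inl (c.inn x)
  | up x => Sum.inl x
  | dn x => Sum.inr ⟦x⟧

theorem starVertex_rot (d : StarDart c.X) :
    starVertex c ((starGraph c).rot d) = starVertex c d := by
  rcases d with x | x | x | x
  · rfl
  · rfl
  · exact congrArg Sum.inl (c.inn.apply_symm_apply x)
  · exact congrArg Sum.inr (Quotient.sound (Equiv.Perm.sameCycle_apply_left.2 (.refl _ _)))

theorem starVertex_eq_iff {d d' : StarDart c.X} :
    starVertex c d = starVertex c d' ↔ (starGraph c).rot.SameCycle d d' := by
  have hup : ∀ x, (starGraph c).rot.SameCycle (inn x) (up x) := fun x => ⟨1, rfl⟩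
  have hout : ∀ x, (starGraph c).rot.SameCycle (inn (c.inn x)) (out x) := fun x =>
    Equiv.Perm.SameCycle.symm ⟨1, rfl⟩
  have hall : ∀ d : StarDart c.X, (∃ x, starVertex c d = Sum.inl x ∧
      (starGraph c).rot.SameCycle (inn x) d) ∨ ∃ x, d = dn x := by
    rintro (x | x | x | x)
    · exact Or.inl ⟨x, rfl, .refl _ _⟩
    · exact Or.inl ⟨c.inn x, rfl, hout x⟩
    · exact Or.inl ⟨x, rfl, hup x⟩
    · exact Or.inr ⟨x, rfl⟩
  constructor
  · intro h
    rcases hall d with ⟨x, hx, hd⟩ | ⟨x, rfl⟩ <;> rcases hall d' with ⟨y, hy, hd'⟩ | ⟨y, rfl⟩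
    · rw [hx, hy] at h
      rw [Sum.inl_injective h] at hd
      exact hd.symm.trans hd'
    · rw [hx] at h; exact absurd h Sum.inl_ne_inr
    · rw [hy] at h; exact absurd h Sum.inr_ne_inl
    · have h1 : c.tau.SameCycle x y := Quotient.exact (Sum.inr_injective h)
      exact mem_of_sameCycle (W := {y | (starGraph c).rot.SameCycle (dn x) (dn y)})
        (fun z hz => hz.trans ⟨1, rfl⟩) h1 (.refl _ _)
  · intro h
    exact (mem_of_sameCycle (W := {d' | starVertex c d' = starVertex c d})
      (fun z hz => (starVertex_rot z).trans hz) h rfl).symm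

theorem card_starGraph_vertex (c : Core p q) : Nat.card (starGraph c).Vertex =
    Nat.card c.X + Nat.card (Quotient (Equiv.Perm.SameCycle.setoid c.tau)) := by
  rw [← Nat.card_sum]
  refine Nat.card_congr (Equiv.ofBijective (Quotient.lift (starVertex c) fun d d' h =>
    starVertex_eq_iff.2 h) ⟨fun a b => ?_, ?_⟩)
  · induction a using Quotient.ind
    induction b using Quotient.ind
    exact fun h => Quotient.sound (starVertex_eq_iff.1 h)
  · rintro (x | x)
    · exact ⟨⟦inn x⟧, rfl⟩
    · induction x using Quotient.ind with | _ x => ?_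
      exact ⟨⟦dn x⟧, rfl⟩

theorem card_starGraph_edge (c : Core p q) :
    Nat.card (starGraph c).Edge = 2 * Nat.card c.X := by
  have h1 := card_dart (starGraph c)
  have h2 : Nat.card (starGraph c).Dart = Nat.card (c.X ⊕ c.X ⊕ c.X ⊕ c.X) := Nat.card_congr
    { toFun := fun d => match d with
        | inn x => Sum.inl x
        | out x => Sum.inr (Sum.inl x)
        | up x => Sum.inr (Sum.inr (Sum.inl x))
        | dn x => Sum.inr (Sum.inr (Sum.inr x))
      invFun := Sum.elim inn (Sum.elim out (Sum.elim up dn))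
      left_inv := fun d => by cases d <;> rfl
      right_inv := by rintro (x | x | x | x) <;> rfl }
  rw [Nat.card_sum, Nat.card_sum, Nat.card_sum] at h2
  omega

theorem isIncoming_starGraph {d : StarDart c.X} :
    (starGraph c).IsIncoming d ↔ ∃ x, inn x = d := by
  constructor
  · rintro ⟨j, hj⟩
    rcases d with x | x | x | x
    · exact ⟨x, rfl⟩
    all_goals cases hj
  · rintro ⟨x, rfl⟩; exact ⟨_, rfl⟩

theorem mem_ghost_starGraph {d : StarDart c.X} :
    d ∈ (starGraph c).ghost ↔ ∃ x, d = up x ∨ d = dn x := by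
  change (¬ _ ∧ ¬ _) ↔ _
  rw [isIncoming_starGraph, isIncoming_starGraph]
  rcases d with x | x | x | x
  · simp
  · refine ⟨fun h => absurd ⟨x, rfl⟩ h.2, ?_⟩
    rintro ⟨y, h | h⟩ <;> cases h
  · refine ⟨fun _ => ⟨x, Or.inl rfl⟩, fun _ => ⟨?_, ?_⟩⟩ <;> rintro ⟨y, h⟩ <;> cases h
  · refine ⟨fun _ => ⟨x, Or.inr rfl⟩, fun _ => ⟨?_, ?_⟩⟩ <;> rintro ⟨y, h⟩ <;> cases h

theorem hasCore_starGraph (c : Core p q) : HasCore (starGraph c) c inn where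
  inj x y h := by cases h; rfl
  isIncoming_iff _ := isIncoming_starGraph
  bdry x := rfl
  next x := by
    have h1 : ∀ z, (out z : (starGraph c).Dart) ∈ ((starGraph c).ghost)ᶜ := fun z h => by
      obtain ⟨y, h | h⟩ := mem_ghost_starGraph.1 h <;> cases h
    refine .skip (fun h => h (mem_ghost_starGraph.2 ⟨x, Or.inl rfl⟩)) (.skip
      (fun h => h (mem_ghost_starGraph.2 ⟨c.tau x, Or.inr rfl⟩)) (.here ?_ (h1 _)))
    exact congrArg out (c.inn.symm_apply_apply _)
  label x := rfl
  label_rev x := rfl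

/-- The star graph has bivalent vertices at the centres of the stars with two edges. A centre of
valency one is excluded by `hne`. -/
theorem isWeakDiagram_starGraph (hc : c.IsLabelled) (hne : ∀ x, c.tau x ≠ x) (x₀ : c.X)
    (hconn : ∀ z, c.tau.SameCycle x₀ z ∨ c.tau.SameCycle (c.inn x₀) z)
    (hcard : (Nat.card (Quotient (Equiv.Perm.SameCycle.setoid c.tau)) : ℤ) - Nat.card c.X + (p + q)
      = 2 - 2 * g) : (starGraph c).IsWeakDiagram g := by
  have hb : ∀ d, (starGraph c).bdry.SameCycle d ((starGraph c).bdry d) := fun d =>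
    Equiv.Perm.sameCycle_apply_right.2 (.refl _ _)
  have hlab : ∀ d, (starGraph c).label ((starGraph c).bdry d) = (starGraph c).label d := by
    rintro (x | x | x | x)
    · exact congrArg Sum.inl (hc.li_inn x)
    · rfl
    · change Sum.inr (c.lo (c.inn.symm (c.inn (c.out x)))) = Sum.inr (c.lo x)
      rw [Equiv.symm_apply_apply, hc.lo_out]
    · rfl
  refine ⟨⟨inn x₀⟩, ?_, ?_, fun d d' => ⟨fun h => ?_, fun h => ?_⟩, ?_, ?_, ?_, ?_⟩
  · have h1 : ∀ x, (starGraph c).Joined Set.univ (inn x) (inn (c.tau x)) := by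
      intro x
      have a1 : ∀ x, (starGraph c).Joined Set.univ (inn x) (up x) := fun x =>
        joined_rot (Γ := starGraph c) (inn x)
      have a2 : ∀ x, (starGraph c).Joined Set.univ (up x) (dn x) := fun x =>
        joined_rev (Γ := starGraph c) (h := up x) trivial
      have a3 : (starGraph c).Joined Set.univ (dn x) (dn (c.tau x)) :=
        joined_rot (Γ := starGraph c) (dn x)
      exact ((a1 x).trans (a2 x)).trans (a3.trans ((a1 _).trans (a2 _)).symm)
    have h2 : ∀ x, (starGraph c).Joined Set.univ (inn x) (inn (c.inn x)) := fun x =>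
      joined_bdry trivial
    have h3 : ∀ x y, c.tau.SameCycle x y → (starGraph c).Joined Set.univ (inn x) (inn y) :=
      fun x y h => mem_of_sameCycle (W := {y | (starGraph c).Joined Set.univ (inn x) (inn y)})
        (fun z hz => hz.trans (h1 z)) h (.refl _)
    have h4 : ∀ z, (starGraph c).Joined Set.univ (inn x₀) (inn z) := fun z =>
      (hconn z).elim (h3 _ _) fun h => (h2 x₀).trans (h3 _ _ h)
    have h5 : ∀ d, (starGraph c).Joined Set.univ (inn x₀) d := by
      rintro (x | x | x | x)
      · exact h4 x
      · exact (h4 x).trans (joined_rev trivial)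
      · exact (h4 x).trans (joined_rot _)
      · exact ((h4 x).trans (joined_rot _)).trans (joined_rev trivial)
    exact fun h k => (h5 h).symm.trans (h5 k)
  · rintro (x | x | x | x) h
    · cases h
    · cases h
    · cases h
    · exact hne x (by injection h)
  · have h1 : ∀ d : StarDart c.X, (∃ x, d = inn x) ∨ ∃ x, (starGraph c).bdry.SameCycle d (out x) ∧
        (starGraph c).label d = Sum.inr (c.lo x) := by
      rintro (x | x | x | x)
      · exact Or.inl ⟨x, rfl⟩
      · exact Or.inr ⟨x, .refl _ _, rfl⟩
      · exact Or.inr ⟨x, (hb (out x)).symm, rfl⟩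
      · exact Or.inr ⟨c.inn.symm x, hb (dn x), rfl⟩
    rcases h1 d with ⟨x, rfl⟩ | ⟨x, hx, hx'⟩ <;> rcases h1 d' with ⟨y, rfl⟩ | ⟨y, hy, hy'⟩
    · exact (hasCore_starGraph c).sameCycle_inn_iff.2 ((hc.li_iff x y).1 (Sum.inl_injective h))
    · exact absurd (h.trans hy') Sum.inl_ne_inr
    · exact absurd (hx'.symm.trans h) Sum.inr_ne_inl
    · refine hx.trans (Equiv.Perm.SameCycle.trans ?_ hy.symm)
      refine (hasCore_starGraph c).sameCycle_out_iff.2 ((hc.lo_iff x y).1 ?_)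
      exact Sum.inr_injective (hx'.symm.trans (h.trans hy'))
  · exact (mem_of_sameCycle (W := {k | (starGraph c).label k = (starGraph c).label d})
      (fun z hz => (hlab z).trans hz) h rfl).symm
  · rintro (j | j)
    · obtain ⟨x, rfl⟩ := hc.li_surj j
      exact ⟨inn x, rfl⟩
    · obtain ⟨x, rfl⟩ := hc.lo_surj j
      exact ⟨out x, rfl⟩
  · rw [card_starGraph_vertex, card_starGraph_edge]
    push_cast
    linarith
  · intro h k hh hk hs
    obtain ⟨x, rfl⟩ := isIncoming_starGraph.1 hh
    obtain ⟨y, rfl⟩ := isIncoming_starGraph.1 hk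
    exact congrArg inn (Sum.inl_injective (starVertex_eq_iff.2 hs))
  · have key : ∀ x, ¬ (starGraph c).Joined ((starGraph c).ghost \ {up x, dn x}) (up x) (dn x) := by
      intro x hj
      have := hj.apply_eq (fun d => starVertex c d = Sum.inl x) (fun d => by
        rw [starVertex_rot]) ?_
      · have h1 : starVertex c (dn x) = Sum.inl x := this ▸ rfl
        exact Sum.inr_ne_inl h1
      · rintro d ⟨hd, hd'⟩
        obtain ⟨y, rfl | rfl⟩ := mem_ghost_starGraph.1 hd
        · refine propext ⟨fun h => absurd h Sum.inr_ne_inl, fun h => ?_⟩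
          obtain rfl : y = x := Sum.inl_injective h
          exact absurd (Or.inl rfl) hd'
        · refine propext ⟨fun h => ?_, fun h => absurd h Sum.inr_ne_inl⟩
          obtain rfl : y = x := Sum.inl_injective h
          exact absurd (Or.inr rfl) hd'
    intro h hh
    obtain ⟨x, rfl | rfl⟩ := mem_ghost_starGraph.1 hh
    · exact key x
    · intro hj
      refine key x (Joined.symm ?_)
      rw [Set.pair_comm]
      exact hj

/-- Bivalent vertices that do not lie on circles can be removed. -/
theorem HasCore.exists_isChordDiagram {i : c.X → G.Dart} (HC : HasCore G c i)
    (H : G.IsWeakDiagram g) (hne : ∀ x, c.tau x ≠ x) :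
    ∃ (G' : RibbonGraph (Fin p ⊕ Fin q)) (i' : c.X → G'.Dart), G'.IsChordDiagram g ∧
      HasCore G' c i' := by
  induction hn : Nat.card G.Dart using Nat.strong_induction_on generalizing G with
  | _ n ih =>
  by_cases hb : ∃ h, G.rot (G.rot h) = h
  · obtain ⟨h, hh⟩ := hb
    -- A bivalent vertex between two consecutive edges of a circle would be a fixed point of `tau`.
    have hcirc : ∀ x, G.rot (G.rot (i x)) ≠ i x := by
      intro x hx
      obtain ⟨z, rfl⟩ := c.inn.surjective x
      have h1 : G.rot (i (c.inn z)) = G.rev (i z) := by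
        apply G.rot.injective
        rw [hx, HC.rot_rev]
      have h2 := (HC.next (c.inn z)).eq_of_mem (by
        rw [← rot_eq, h1]; exact HC.rev_not_mem_ghost z)
      rw [← rot_eq, h1] at h2
      apply hne (c.inn z)
      rw [Core.tau_apply, ← HC.inj (G.rev_injective h2)]
    have hnot : ∀ k, G.rot.SameCycle h k → ¬ G.IsIncoming k := by
      intro k hk hk'
      obtain ⟨x, rfl⟩ := (HC.isIncoming_iff k).1 hk'
      refine hcirc x (mem_of_sameCycle (W := {k | G.rot (G.rot k) = k}) (fun a ha => ?_) hk hh)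
      exact congrArg G.rot ha
    have hg : h ∈ G.ghost := by
      refine ⟨hnot h (.refl _ _), fun hr => ?_⟩
      obtain ⟨x, hx⟩ := (HC.isIncoming_iff _).1 hr
      refine hnot (G.rot h) (Equiv.Perm.sameCycle_apply_right.2 (.refl _ _)) ?_
      rw [(rev_eq_iff.1 hx.symm : h = G.rev (i x)), HC.rot_rev]
      exact HC.isIncoming _
    have hw := H.contract (H.forest.not_sameCycle hg) (fun k _ hk _ _ _ hs _ =>
      hnot k hs.symm hk) (Or.inl hg)
    have := card_contract_dart h
    exact ih _ (by omega) (HC.contract hg H.label_bdry) hw rfl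
  · push Not at hb
    exact ⟨G, i, isChordDiagram_iff.2 ⟨H, hb⟩, HC⟩

theorem _root_.StringTopology.Core.IsOneVertex.exists_isChordDiagram (hc : c.IsOneVertex)
    (hcard : Nat.card c.X + 1 = 2 * g + p + q) (h2 : 2 ≤ Nat.card c.X) :
    ∃ (G : RibbonGraph (Fin p ⊕ Fin q)) (i : c.X → G.Dart), G.IsChordDiagram g ∧ HasCore G c i := by
  have : Nontrivial c.X := Finite.one_lt_card_iff_nontrivial.1 h2
  obtain ⟨x₀⟩ := this.to_nonempty
  have hne : ∀ x, c.tau x ≠ x := by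
    intro x hx
    obtain ⟨y, hy⟩ := exists_ne x
    exact hy (mem_of_sameCycle (W := {y | y = x}) (by rintro a rfl; exact hx)
      (hc.tau_sameCycle x y) rfl)
  refine (hasCore_starGraph c).exists_isChordDiagram (isWeakDiagram_starGraph hc.toIsLabelled hne x₀
    (fun z => Or.inl (hc.tau_sameCycle _ _)) ?_) hne
  have : Nat.card (Quotient (Equiv.Perm.SameCycle.setoid c.tau)) = 1 := by
    rw [Nat.card_eq_one_iff_unique]
    refine ⟨⟨fun a b => ?_⟩, ⟨⟦x₀⟧⟩⟩
    induction a using Quotient.ind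
    induction b using Quotient.ind
    exact Quotient.sound (hc.tau_sameCycle _ _)
  rw [this]
  have h3 : (Nat.card c.X : ℤ) + 1 = 2 * g + p + q := by exact_mod_cast hcard
  push_cast
  linarith

theorem _root_.StringTopology.Core.Splits.exists_isChordDiagram {x : c.X} (hx : c.Splits x)
    (hc : c.IsLabelled) (hne : ∀ x, c.tau x ≠ x) (hcard : Nat.card c.X = 2 * g + p + q) :
    ∃ (G : RibbonGraph (Fin p ⊕ Fin q)) (i : c.X → G.Dart), G.IsChordDiagram g ∧ HasCore G c i := by
  refine (hasCore_starGraph c).exists_isChordDiagram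
    (isWeakDiagram_starGraph hc hne x hx.two ?_) hne
  have : Nat.card (Quotient (Equiv.Perm.SameCycle.setoid c.tau)) = 2 := by
    rw [Nat.card_eq_two_iff]
    refine ⟨⟦x⟧, ⟦c.inn x⟧, fun h => hx.not_loop (Quotient.exact h), ?_⟩
    refine Set.eq_univ_of_forall fun a => ?_
    induction a using Quotient.ind with | _ a => ?_
    exact (hx.two a).imp (fun h => Quotient.sound h.symm) fun h => Quotient.sound h.symm
  rw [this, hcard]
  push_cast
  ring

/-! ### Linking all chord diagrams -/

/-- A step between cores is realized by contracting two different edges of a reduced diagram. -/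
theorem linked_of_adjacent {G' : RibbonGraph (Fin p ⊕ Fin q)} {i : c.X → G.Dart} {i' : c'.X → G'.Dart}
    (h : Core.Adjacent c c') (hcard : Nat.card c.X + 1 = 2 * g + p + q)
    (HC : HasCore G c i) (H : G.IsChordDiagram g) (HC' : HasCore G' c' i')
    (H' : G'.IsChordDiagram g) : Linked g G G' := by
  rcases h.cases with ⟨⟨f⟩⟩ | ⟨e, x, y, j, j', he, h1, h2, hx, hy, -, hne⟩
  · exact HC.linked H (HC'.comp_iso f) H'
  · obtain ⟨E₀, k₀, hE₀, hk₀⟩ := hx.exists_isChordDiagram (g := g) he hne (by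
      have := h1.card; omega)
    obtain ⟨E, k, hE, hk, -, hR⟩ := hk₀.exists_isReduced hE₀
    obtain ⟨k₁, hk₁⟩ := hk.contract_del h1 hx.inn_ne hx.out_ne
    obtain ⟨k₂, hk₂⟩ := hk.contract_del h2 hy.inn_ne hy.out_ne
    have c1 := hR.contracts hk hE hx.not_loop
    have c2 := hR.contracts hk hE hy.not_loop
    exact (HC.linked H hk₁ c1.right).trans _ _ _ ((c1.linked.symm _ _).trans _ _ _
      (c2.linked.trans _ _ _ (hk₂.linked c2.right HC' H')))

/-- The intermediate one-vertex cores are realized by diagrams too, so the links can be put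
together. -/
theorem linked_of_related (h : Core.Related c c') (hc : c.IsOneVertex)
    (hcard : Nat.card c.X + 1 = 2 * g + p + q) (h2 : 2 ≤ Nat.card c.X) :
    ∀ {G G' : RibbonGraph (Fin p ⊕ Fin q)} {i : c.X → G.Dart} {i' : c'.X → G'.Dart},
      HasCore G c i → G.IsChordDiagram g → HasCore G' c' i' → G'.IsChordDiagram g →
      Linked g G G' := by
  induction h with
  | rel c c' h => exact fun HC H HC' H' => linked_of_adjacent h hcard HC H HC' H'
  | refl => exact fun HC H HC' H' => HC.linked H HC' H'
  | symm c c' h ih =>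
    have e := Core.Related.card_eq h
    intro G G' i i' HC H HC' H'
    exact (ih ((Core.Related.isOneVertex_iff h).2 hc) (by rwa [e]) (by rwa [e])
      HC' H' HC H).symm _ _
  | trans c c₁ c' h _ ih ih' =>
    have e := Core.Related.card_eq h
    rw [e] at hcard h2
    have hc₁ := (Core.Related.isOneVertex_iff h).1 hc
    obtain ⟨G₁, i₁, H₁, HC₁⟩ := hc₁.exists_isChordDiagram hcard h2
    intro G G' i i' HC H HC' H'
    exact (ih hc (by rwa [e]) (by rwa [e]) HC H HC₁ H₁).trans _ _ _
      (ih' hc₁ hcard h2 HC₁ H₁ HC' H')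

theorem linked_of_isChordDiagram {G G' : RibbonGraph (Fin (p + 1) ⊕ Fin (q + 1))}
    (hgpq : ¬ (g = 0 ∧ p = 0 ∧ q = 0)) (H : G.IsChordDiagram g) (H' : G'.IsChordDiagram g) :
    Linked g G G' := by
  obtain ⟨c, i, HC⟩ := H.weak.exists_hasCore
  obtain ⟨c', i', HC'⟩ := H'.weak.exists_hasCore
  obtain ⟨G₁, c₁, i₁, h1, h2, h3, h4, h5⟩ := HC.exists_isOneVertex H
  obtain ⟨G₁', c₁', i₁', h1', h2', h3', h4', h5'⟩ := HC'.exists_isOneVertex H'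
  have hr := Core.related_of_card_eq p q c₁ c₁' h4 h4' (by omega)
  exact h3.trans _ _ _ ((linked_of_related hr h4 h5 (by omega) h2 h1 h2' h1').trans _ _ _
    (h3'.symm _ _))

theorem exists_isChordDiagram (hgpq : ¬ (g = 0 ∧ p = 0 ∧ q = 0)) :
    ∃ G : RibbonGraph (Fin (p + 1) ⊕ Fin (q + 1)), G.IsChordDiagram g := by
  obtain ⟨c, hc, hcard⟩ := Core.exists_isOneVertex g p q
  obtain ⟨G, -, H, -⟩ := hc.exists_isChordDiagram (g := g) (by omega) (by omega)
  exact ⟨G, H⟩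

end RibbonGraph

end StringTopology

theorem mainTheorem4 (g p q : ℕ) (hp : 1 ≤ p) (hq : 1 ≤ q) (hgpq : ¬ (g = 0 ∧ p = 1 ∧ q = 1)) :
    PathConnectedSpace (StringTopology.MarkedChordDiagramSpace g p q) := by
  obtain ⟨p, rfl⟩ := Nat.exists_eq_add_of_le' hp
  obtain ⟨q, rfl⟩ := Nat.exists_eq_add_of_le' hq
  have h : ¬ (g = 0 ∧ p = 0 ∧ q = 0) := by omega
  exact StringTopology.pathConnectedSpace_of_linked
    (StringTopology.RibbonGraph.exists_isChordDiagram h)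
    fun _ _ H H' => StringTopology.RibbonGraph.linked_of_isChordDiagram h H H'
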